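/- Let $n\ge 1$ be an integer and let $c_0>0$, $\beta>\tfrac13$, $\nu_0>0$, $\alpha_p>0$, $\gamma>1$, $D>0$ be real constants. Consider the Cauchy problem for the real-valued velocity potential $\phi=\phi(t,x)$ and temperature $T=T(t,x)$, $x\in\mathbb{R}^n$, $t>0$, $$\begin{cases}\phi_{tt}-c_0^2\Delta\phi-(1+\beta)\nu_0\Delta\phi_t+\alpha_pc_0^2T_t=0,\\ T_t-\gamma D\Delta T+\dfrac{\gamma-1}{\alpha_p}\Delta\phi=0,\\ \phi(0,\cdot)=\phi_0,\quad \phi_t(0,\cdot)=\phi_1,\quad T(0,\cdot)=T_0,\end{cases}$$ with $\phi_0,\phi_1,T_0\in L^2(\mathbb{R}^n)\cap L^1(\mathbb{R}^n)$. A solution is a pair $\phi\in C^1([0,\infty),L^2)$, $T\in C([0,\infty),L^2)$ that attains the initial data and satisfies the two equations for $t>0$ in the sense of tempered distributions in $x$: for every Schwartz function $\eta$, writing $\langle f,\eta\rangle=\int f\eta\,dx$, $$\frac{d}{dt}\big(\langle\phi_t,\eta\rangle+\alpha_pc_0^2\langle T,\eta\rangle\big)=c_0^2\langle\phi,\Delta\eta\rangle+(1+\beta)\nu_0\langle\phi_t,\Delta\eta\rangle,\qquad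 \frac{d}{dt}\langle T,\eta\rangle=\gamma D\langle T,\Delta\eta\rangle-\frac{\gamma-1}{\alpha_p}\langle\phi,\Delta\eta\rangle .$$ Put $P_{\phi_1}=\int_{\mathbb{R}^n}\phi_1\,dx$, $\|f\|_{L^2\cap L^1}=\|f\|_{L^2}+\|f\|_{L^1}$, and $$\mathcal A_n(t)=\begin{cases}\sqrt t,&n=1,\\ \sqrt{\ln t},&n=2,\\ t^{\frac12-\frac n4},&n\ge3.\end{cases}$$ For all such data there is exactly one solution $(\phi,T)$. Moreover there are constants $c,C>0$ and $t_1>1$, depending only on $n,c_0,\beta,\nu_0,\alpha_p,\gamma,D$, such that for all such data the solution satisfies $$\|\phi(t,\cdot)\|_{L^2}\le C\,\mathcal A_n(t)\big(\|\phi_0\|_{L^2\cap L^1}+\|\phi_1\|_{L^2\cap L^1}+\|T_0\|_{L^2\cap L^1}\big)\qquad\text{for all }t\ge t_1,$$ and, if $P_{\phi_1}\ne0$, there is $t_0>1$, which may depend on the data, with $$c\,\mathcal A_n(t)\,|P_{\phi_1}|\le\|\phi(t,\cdot)\|_{L^2}\qquad\text{for all }t\ge t_0 .$$ In particular, if $P_{\phi_1}\neq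 0$, then $\|\phi(t,\cdot)\|_{L^2}\simeq\mathcal A_n(t)$ as $t\to\infty$, with implied constants that may depend on the data. -/

import Mathlib

open MeasureTheory Set Filter Asymptotics
open scoped SchwartzMap Laplacian

noncomputable section

/-- The physical constants of the thermoviscous acoustic system. -/
structure AcousticParams where
  /-- isothermal speed of sound `c₀ > 0` -/
  c₀ : ℝ
  /-- viscosity ratio `β = ηᵇ / ηˢ + 1/3` with `ηˢ, ηᵇ > 0`, i.e. `β > 1/3` -/
  β : ℝ
  /-- momentum diffusion constant `ν₀ > 0` -/
  ν₀ : ℝ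
  /-- isobaric thermal expansion coefficient `α_p > 0` -/
  αp : ℝ
  /-- ratio of the specific heat capacities `γ = c_P / c_V > 1` -/
  γ : ℝ
  /-- thermal diffusion constant `D_Th > 0` -/
  D : ℝ
  c₀_pos : 0 < c₀
  β_gt : 1 / 3 < β
  ν₀_pos : 0 < ν₀
  αp_pos : 0 < αp
  γ_gt : 1 < γ
  D_pos : 0 < D

/-- The real Hilbert space `L²(ℝⁿ)`. -/
abbrev L2 (n : ℕ) : Type := Lp ℝ 2 (volume : Measure (EuclideanSpace ℝ (Fin n)))

/-- Membership in `L²(ℝⁿ) ∩ L¹(ℝⁿ)`. -/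
def MemL1L2 {n : ℕ} (f : EuclideanSpace ℝ (Fin n) → ℝ) : Prop :=
  MemLp f 1 volume ∧ MemLp f 2 volume

/-- The norm `‖f‖_{L² ∩ L¹} = ‖f‖_{L¹} + ‖f‖_{L²}`. -/
def normL1L2 {n : ℕ} (f : EuclideanSpace ℝ (Fin n) → ℝ) : ℝ :=
  (eLpNorm f 1 volume).toReal + (eLpNorm f 2 volume).toReal

/-- The action `∫ f η dx` of a real `L²` function, seen as a tempered distribution, on a
(complex-valued) Schwartz test function. -/
def pairing {n : ℕ} (f : L2 n) (η : 𝓢(EuclideanSpace ℝ (Fin n), ℂ)) : ℂ :=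
  ∫ x, (f x : ℂ) * η x

/-- `(φ, φt, T)` is a solution on `[0, ∞)` of the Cauchy problem
* `φ_tt - c₀² Δφ - (1 + β) ν₀ Δφ_t + α_p c₀² T_t = 0`,
* `T_t - γ D Δ T + ((γ - 1) / α_p) Δ φ = 0`,
* `φ(0) = φ₀`, `φ_t(0) = φ₁`, `T(0) = T₀`,

in the class `φ ∈ C¹([0, ∞), L²)`, `T ∈ C([0, ∞), L²)`, with `φt` the time derivative of `φ`.
The two equations hold in the sense of (tempered) distributions in `x`: all space derivatives are
put on a test function. Only the values of the three curves at times `t ≥ 0` matter. -/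
structure IsSolution {n : ℕ} (p : AcousticParams)
    (φ₀ φ₁ T₀ : EuclideanSpace ℝ (Fin n) → ℝ) (φ φt T : ℝ → L2 n) : Prop where
  hasDeriv : ∀ t, 0 ≤ t → HasDerivWithinAt φ (φt t) (Ici 0) t
  continuous_φt : ContinuousOn φt (Ici 0)
  continuous_T : ContinuousOn T (Ici 0)
  init_φ : φ 0 =ᵐ[volume] φ₀
  init_φt : φt 0 =ᵐ[volume] φ₁
  init_T : T 0 =ᵐ[volume] T₀
  eq_φ : ∀ η : 𝓢(EuclideanSpace ℝ (Fin n), ℂ), ∀ t, 0 < t →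
    HasDerivAt (fun s => pairing (φt s) η + ((p.αp * p.c₀ ^ 2 : ℝ) : ℂ) * pairing (T s) η)
      (((p.c₀ ^ 2 : ℝ) : ℂ) * pairing (φ t) (Δ η)
        + (((1 + p.β) * p.ν₀ : ℝ) : ℂ) * pairing (φt t) (Δ η)) t
  eq_T : ∀ η : 𝓢(EuclideanSpace ℝ (Fin n), ℂ), ∀ t, 0 < t →
    HasDerivAt (fun s => pairing (T s) η)
      (((p.γ * p.D : ℝ) : ℂ) * pairing (T t) (Δ η)
        - (((p.γ - 1) / p.αp : ℝ) : ℂ) * pairing (φ t) (Δ η)) t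

/-- The rate `𝒜ₙ(t)`: `√t` for `n = 1`, `√(ln t)` for `n = 2`, `t^{1/2 - n/4}` for `n ≥ 3`. -/
def growthRate (n : ℕ) (t : ℝ) : ℝ :=
  if n = 1 then √t
  else if n = 2 then √(Real.log t)
  else t ^ ((1 : ℝ) / 2 - (n : ℝ) / 4)

end

/-! Put s = 4π²|ξ|² and r = √s. After a Fourier transform in x the system becomes a 3×3 linear ODE
at each frequency. Use the heat equation to eliminate T_t, and replace the temperature by z =
(γ-1)φ_t + γ α_p c₀² T. The potential then drops out of the equation for z: with f = φ̂ and g = f',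
one has g' = s(-W f - B g + D z) and z' = s(-D z + q g) (`IsMode`). For every choice of the physical
constants some weight ν makes g² + ν z² strictly dissipated (`AcousticParams.modeCoeff`). Everything
after that is an energy estimate on this ODE; no characteristic roots are expanded.

Existence: `ModeCoeff.exists_growth_bound` controls the mode flow on bounded time intervals
uniformly in s, so the flow acts by bounded Fourier multipliers on L². Uniqueness: truncation to a
ball of frequencies turns the weak system into an ODE with a bounded generator
(`IsFourierSolution.eq_zero`).

Upper bound: high frequencies decay exponentially (`ModeCoeff.exists_decay_bound`). At low frequency
the squared multipliers are at most a constant times s⁻¹ exp(-δst), and also at most a constant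
times (1+t)². Integrating the smaller of the two over ℝⁿ gives t, log t or t^{-(n-2)/2}, the square
of 𝒜ₙ(t). Here the data enter through sup |φ̂₀| ≤ ‖φ₀‖_{L¹}, and likewise for φ₁ and T₀.

Lower bound: where r and r²t are small, the contributions of φ₀ and T₀ stay bounded, while that of
φ₁ is close to φ̂₁(ξ) sin(√W r t)/(√W r), with φ̂₁(0) = P (`ModeCoeff.exists_oscillator_approx`).
Writing 2 sin² = 1 - cos and integrating by parts against the cosine over a shell |ξ| ≤ ε/√t leaves
a fixed fraction of the non-oscillating integral, which has size 𝒜ₙ(t)². -/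

/-! ### Elementary inequalities. -/

/-- Differential form of Grönwall's inequality on the half line. -/
theorem le_exp_mul_of_hasDerivAt_le {E E' : ℝ → ℝ} {k : ℝ} (hE : ∀ t, HasDerivAt E (E' t) t)
    (hk : ∀ t, E' t ≤ k * E t) {t : ℝ} (ht : 0 ≤ t) : E t ≤ Real.exp (k * t) * E 0 := by
  have hd : ∀ τ, HasDerivAt (fun τ => Real.exp (-k * τ) * E τ)
      (Real.exp (-k * τ) * (-k * 1) * E τ + Real.exp (-k * τ) * E' τ) τ := fun τ =>
    (((hasDerivAt_id τ).const_mul (-k)).exp).mul (hE τ)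
  have hanti : Antitone (fun τ => Real.exp (-k * τ) * E τ) := by
    apply antitone_of_deriv_nonpos (fun τ => (hd τ).differentiableAt)
    intro τ
    rw [(hd τ).deriv]
    nlinarith [hk τ, Real.exp_pos (-k * τ)]
  have h := hanti ht
  simp only [mul_zero, Real.exp_zero, one_mul] at h
  have h1 : Real.exp (k * t) * (Real.exp (-k * t) * E t) = E t := by
    rw [← mul_assoc, ← Real.exp_add]; simp
  rw [← h1]
  exact mul_le_mul_of_nonneg_left h (Real.exp_pos _).le

theorem exists_pos_mul_le {A₁ A₂ A₃ B₁ B₂ B₃ : ℝ} (hA₁ : 0 < A₁) (hA₂ : 0 < A₂) (hA₃ : 0 < A₃)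
    (hB₁ : 0 < B₁) (hB₂ : 0 < B₂) (hB₃ : 0 < B₃) :
    ∃ x : ℝ, 0 < x ∧ x * A₁ ≤ B₁ ∧ x * A₂ ≤ B₂ ∧ x * A₃ ≤ B₃ := by
  refine ⟨min (min (B₁ / A₁) (B₂ / A₂)) (B₃ / A₃), by positivity, ?_, ?_, ?_⟩
  · rw [← le_div_iff₀ hA₁]; exact (min_le_left _ _).trans (min_le_left _ _)
  · rw [← le_div_iff₀ hA₂]; exact (min_le_left _ _).trans (min_le_right _ _)
  · rw [← le_div_iff₀ hA₃]; exact min_le_right _ _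

/-- A binary quadratic form with negative discriminant is coercive. -/
theorem exists_coercive_of_discrim_neg {a b c : ℝ} (ha : 0 < a) (hc : 0 < c)
    (h : b ^ 2 < 4 * a * c) :
    ∃ δ : ℝ, 0 < δ ∧ ∀ x y : ℝ, δ * (x ^ 2 + y ^ 2) ≤ a * x ^ 2 + b * x * y + c * y ^ 2 := by
  have hac : 0 < a + c := by positivity
  -- With this value 4(a-δ)(c-δ) - b² = 4δ², so completing the square leaves the perfect square
  -- (2δy)².
  set δ := (4 * a * c - b ^ 2) / (4 * (a + c)) with hδ
  have hδe : δ * (4 * (a + c)) = 4 * a * c - b ^ 2 := by rw [hδ]; field_simp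
  have hδa : 0 < a - δ := by
    by_contra hcon
    nlinarith [sq_nonneg b, mul_pos ha ha]
  refine ⟨δ, by apply div_pos <;> linarith, fun x y => ?_⟩
  have key : 0 ≤ 4 * (a - δ) * ((a - δ) * x ^ 2 + b * x * y + (c - δ) * y ^ 2) := by
    have : 4 * (a - δ) * ((a - δ) * x ^ 2 + b * x * y + (c - δ) * y ^ 2)
        = (2 * (a - δ) * x + b * y) ^ 2 + (2 * δ * y) ^ 2 := by
      linear_combination (-y ^ 2) * hδe
    rw [this]; positivity
  have := nonneg_of_mul_nonneg_right key (by positivity)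
  linarith

/-- These are the terms without the factor s in the derivative of the shifted energy f² + (g + a f)²
+ ν(z + e f)²; the constant must not involve the frequency. -/
theorem lower_order_le {ν : ℝ} (hν : 0 ≤ ν) (a e x Y Z : ℝ) :
    2 * x * (Y - a * x) + 2 * Y * (a * (Y - a * x)) + ν * (2 * Z * (e * (Y - a * x))) ≤
      (3 + 4 * |a| + a ^ 2 + ν * e ^ 2 + ν * e ^ 2 * a ^ 2) * (x ^ 2 + Y ^ 2 + ν * Z ^ 2) := by
  have t1 : 2 * x * (Y - a * x) ≤ (1 + 2 * |a|) * (x ^ 2 + Y ^ 2) := by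
    nlinarith [sq_nonneg (x - Y), mul_le_mul_of_nonneg_right (neg_abs_le a) (sq_nonneg x),
      mul_nonneg (abs_nonneg a) (sq_nonneg Y)]
  have t2 : 2 * Y * (a * (Y - a * x)) ≤ (2 * |a| + a ^ 2) * (x ^ 2 + Y ^ 2) := by
    nlinarith [mul_nonneg (sq_nonneg a) (sq_nonneg (x + Y)),
      mul_le_mul_of_nonneg_right (le_abs_self a) (sq_nonneg Y),
      mul_nonneg (abs_nonneg a) (sq_nonneg x)]
  have t3 : 2 * Z * (e * (Y - a * x)) ≤ 2 * Z ^ 2 + e ^ 2 * Y ^ 2 + e ^ 2 * a ^ 2 * x ^ 2 := by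
    nlinarith [sq_nonneg (Z - e * Y), sq_nonneg (Z + e * a * x)]
  have t4 := mul_le_mul_of_nonneg_left t3 hν
  have t5 : 0 ≤ ν * e ^ 2 * (x ^ 2 + ν * Z ^ 2) + ν * e ^ 2 * a ^ 2 * (Y ^ 2 + ν * Z ^ 2)
      + 2 * x ^ 2 + 2 * Y ^ 2 + (1 + 4 * |a| + a ^ 2) * (ν * Z ^ 2) := by positivity
  linear_combination t1 + t2 + t4 + t5

/-! ### Energy estimates for a single Fourier mode. -/

/-- One Fourier mode of the acoustic system, for the potential `f`, its time derivative `g` and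
the combination `z` of temperature and `g` that does not see the acoustic oscillation at leading
order; `s` is the squared frequency. -/
structure IsMode (W B D q s : ℝ) (f g z : ℝ → ℝ) : Prop where
  deriv_f : ∀ t, HasDerivAt f (g t) t
  deriv_g : ∀ t, HasDerivAt g (s * (-W * f t - B * g t + D * z t)) t
  deriv_z : ∀ t, HasDerivAt z (s * (-D * z t + q * g t)) t

/-- The condition on the coefficients of `IsMode` which makes `g² + ν z²` strictly dissipated. -/
structure ModeCoeff (W B D q ν : ℝ) : Prop where
  W_pos : 0 < W
  D_pos : 0 < D
  ν_pos : 0 < ν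
  discrim : (D + ν * q) ^ 2 < 4 * B * (ν * D)

namespace ModeCoeff

variable {W B D q ν : ℝ} (h : ModeCoeff W B D q ν)

include h

theorem B_pos : 0 < B := by
  by_contra hB
  nlinarith [h.discrim, sq_nonneg (D + ν * q), mul_pos h.ν_pos h.D_pos]

/-- Since (D + νq)² ≥ 4Dνq, the discriminant condition forces νDq < νDB. -/
theorem q_lt_B : q < B := by
  by_contra hB
  nlinarith [h.discrim, sq_nonneg (D - ν * q), mul_pos h.ν_pos h.D_pos]

/-- Up to the factor -2s, this form is what the g- and z-terms contribute to the derivative of g² +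
ν z². -/
theorem exists_coercive : ∃ δ : ℝ, 0 < δ ∧ ∀ x y : ℝ,
    δ * (x ^ 2 + y ^ 2) ≤ B * x ^ 2 + -(D + ν * q) * x * y + ν * D * y ^ 2 :=
  exists_coercive_of_discrim_neg h.B_pos (mul_pos h.ν_pos h.D_pos) (by
    have := h.discrim; nlinarith)

/-- Growth bound for a mode that is uniform in the frequency. -/
theorem exists_growth_bound : ∃ C K : ℝ, 0 < C ∧ ∀ s f g z, 0 ≤ s → IsMode W B D q s f g z →
    ∀ t, 0 ≤ t → f t ^ 2 + g t ^ 2 + z t ^ 2 ≤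
      C * Real.exp (K * t) * (f 0 ^ 2 + g 0 ^ 2 + z 0 ^ 2) := by
  obtain ⟨δ, hδ, hQ⟩ := h.exists_coercive
  have hν := h.ν_pos
  -- The vector (1, -a, -e) in (f, g, z) is annihilated by the part of the generator proportional to
  -- s. In the variables g + a f and z + e f the unbounded factor s therefore multiplies only the
  -- dissipative quadratic form.
  set a := W / (B - q) with ha
  set e := q / D * a with he
  have hqB : B - q ≠ 0 := (sub_pos.2 h.q_lt_B).ne'
  have hW : W = a * (B - q) := by rw [ha]; field_simp
  have hDe : D * e = q * a := by rw [he]; have := h.D_pos.ne'; field_simp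
  -- `f² + (g + a f)² + ν (z + e f)²` grows at most exponentially
  set K := 3 + 4 * |a| + a ^ 2 + ν * e ^ 2 + ν * e ^ 2 * a ^ 2 with hK
  have lower : ∃ C₁ > 0, ∀ x y w : ℝ,
      x ^ 2 + y ^ 2 + w ^ 2 ≤ C₁ * (x ^ 2 + (y + a * x) ^ 2 + ν * (w + e * x) ^ 2) := by
    refine ⟨1 + 2 + 2 * a ^ 2 + 2 / ν + 2 * e ^ 2, by positivity, fun x y w => ?_⟩
    have h1 : y ^ 2 ≤ 2 * (y + a * x) ^ 2 + 2 * a ^ 2 * x ^ 2 := by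
      nlinarith [sq_nonneg (y + a * x + a * x)]
    have h2 : w ^ 2 ≤ 2 * (w + e * x) ^ 2 + 2 * e ^ 2 * x ^ 2 := by
      nlinarith [sq_nonneg (w + e * x + e * x)]
    have h3 : 2 * (w + e * x) ^ 2 = 2 / ν * (ν * (w + e * x) ^ 2) := by field_simp
    rw [h3] at h2
    set X := x ^ 2
    set Y := (y + a * x) ^ 2
    set Z := ν * (w + e * x) ^ 2
    have hX : 0 ≤ X := by positivity
    have hY : 0 ≤ Y := by positivity
    have hZ : 0 ≤ Z := by positivity
    have hν2 : 0 < 2 / ν := by positivity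
    have : 0 ≤ (1 + 2 / ν) * Y + 2 * a ^ 2 * (Y + Z) + 2 * e ^ 2 * (Y + Z) + 3 * Z + 2 * X
      + 2 / ν * X := by positivity
    nlinarith
  have upper : ∃ C₂ > 0, ∀ x y w : ℝ,
      x ^ 2 + (y + a * x) ^ 2 + ν * (w + e * x) ^ 2 ≤ C₂ * (x ^ 2 + y ^ 2 + w ^ 2) := by
    refine ⟨1 + 2 + 2 * a ^ 2 + 2 * ν + 2 * ν * e ^ 2, by positivity, fun x y w => ?_⟩
    have h1 : (y + a * x) ^ 2 ≤ 2 * y ^ 2 + 2 * a ^ 2 * x ^ 2 := by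
      nlinarith [sq_nonneg (y - a * x)]
    have h2 : ν * (w + e * x) ^ 2 ≤ ν * (2 * w ^ 2 + 2 * e ^ 2 * x ^ 2) := by
      apply mul_le_mul_of_nonneg_left _ hν.le
      nlinarith [sq_nonneg (w - e * x)]
    have : 0 ≤ 2 * a ^ 2 * (y ^ 2 + w ^ 2) + 2 * ν * (x ^ 2 + y ^ 2)
      + 2 * ν * e ^ 2 * (y ^ 2 + w ^ 2) + 2 * x ^ 2 + y ^ 2 + 3 * w ^ 2 := by positivity
    nlinarith
  obtain ⟨C₁, hC₁, hlow⟩ := lower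
  obtain ⟨C₂, hC₂, hup⟩ := upper
  refine ⟨C₁ * C₂, K, by positivity, fun s f g z hs hm t ht => ?_⟩
  set F : ℝ → ℝ := fun t => f t ^ 2 + (g t + a * f t) ^ 2 + ν * (z t + e * f t) ^ 2
  have hF : ∀ t, HasDerivAt F (2 * f t * g t
      + 2 * (g t + a * f t) * (s * (-W * f t - B * g t + D * z t) + a * g t)
      + ν * (2 * (z t + e * f t) * (s * (-D * z t + q * g t) + e * g t))) t := fun t => by
    have h1 := (hm.deriv_f t).pow 2
    have h2 := ((hm.deriv_g t).add ((hm.deriv_f t).const_mul a)).pow 2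
    have h3 := (((hm.deriv_z t).add ((hm.deriv_f t).const_mul e)).pow 2).const_mul ν
    refine ((h1.add h2).add h3).congr_deriv ?_
    simp
  have hbound := le_exp_mul_of_hasDerivAt_le (k := K) hF (fun τ => ?_) ht
  · calc _ ≤ C₁ * F t := hlow _ _ _
      _ ≤ C₁ * (Real.exp (K * t) * F 0) := by gcongr
      _ ≤ C₁ * (Real.exp (K * t) * (C₂ * (f 0 ^ 2 + g 0 ^ 2 + z 0 ^ 2))) := by
        gcongr; exact hup _ _ _
      _ = _ := by ring
  · change _ ≤ K * (f τ ^ 2 + (g τ + a * f τ) ^ 2 + ν * (z τ + e * f τ) ^ 2)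
    generalize f τ = x
    generalize g τ = y
    generalize z τ = w
    set Y := y + a * x with hY
    set Z := w + e * x with hZ
    have hy : y = Y - a * x := by rw [hY]; ring
    have hw : w = Z - e * x := by rw [hZ]; ring
    have e1 : -W * x - B * y + D * w = -B * Y + D * Z := by
      rw [hy, hw]; linear_combination (-x) * hW - x * hDe
    have e2 : -D * w + q * y = -D * Z + q * Y := by
      rw [hy, hw]; linear_combination x * hDe
    rw [e1, e2]
    have hd := hQ Y Z
    have hdis : 2 * Y * (s * (-B * Y + D * Z)) + ν * (2 * Z * (s * (-D * Z + q * Y))) ≤ 0 := by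
      have : 0 ≤ s * (B * Y ^ 2 + -(D + ν * q) * Y * Z + ν * D * Z ^ 2) :=
        mul_nonneg hs (le_trans (by positivity) hd)
      nlinarith
    have := lower_order_le hν.le a e x Y Z
    rw [hK]
    linear_combination hdis + this + (2 * x + 2 * a * Y + 2 * ν * e * Z) * hy

end ModeCoeff

/-- The energy W s f² + g² + ν z² does not dissipate f. Differentiating the cross term 2κχfg
supplies the missing -κWχs f², at the price of g² and z² terms that a small κ makes absorbable. -/
theorem dissipation_le {W B D κ χ s x y w : ℝ} (hW : 0 < W) (hκ : 0 ≤ κ) (hs : 0 ≤ s)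
    (hχ : 0 ≤ χ) (hχs : χ ≤ s) (hχ1 : χ ≤ 1) :
    2 * κ * χ * (y ^ 2 + x * (s * (-W * x - B * y + D * w))) ≤
      -κ * W * χ * s * x ^ 2 + 2 * κ * s * (1 + B ^ 2 / W + D ^ 2 / W) * (y ^ 2 + w ^ 2) := by
  have h1 : x * (-B * y + D * w) ≤ W / 2 * x ^ 2 + B ^ 2 / W * y ^ 2 + D ^ 2 / W * w ^ 2 := by
    have e : W / 2 * x ^ 2 + B ^ 2 / W * y ^ 2 + D ^ 2 / W * w ^ 2 - x * (-B * y + D * w)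
        = W * ((x / 2 + B / W * y) ^ 2 + (x / 2 - D / W * w) ^ 2) := by field_simp; ring
    have : 0 ≤ W * ((x / 2 + B / W * y) ^ 2 + (x / 2 - D / W * w) ^ 2) := by positivity
    linarith
  have h2 : κ * χ * s * (x * (-B * y + D * w)) ≤
      κ * χ * s * (W / 2 * x ^ 2 + B ^ 2 / W * y ^ 2 + D ^ 2 / W * w ^ 2) :=
    mul_le_mul_of_nonneg_left h1 (by positivity)
  have h3 : κ * χ * y ^ 2 ≤ κ * s * y ^ 2 := by gcongr
  have h4 : κ * χ * s * (B ^ 2 / W * y ^ 2 + D ^ 2 / W * w ^ 2) ≤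
      κ * 1 * s * (B ^ 2 / W * y ^ 2 + D ^ 2 / W * w ^ 2) := by gcongr
  have h5 : 0 ≤ κ * s * (w ^ 2 + B ^ 2 / W * w ^ 2 + D ^ 2 / W * y ^ 2) := by positivity
  linear_combination 2 * h2 + 2 * h3 + 2 * h4 + 2 * h5

namespace ModeCoeff

variable {W B D q ν : ℝ} (h : ModeCoeff W B D q ν)

include h

/-- Exponential decay of the energy of a mode, with the rate `s / (1 + s)` typical of systems of
regularity-gain type. -/
theorem exists_decay_bound : ∃ C δ : ℝ, 0 < C ∧ 0 < δ ∧ ∀ s f g z, 0 ≤ s →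
    IsMode W B D q s f g z → ∀ t, 0 ≤ t → s * f t ^ 2 + g t ^ 2 + z t ^ 2 ≤
      C * Real.exp (-δ * (s / (1 + s)) * t) * (s * f 0 ^ 2 + g 0 ^ 2 + z 0 ^ 2) := by
  obtain ⟨δ₀, hδ₀, hQ⟩ := h.exists_coercive
  have hν := h.ν_pos
  have hW := h.W_pos
  -- The first condition lets the coercive form absorb the error of `dissipation_le`; the other two
  -- keep the cross term below half of the f- and g-parts of the energy.
  obtain ⟨κ, hκ, hκ1, hκ2, hκ3⟩ := exists_pos_mul_le (A₁ := 2 * (1 + B ^ 2 / W + D ^ 2 / W))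
    (A₂ := 2) (A₃ := 2) (B₁ := δ₀) (B₂ := W) (B₃ := 1)
    (by positivity) two_pos two_pos hδ₀ hW one_pos
  obtain ⟨δ, hδ, hδ1, hδ2, hδ3⟩ := exists_pos_mul_le (A₁ := W + κ)
    (A₂ := 1 + κ) (A₃ := ν) (B₁ := κ * W) (B₂ := δ₀) (B₃ := δ₀)
    (by positivity) (by positivity) hν (by positivity) hδ₀ hδ₀
  have hcross : ∀ s χ x y : ℝ, 0 ≤ s → 0 ≤ χ → χ ≤ s → χ ≤ 1 →
      |2 * κ * χ * x * y| ≤ κ * (s * x ^ 2 + y ^ 2) := by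
    intro s χ x y hs hχ hχs hχ1
    have hsq : χ ^ 2 * x ^ 2 ≤ s * x ^ 2 := by
      gcongr; nlinarith
    have : |2 * χ * x * y| ≤ s * x ^ 2 + y ^ 2 := by
      rw [abs_le]; constructor <;> nlinarith [sq_nonneg (χ * x + y), sq_nonneg (χ * x - y)]
    calc |2 * κ * χ * x * y| = κ * |2 * χ * x * y| := by
          rw [← abs_of_pos hκ, ← abs_mul, abs_of_pos hκ]; ring_nf
      _ ≤ _ := by gcongr
  have lower : ∃ C₁ > 0, ∀ s χ x y w : ℝ, 0 ≤ s → 0 ≤ χ → χ ≤ s → χ ≤ 1 →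
      s * x ^ 2 + y ^ 2 + w ^ 2 ≤
        C₁ * (W * s * x ^ 2 + y ^ 2 + ν * w ^ 2 + 2 * κ * χ * x * y) := by
    refine ⟨2 / W + 2 + 1 / ν, by positivity, fun s χ x y w hs hχ hχs hχ1 => ?_⟩
    have h1 := (abs_le.1 (hcross s χ x y hs hχ hχs hχ1)).1
    have h2 : W / 2 * (s * x ^ 2) + 1 / 2 * y ^ 2 + ν * w ^ 2 ≤
        W * s * x ^ 2 + y ^ 2 + ν * w ^ 2 + 2 * κ * χ * x * y := by
      have a1 : κ * (s * x ^ 2) ≤ W / 2 * (s * x ^ 2) := by gcongr; linarith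
      have a2 : κ * y ^ 2 ≤ 1 / 2 * y ^ 2 := by gcongr; linarith
      linarith
    refine le_trans ?_ (mul_le_mul_of_nonneg_left h2 (by positivity))
    have e : (2 / W + 2 + 1 / ν) * (W / 2 * (s * x ^ 2) + 1 / 2 * y ^ 2 + ν * w ^ 2) =
        s * x ^ 2 + y ^ 2 + w ^ 2 + ((2 + 1 / ν) * (W / 2 * (s * x ^ 2)) +
        (2 / W + 1 / ν) * (1 / 2 * y ^ 2) + (2 / W + 2) * (ν * w ^ 2)) := by
      field_simp; ring
    rw [e]
    have : 0 ≤ (2 + 1 / ν) * (W / 2 * (s * x ^ 2)) +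
        (2 / W + 1 / ν) * (1 / 2 * y ^ 2) + (2 / W + 2) * (ν * w ^ 2) := by positivity
    linarith
  have upper : ∀ s χ x y w : ℝ, 0 ≤ s → 0 ≤ χ → χ ≤ s → χ ≤ 1 →
      W * s * x ^ 2 + y ^ 2 + ν * w ^ 2 + 2 * κ * χ * x * y ≤
        (W + κ) * (s * x ^ 2) + (1 + κ) * y ^ 2 + ν * w ^ 2 := by
    intro s χ x y w hs hχ hχs hχ1
    have h1 := (abs_le.1 (hcross s χ x y hs hχ hχs hχ1)).2
    linarith
  obtain ⟨C₁, hC₁, hlow⟩ := lower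
  refine ⟨C₁ * (W + 1 + 2 * κ + ν), δ, by positivity, hδ, fun s f g z hs hm t ht => ?_⟩
  -- χ behaves like min(s, 1). The bound χ² ≤ s keeps the cross term under the s-weighted energy,
  -- and χ ≤ s keeps its derivative under the dissipation.
  set χ := s / (1 + s) with hχdef
  have hχ : 0 ≤ χ := by positivity
  have hχs : χ ≤ s := div_le_self hs (by linarith)
  have hχ1 : χ ≤ 1 := by rw [hχdef, div_le_one (by linarith)]; linarith
  set F : ℝ → ℝ := fun t => W * s * f t ^ 2 + g t ^ 2 + ν * z t ^ 2 + 2 * κ * χ * f t * g t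
  have hF : ∀ t, HasDerivAt F (W * s * (2 * f t * g t)
      + 2 * g t * (s * (-W * f t - B * g t + D * z t))
      + ν * (2 * z t * (s * (-D * z t + q * g t)))
      + 2 * κ * χ * (g t ^ 2 + f t * (s * (-W * f t - B * g t + D * z t)))) t := fun t => by
    have h1 := ((hm.deriv_f t).pow 2).const_mul (W * s)
    have h2 := (hm.deriv_g t).pow 2
    have h3 := ((hm.deriv_z t).pow 2).const_mul ν
    have h4 := ((hm.deriv_f t).const_mul (2 * κ * χ)).mul (hm.deriv_g t)
    refine (((h1.add h2).add h3).add h4).congr_deriv ?_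
    simp; ring
  have hbound := le_exp_mul_of_hasDerivAt_le (k := -δ * χ) hF (fun τ => ?_) ht
  · have hup : F 0 ≤ (W + 1 + 2 * κ + ν) * (s * f 0 ^ 2 + g 0 ^ 2 + z 0 ^ 2) := by
      refine (upper s χ (f 0) (g 0) (z 0) hs hχ hχs hχ1).trans ?_
      have : 0 ≤ (1 + κ + ν) * (s * f 0 ^ 2) + (W + κ + ν) * g 0 ^ 2
        + (W + 1 + 2 * κ) * z 0 ^ 2 := by positivity
      linarith
    calc _ ≤ C₁ * F t := hlow s χ _ _ _ hs hχ hχs hχ1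
      _ ≤ C₁ * (Real.exp (-δ * χ * t) * F 0) := by gcongr
      _ ≤ C₁ * (Real.exp (-δ * χ * t) *
          ((W + 1 + 2 * κ + ν) * (s * f 0 ^ 2 + g 0 ^ 2 + z 0 ^ 2))) := by gcongr
      _ = _ := by ring
  · change _ ≤ -δ * χ * (W * s * f τ ^ 2 + g τ ^ 2 + ν * z τ ^ 2 + 2 * κ * χ * f τ * g τ)
    generalize f τ = x
    generalize g τ = y
    generalize z τ = w
    have h1 := mul_le_mul_of_nonneg_left (hQ y w) hs
    have h2 := dissipation_le (B := B) (D := D) (x := x) (y := y) (w := w) hW hκ.le hs hχ hχs hχ1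
    have h3 : κ * (2 * (1 + B ^ 2 / W + D ^ 2 / W)) * (s * (y ^ 2 + w ^ 2)) ≤
        δ₀ * (s * (y ^ 2 + w ^ 2)) := by gcongr
    have h4 : δ * χ * (W * s * x ^ 2 + y ^ 2 + ν * w ^ 2 + 2 * κ * χ * x * y) ≤
        δ * χ * ((W + κ) * (s * x ^ 2) + (1 + κ) * y ^ 2 + ν * w ^ 2) :=
      mul_le_mul_of_nonneg_left (upper s χ x y w hs hχ hχs hχ1) (by positivity)
    have h5 : δ * (W + κ) * (χ * (s * x ^ 2)) ≤ κ * W * (χ * (s * x ^ 2)) := by gcongr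
    have h6 : δ * (1 + κ) * (χ * y ^ 2) ≤ δ₀ * (s * y ^ 2) := by gcongr
    have h7 : δ * ν * (χ * w ^ 2) ≤ δ₀ * (s * w ^ 2) := by gcongr
    linear_combination 2 * h1 + h2 + h3 + h4 + h5 + h6 + h7

/-- For low frequencies and bounded `s * t`, the energy in the variables `f - (D / W) z`, `g`,
`√s z` is controlled by its initial value. -/
theorem exists_short_time_bound : ∃ C : ℝ, 0 < C ∧ ∀ s f g z, 0 ≤ s → s ≤ 1 →
    IsMode W B D q s f g z → ∀ t, 0 ≤ t → s * t ≤ 1 →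
      s * (f t - D / W * z t) ^ 2 + g t ^ 2 + s * z t ^ 2 ≤
        C * (s * (f 0 - D / W * z 0) ^ 2 + g 0 ^ 2 + s * z 0 ^ 2) := by
  have hW := h.W_pos
  have hD := h.D_pos
  have hB := h.B_pos
  set K := (D ^ 2 + D * |q|) / W + (D ^ 2 + |q|) + (D * |q| + |q|) with hK
  refine ⟨(1 / W + 1) * (Real.exp K * (W + 1)), by positivity,
    fun s f g z hs hs1 hm t ht hst => ?_⟩
  -- Since -W f + D z = -W(f - p z), the terms coupling u = f - p z with g cancel to leading order,
  -- and the energy W s u² + g² + s z² has a derivative of at most K s times itself. Weighting z² by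
  -- s as well is what later gives f bounded instead of O(s^{-1/2}).
  set p := D / W with hp
  have hWp : W * p = D := by rw [hp]; field_simp
  set F : ℝ → ℝ := fun t => W * (s * (f t - p * z t) ^ 2) + g t ^ 2 + s * z t ^ 2 with hFdef
  have hF : ∀ t, HasDerivAt F (W * (s * (2 * (f t - p * z t) *
        (g t - p * (s * (-D * z t + q * g t)))))
      + 2 * g t * (s * (-W * f t - B * g t + D * z t))
      + s * (2 * z t * (s * (-D * z t + q * g t)))) t := fun t => by
    have h1 := ((((hm.deriv_f t).sub ((hm.deriv_z t).const_mul p)).pow 2).const_mul s).const_mul W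
    have h2 := (hm.deriv_g t).pow 2
    have h3 := ((hm.deriv_z t).pow 2).const_mul s
    refine ((h1.add h2).add h3).congr_deriv ?_
    simp
  have hbound := le_exp_mul_of_hasDerivAt_le (k := K * s) hF (fun τ => ?_) ht
  · set a := s * (f t - p * z t) ^ 2
    set b := s * (f 0 - p * z 0) ^ 2
    have ha : 0 ≤ a := by positivity
    have hb : 0 ≤ b := by positivity
    have hexp : Real.exp (K * s * t) ≤ Real.exp K := by
      rw [Real.exp_le_exp, mul_assoc]
      exact mul_le_of_le_one_right (by positivity) hst
    have hFt : a + g t ^ 2 + s * z t ^ 2 ≤ (1 / W + 1) * F t := by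
      have e : (1 / W + 1) * F t = a + g t ^ 2 + s * z t ^ 2
          + (W * a + 1 / W * (g t ^ 2 + s * z t ^ 2)) := by
        change (1 / W + 1) * (W * a + g t ^ 2 + s * z t ^ 2) = _
        field_simp; ring
      have : 0 ≤ W * a + 1 / W * (g t ^ 2 + s * z t ^ 2) := by positivity
      linarith
    have hF0 : F 0 ≤ (W + 1) * (b + g 0 ^ 2 + s * z 0 ^ 2) := by
      change W * b + g 0 ^ 2 + s * z 0 ^ 2 ≤ _
      have : 0 ≤ b + W * (g 0 ^ 2 + s * z 0 ^ 2) := by positivity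
      linarith
    have hF0' : 0 ≤ F 0 := by
      change 0 ≤ W * b + g 0 ^ 2 + s * z 0 ^ 2
      positivity
    calc _ ≤ (1 / W + 1) * F t := hFt
      _ ≤ (1 / W + 1) * (Real.exp (K * s * t) * F 0) := by gcongr
      _ ≤ (1 / W + 1) * (Real.exp K * ((W + 1) * (b + g 0 ^ 2 + s * z 0 ^ 2))) := by
        gcongr
      _ = _ := by ring
  · change _ ≤ K * s * (W * (s * (f τ - p * z τ) ^ 2) + g τ ^ 2 + s * z τ ^ 2)
    obtain ⟨u, hu⟩ : ∃ u, u = f τ - p * z τ := ⟨_, rfl⟩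
    have hf : f τ = u + p * z τ := by rw [hu]; ring
    rw [← hu, hf]
    generalize g τ = y
    generalize z τ = w
    have i1 : 2 * (s * u * w) ≤ s * u ^ 2 + s * w ^ 2 := by
      nlinarith [mul_nonneg hs (sq_nonneg (u - w))]
    have hs2 : ∀ x : ℝ, s * (s * x ^ 2) ≤ 1 * (s * x ^ 2) := fun x => by gcongr
    have i2 : |2 * (s * u * y)| ≤ s * u ^ 2 + y ^ 2 := by
      rw [abs_le]; constructor <;>
        nlinarith [sq_nonneg (s * u - y), sq_nonneg (s * u + y), hs2 u]
    have i3 : |2 * (s * w * y)| ≤ s * w ^ 2 + y ^ 2 := by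
      rw [abs_le]; constructor <;>
        nlinarith [sq_nonneg (s * w - y), sq_nonneg (s * w + y), hs2 w]
    have j1 := mul_le_mul_of_nonneg_left i1 (by positivity : 0 ≤ D ^ 2)
    have j2 : -q * (2 * (s * u * y)) ≤ |q| * (s * u ^ 2 + y ^ 2) := by
      refine (le_abs_self _).trans ?_
      rw [abs_mul, abs_neg]; gcongr
    have j3 : q * (2 * (s * w * y)) ≤ |q| * (s * w ^ 2 + y ^ 2) := by
      refine (le_abs_self _).trans ?_
      rw [abs_mul]; gcongr
    have j2' := mul_le_mul_of_nonneg_left j2 hD.le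
    have e1 : K * (W * (s * u ^ 2) + y ^ 2 + s * w ^ 2) =
        D ^ 2 * (s * u ^ 2 + s * w ^ 2) + D * (|q| * (s * u ^ 2 + y ^ 2))
        + |q| * (s * w ^ 2 + y ^ 2) + ((D ^ 2 + |q| + (D * |q| + |q|)) * (W * (s * u ^ 2))
        + ((D ^ 2 + D * |q|) / W + D ^ 2 + |q|) * y ^ 2
        + ((D ^ 2 + D * |q|) / W + (D * |q| + |q|)) * (s * w ^ 2)) := by
      rw [hK]; field_simp; ring
    have e2 : 0 ≤ (D ^ 2 + |q| + (D * |q| + |q|)) * (W * (s * u ^ 2))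
        + ((D ^ 2 + D * |q|) / W + D ^ 2 + |q|) * y ^ 2
        + ((D ^ 2 + D * |q|) / W + (D * |q| + |q|)) * (s * w ^ 2) := by positivity
    have k1 : D ^ 2 * (2 * (s * u * w)) + D * (-q * (2 * (s * u * y))) + q * (2 * (s * w * y)) ≤
        K * (W * (s * u ^ 2) + y ^ 2 + s * w ^ 2) := by linarith
    have k2 := mul_le_mul_of_nonneg_left k1 hs
    have k3 : 0 ≤ B * s * y ^ 2 + s * (s * (D * w ^ 2)) := by positivity
    linear_combination k2 + 2 * k3
      + (2 * s * s * u * (D * w - q * y) - 2 * s * w * y) * hWp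

end ModeCoeff

namespace ModeCoeff

variable {W B D q ν : ℝ} (h : ModeCoeff W B D q ν)

include h

/-- A low-frequency mode without initial velocity stays bounded while `s * t ≤ 1`. -/
theorem exists_bound_of_velocity_eq_zero : ∃ C : ℝ, 0 < C ∧ ∀ s f g z, 0 < s → s ≤ 1 →
    IsMode W B D q s f g z → g 0 = 0 → ∀ t, 0 ≤ t → s * t ≤ 1 →
      f t ^ 2 ≤ C * (f 0 ^ 2 + z 0 ^ 2) := by
  obtain ⟨C, hC, hb⟩ := h.exists_short_time_bound
  set p := D / W
  refine ⟨(2 + 2 * p ^ 2) * (C * (2 + 2 * p ^ 2 + 1)), by positivity,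
    fun s f g z hs hs1 hm hg t ht hst => ?_⟩
  have h1 := hb s f g z hs.le hs1 hm t ht hst
  rw [hg] at h1
  have h2 : (f t - p * z t) ^ 2 + z t ^ 2 ≤ C * ((f 0 - p * z 0) ^ 2 + z 0 ^ 2) := by
    -- With g(0) = 0 the initial energy carries a factor s throughout, so s cancels; this needs s ≠
    -- 0.
    refine le_of_mul_le_mul_left ?_ hs
    nlinarith [sq_nonneg (g t)]
  have h3 : f t ^ 2 ≤ 2 * (f t - p * z t) ^ 2 + 2 * p ^ 2 * z t ^ 2 := by
    nlinarith [sq_nonneg (f t - p * z t - p * z t)]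
  have h4 : (f 0 - p * z 0) ^ 2 ≤ 2 * f 0 ^ 2 + 2 * p ^ 2 * z 0 ^ 2 := by
    nlinarith [sq_nonneg (f 0 + p * z 0)]
  calc f t ^ 2 ≤ (2 + 2 * p ^ 2) * ((f t - p * z t) ^ 2 + z t ^ 2) := by
        have : 0 ≤ 2 * p ^ 2 * (f t - p * z t) ^ 2 + 2 * z t ^ 2 := by positivity
        linarith
    _ ≤ (2 + 2 * p ^ 2) * (C * ((f 0 - p * z 0) ^ 2 + z 0 ^ 2)) := by gcongr
    _ ≤ (2 + 2 * p ^ 2) * (C * ((2 + 2 * p ^ 2 + 1) * (f 0 ^ 2 + z 0 ^ 2))) := by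
      gcongr
      have : 0 ≤ (2 * p ^ 2 + 1) * f 0 ^ 2 + 2 * z 0 ^ 2 := by positivity
      linarith
    _ = _ := by ring

/-- Low-frequency modes are approximated by the oscillator `f'' = -W s f`. -/
theorem exists_oscillator_approx : ∃ C : ℝ, 0 < C ∧ ∀ r f g z, 0 ≤ r → r ≤ 1 →
    IsMode W B D q (r ^ 2) f g z → f 0 = 0 → ∀ t, 0 ≤ t → r ^ 2 * t ≤ 1 →
      |√W * r * f t - g 0 * Real.sin (√W * r * t)| ≤
        C * (r + r ^ 2 * t) * (|g 0| + |z 0|) := by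
  obtain ⟨C₁, hC₁, hshort⟩ := h.exists_short_time_bound
  obtain ⟨C₂, δ, hC₂, hδ, hdec⟩ := h.exists_decay_bound
  have hD := h.D_pos
  have hB := h.B_pos
  have hW := h.W_pos
  set p := D / W with hp
  have hp0 : 0 < p := by positivity
  set k := √W with hk
  have hk0 : 0 < k := Real.sqrt_pos.2 hW
  have hkk : k * k = W := Real.mul_self_sqrt hW.le
  have hkpD : W * p = D := by rw [hp]; field_simp
  set M := √(C₁ * (p ^ 2 + 1 + 1)) with hM
  set A := (k * p * (D + |q|) + B) * M with hA
  refine ⟨A + k * p + k * p * √C₂, by positivity, fun r f g z hr hr1 hm hf0 t ht hst => ?_⟩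
  set s := r ^ 2 with hs
  have hs0 : 0 ≤ s := by positivity
  have hs1 : s ≤ 1 := pow_le_one₀ hr hr1
  set N := |g 0| + |z 0| with hN
  have hN0 : 0 ≤ N := by positivity
  have hzN : |z 0| ≤ N := by rw [hN]; linarith [abs_nonneg (g 0)]
  have hgN : |g 0| ≤ N := by rw [hN]; linarith [abs_nonneg (z 0)]
  have hg2 : g 0 ^ 2 + z 0 ^ 2 ≤ N ^ 2 := by
    rw [hN, ← sq_abs (g 0), ← sq_abs (z 0)]
    nlinarith [mul_nonneg (abs_nonneg (g 0)) (abs_nonneg (z 0))]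
  have hz2 : z 0 ^ 2 ≤ N ^ 2 := by nlinarith [sq_nonneg (g 0)]
  have hgz : ∀ τ ∈ Icc 0 t, |g τ| ≤ M * N ∧ r * |z τ| ≤ M * N := by
    intro τ hτ
    have hsτ : s * τ ≤ 1 := (mul_le_mul_of_nonneg_left hτ.2 hs0).trans hst
    have h1 := hshort s f g z hs0 hs1 hm τ hτ.1 hsτ
    have h2 : s * (f 0 - p * z 0) ^ 2 + g 0 ^ 2 + s * z 0 ^ 2 ≤ (p ^ 2 + 1 + 1) * N ^ 2 := by
      rw [hf0]
      have a1 : s * (0 - p * z 0) ^ 2 ≤ 1 * (p ^ 2 * N ^ 2) := by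
        have : (0 - p * z 0) ^ 2 = p ^ 2 * z 0 ^ 2 := by ring
        rw [this]; gcongr
      have a2 : s * z 0 ^ 2 ≤ 1 * N ^ 2 := by gcongr
      have a3 : g 0 ^ 2 ≤ N ^ 2 := by nlinarith [sq_nonneg (z 0)]
      linarith
    have h3 : s * (f τ - p * z τ) ^ 2 + g τ ^ 2 + s * z τ ^ 2 ≤ (M * N) ^ 2 := by
      rw [mul_pow, hM, Real.sq_sqrt (by positivity), mul_assoc]
      exact h1.trans (mul_le_mul_of_nonneg_left h2 hC₁.le)
    have h4 : 0 ≤ s * (f τ - p * z τ) ^ 2 := by positivity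
    have h5 : 0 ≤ s * z τ ^ 2 := by positivity
    constructor
    · apply abs_le_of_sq_le_sq _ (by positivity)
      linarith [sq_nonneg (g τ)]
    · refine (le_abs_self _).trans (abs_le_of_sq_le_sq ?_ (by positivity))
      rw [mul_pow, sq_abs]
      linarith [sq_nonneg (g τ)]
  -- Variation of constants: R is constant along the free oscillator in the variables f - p z and g.
  -- Its actual derivative has size s(|g| + r|z|), which the short-time bound controls by s N.
  set R : ℝ → ℝ := fun τ => k * r * (f τ - p * z τ) * Real.cos (k * r * (t - τ))
    + g τ * Real.sin (k * r * (t - τ)) with hR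
  have hRd : ∀ τ, HasDerivAt R
      (k * r * p * s * (D * z τ - q * g τ) * Real.cos (k * r * (t - τ))
        - B * s * g τ * Real.sin (k * r * (t - τ))) τ := by
    intro τ
    have hlin : HasDerivAt (fun τ => k * r * (t - τ)) (k * r * (0 - 1)) τ :=
      ((hasDerivAt_const τ t).sub (hasDerivAt_id τ)).const_mul (k * r)
    have h1 := (((hm.deriv_f τ).sub ((hm.deriv_z τ).const_mul p)).const_mul (k * r)).mul hlin.cos
    have h2 := (hm.deriv_g τ).mul hlin.sin
    refine (h1.add h2).congr_deriv ?_
    simp only [Pi.sub_apply]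
    rw [hs]
    linear_combination (-(r ^ 2) * z τ * Real.sin (k * r * (t - τ))) * hkpD
      + (r ^ 2 * (f τ - p * z τ) * Real.sin (k * r * (t - τ))) * hkk
  have hRb : ∀ τ ∈ Icc 0 t, ‖k * r * p * s * (D * z τ - q * g τ) * Real.cos (k * r * (t - τ))
        - B * s * g τ * Real.sin (k * r * (t - τ))‖ ≤ A * N * s := by
    intro τ hτ
    obtain ⟨h1, h2⟩ := hgz τ hτ
    have hc := Real.abs_cos_le_one (k * r * (t - τ))
    have hsn := Real.abs_sin_le_one (k * r * (t - τ))
    rw [Real.norm_eq_abs]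
    have a1 : |r * (D * z τ - q * g τ)| ≤ (D + |q|) * (M * N) := by
      have e : r * (D * z τ - q * g τ) = D * (r * z τ) - r * (q * g τ) := by ring
      rw [e]
      refine (abs_sub _ _).trans ?_
      rw [abs_mul D, abs_mul r, abs_mul r, abs_mul q, abs_of_pos hD, abs_of_nonneg hr]
      have : r * (|q| * |g τ|) ≤ 1 * (|q| * (M * N)) := by gcongr
      have : D * (r * |z τ|) ≤ D * (M * N) := by gcongr
      linarith
    calc _ ≤ |k * r * p * s * (D * z τ - q * g τ) * Real.cos (k * r * (t - τ))|
          + |B * s * g τ * Real.sin (k * r * (t - τ))| := abs_sub _ _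
      _ = k * p * s * |r * (D * z τ - q * g τ)| * |Real.cos (k * r * (t - τ))|
          + B * s * |g τ| * |Real.sin (k * r * (t - τ))| := by
        have e : k * r * p * s * (D * z τ - q * g τ) * Real.cos (k * r * (t - τ))
          = k * p * s * (r * (D * z τ - q * g τ)) * Real.cos (k * r * (t - τ)) := by ring
        rw [e, abs_mul, abs_mul (k * p * s), abs_mul (B * s * g τ), abs_mul (B * s),
          abs_of_nonneg (by positivity : 0 ≤ k * p * s), abs_of_nonneg (by positivity : 0 ≤ B * s)]
      _ ≤ k * p * s * ((D + |q|) * (M * N)) * 1 + B * s * (M * N) * 1 := by gcongr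
      _ = _ := by rw [hA]; ring
  have hRt : |R t - R 0| ≤ A * N * s * t := by
    have := (convex_Icc 0 t).norm_image_sub_le_of_norm_hasDerivWithin_le
      (fun τ hτ => (hRd τ).hasDerivWithinAt) hRb (left_mem_Icc.2 ht) (right_mem_Icc.2 ht)
    rwa [Real.norm_eq_abs, Real.norm_eq_abs, sub_zero, abs_of_nonneg ht] at this
  -- The short-time bound only controls r|z|. The error k p r z(t) has to be O(r), so z itself is
  -- bounded through the decay estimate.
  have hzt : |z t| ≤ √C₂ * N := by
    apply abs_le_of_sq_le_sq _ (by positivity)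
    rw [mul_pow, Real.sq_sqrt hC₂.le]
    have h1 := hdec s f g z hs0 hm t ht
    have hexp : Real.exp (-δ * (s / (1 + s)) * t) ≤ 1 := by
      rw [Real.exp_le_one_iff]
      have : 0 ≤ δ * (s / (1 + s)) * t := by positivity
      linarith
    calc z t ^ 2 ≤ s * f t ^ 2 + g t ^ 2 + z t ^ 2 := by
          have : 0 ≤ s * f t ^ 2 + g t ^ 2 := by positivity
          linarith
      _ ≤ C₂ * Real.exp (-δ * (s / (1 + s)) * t) * (s * f 0 ^ 2 + g 0 ^ 2 + z 0 ^ 2) := h1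
      _ ≤ C₂ * 1 * N ^ 2 := by
        gcongr
        rw [hf0]; linarith
      _ = C₂ * N ^ 2 := by ring
  have e : k * r * f t - g 0 * Real.sin (k * r * t)
      = (R t - R 0) + (-(k * p * r * z 0 * Real.cos (k * r * t))) + k * p * r * z t := by
    simp only [hR, sub_self, mul_zero, Real.cos_zero, Real.sin_zero, sub_zero, hf0]
    ring
  rw [e]
  have b1 : |-(k * p * r * z 0 * Real.cos (k * r * t))| ≤ k * p * r * N := by
    rw [abs_neg, abs_mul, abs_mul, abs_of_nonneg (by positivity : 0 ≤ k * p * r)]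
    have := Real.abs_cos_le_one (k * r * t)
    calc _ ≤ k * p * r * N * 1 := by gcongr
      _ = _ := mul_one _
  have b2 : |k * p * r * z t| ≤ k * p * r * (√C₂ * N) := by
    rw [abs_mul, abs_of_nonneg (by positivity : 0 ≤ k * p * r)]
    gcongr
  have hA0 : 0 ≤ A := by positivity
  calc _ ≤ |R t - R 0| + |-(k * p * r * z 0 * Real.cos (k * r * t))| + |k * p * r * z t| :=
        (abs_add_le _ _).trans (add_le_add_left (abs_add_le _ _) _)
    _ ≤ A * N * s * t + k * p * r * N + k * p * r * (√C₂ * N) := by gcongr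
    _ ≤ _ := by
      have : 0 ≤ A * r * N + (k * p + k * p * √C₂) * (s * t) * N := by positivity
      linarith

end ModeCoeff

/-! ### The flow of a mode as a matrix exponential. -/

/-- The generator of `IsMode`. -/
def modeGenerator (W B D q s : ℝ) : (ℝ × ℝ × ℝ) →L[ℝ] (ℝ × ℝ × ℝ) :=
  let f := ContinuousLinearMap.fst ℝ ℝ (ℝ × ℝ)
  let g := (ContinuousLinearMap.fst ℝ ℝ ℝ).comp (ContinuousLinearMap.snd ℝ ℝ (ℝ × ℝ))
  let z := (ContinuousLinearMap.snd ℝ ℝ ℝ).comp (ContinuousLinearMap.snd ℝ ℝ (ℝ × ℝ))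
  g.prod 0 + s • ContinuousLinearMap.prod 0 ((-W • f - B • g + D • z).prod (-D • z + q • g))

/-- The solution at time `t` of the mode of squared frequency `s` with initial value `v`. -/
noncomputable def modeFlow (W B D q : ℝ) (v : ℝ × ℝ × ℝ) (t s : ℝ) : ℝ × ℝ × ℝ :=
  NormedSpace.exp (t • modeGenerator W B D q s) v

/-- Joint continuity serves twice: measurability in ξ at fixed time, and continuity in time at fixed
frequency. -/
theorem continuous_modeFlow (W B D q : ℝ) (v : ℝ × ℝ × ℝ) :
    Continuous fun x : ℝ × ℝ => modeFlow W B D q v x.1 x.2 := by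
  unfold modeFlow modeGenerator
  have h1 : Continuous (NormedSpace.exp : ((ℝ × ℝ × ℝ) →L[ℝ] (ℝ × ℝ × ℝ)) → _) :=
    letI := NormedAlgebra.restrictScalars ℚ ℝ ((ℝ × ℝ × ℝ) →L[ℝ] (ℝ × ℝ × ℝ))
    NormedSpace.exp_continuous
  exact (h1.comp (by fun_prop)).clm_apply continuous_const

theorem isMode_modeFlow (W B D q s : ℝ) (v : ℝ × ℝ × ℝ) :
    IsMode W B D q s (fun t => (modeFlow W B D q v t s).1) (fun t => (modeFlow W B D q v t s).2.1)
      (fun t => (modeFlow W B D q v t s).2.2) := by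
  have hd : ∀ t, HasDerivAt (fun t => modeFlow W B D q v t s)
      (modeGenerator W B D q s (modeFlow W B D q v t s)) t := fun t =>
    (hasDerivAt_exp_smul_const' (𝕂 := ℝ) (modeGenerator W B D q s) t).clm_apply
      (hasDerivAt_const t v) |>.congr_deriv (by simp [modeFlow])
  refine ⟨fun t => ?_, fun t => ?_, fun t => ?_⟩
  · refine (((ContinuousLinearMap.fst ℝ ℝ (ℝ × ℝ)).hasFDerivAt).comp_hasDerivAt t
      (hd t)).congr_deriv ?_
    simp [modeGenerator]
  · refine (((ContinuousLinearMap.fst ℝ ℝ ℝ).comp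
      (ContinuousLinearMap.snd ℝ ℝ (ℝ × ℝ))).hasFDerivAt.comp_hasDerivAt t (hd t)).congr_deriv ?_
    simp [modeGenerator]
  · refine (((ContinuousLinearMap.snd ℝ ℝ ℝ).comp
      (ContinuousLinearMap.snd ℝ ℝ (ℝ × ℝ))).hasFDerivAt.comp_hasDerivAt t (hd t)).congr_deriv ?_
    simp [modeGenerator]

@[simp]
theorem modeFlow_zero (W B D q s : ℝ) (v : ℝ × ℝ × ℝ) : modeFlow W B D q v 0 s = v := by
  simp [modeFlow]

open scoped FourierTransform Topology

/-! ### Multiplication operators on L². -/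

section LpMul

variable {α : Type*} [MeasurableSpace α] {μ : Measure α}

theorem norm_sq_eq_integral_norm_sq {F : Type*} [NormedAddCommGroup F] [InnerProductSpace ℂ F]
    (u : Lp F 2 μ) : ‖u‖ ^ 2 = ∫ x, ‖u x‖ ^ 2 ∂μ := by
  have h := L2.inner_def (𝕜 := ℂ) u u
  rw [inner_self_eq_norm_sq_to_K] at h
  simp_rw [inner_self_eq_norm_sq_to_K] at h
  have h2 : ((‖u‖ ^ 2 : ℝ) : ℂ) = ((∫ x, ‖u x‖ ^ 2 ∂μ : ℝ) : ℂ) := by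
    rw [← integral_complex_ofReal]
    simpa using h
  exact_mod_cast h2

theorem integrable_norm_sq (u : Lp ℂ 2 μ) : Integrable (fun x => ‖u x‖ ^ 2) μ :=
  (memLp_two_iff_integrable_sq_norm (Lp.aestronglyMeasurable u)).1 (Lp.memLp u)

/-- Multiplication by a bounded function is a bounded operator on `L²`. -/
theorem exists_mulLp {m : α → ℝ} (hm : AEStronglyMeasurable m μ) {C : ℝ} (hC : ∀ x, |m x| ≤ C) :
    ∃ T : Lp ℂ 2 μ →L[ℂ] Lp ℂ 2 μ, ∀ u, T u =ᵐ[μ] fun x => (m x : ℂ) * u x := by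
  have hmem : ∀ u : Lp ℂ 2 μ, MemLp (fun x => (m x : ℂ) * u x) 2 μ := fun u =>
    (Lp.memLp u).of_le_mul (c := C)
      ((Complex.continuous_ofReal.comp_aestronglyMeasurable hm).mul (Lp.aestronglyMeasurable u))
      (Eventually.of_forall fun x => by
        rw [norm_mul, Complex.norm_real, Real.norm_eq_abs]
        exact mul_le_mul_of_nonneg_right (hC x) (norm_nonneg _))
  let T : Lp ℂ 2 μ →ₗ[ℂ] Lp ℂ 2 μ :=
    { toFun := fun u => (hmem u).toLp
      map_add' := fun u v => by
        rw [← MemLp.toLp_add]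
        apply MemLp.toLp_congr
        filter_upwards [Lp.coeFn_add u v] with x hx
        simp only [hx, Pi.add_apply]; ring
      map_smul' := fun c u => by
        rw [RingHom.id_apply, ← MemLp.toLp_const_smul]
        apply MemLp.toLp_congr
        filter_upwards [Lp.coeFn_smul c u] with x hx
        simp only [hx, Pi.smul_apply, smul_eq_mul]; ring }
  refine ⟨T.mkContinuous C fun u => ?_, fun u => (hmem u).coeFn_toLp⟩
  apply Lp.norm_le_mul_norm_of_ae_le_mul
  filter_upwards [(hmem u).coeFn_toLp] with x hx
  change ‖(hmem u).toLp _ x‖ ≤ _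
  rw [hx, norm_mul, Complex.norm_real, Real.norm_eq_abs]
  exact mul_le_mul_of_nonneg_right (hC x) (norm_nonneg _)

/-- Dominated convergence for multiplication operators on `L²`. -/
theorem tendsto_zero_of_ae_eq_mul {ι : Type*} {l : Filter ι} [l.IsCountablyGenerated]
    {F : ι → Lp ℂ 2 μ} {a : ι → α → ℝ} {u : Lp ℂ 2 μ} {C : ℝ}
    (hF : ∀ᶠ i in l, F i =ᵐ[μ] fun x => (a i x : ℂ) * u x) (hC : ∀ᶠ i in l, ∀ x, |a i x| ≤ C)
    (ha : ∀ x, Tendsto (fun i => a i x) l (𝓝 0)) : Tendsto F l (𝓝 0) := by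
  rw [tendsto_zero_iff_norm_tendsto_zero]
  have h1 : Tendsto (fun i => ∫ x, ‖F i x‖ ^ 2 ∂μ) l (𝓝 0) := by
    have h2 : Tendsto (fun i => ∫ x, a i x ^ 2 * ‖u x‖ ^ 2 ∂μ) l (𝓝 (∫ _, (0 : ℝ) ∂μ)) := by
      have hmeas : ∀ᶠ i in l, AEStronglyMeasurable (fun x => a i x ^ 2 * ‖u x‖ ^ 2) μ := by
        filter_upwards [hF] with i hi
        refine ((Lp.aestronglyMeasurable (F i)).norm.pow 2).congr ?_
        filter_upwards [hi] with x hx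
        simp [hx, mul_pow]
      refine tendsto_integral_filter_of_dominated_convergence (fun x => C ^ 2 * ‖u x‖ ^ 2)
        hmeas ?_ ((integrable_norm_sq u).const_mul _) ?_
      · filter_upwards [hC] with i hi
        refine Eventually.of_forall fun x => ?_
        rw [Real.norm_eq_abs, abs_of_nonneg (by positivity)]
        refine mul_le_mul_of_nonneg_right ?_ (by positivity)
        rw [← sq_abs]
        exact pow_le_pow_left₀ (abs_nonneg _) (hi x) 2
      · refine Eventually.of_forall fun x => ?_
        simpa using ((ha x).pow 2).mul_const (‖u x‖ ^ 2)
    simp only [integral_zero] at h2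
    refine h2.congr' ?_
    filter_upwards [hF] with i hi
    apply integral_congr_ae
    filter_upwards [hi] with x hx
    simp [hx, mul_pow]
  have h3 : Tendsto (fun i => √(∫ x, ‖F i x‖ ^ 2 ∂μ)) l (𝓝 0) := by
    simpa using h1.sqrt
  refine h3.congr fun i => ?_
  rw [← norm_sq_eq_integral_norm_sq, Real.sqrt_sq (norm_nonneg _)]

end LpMul

/-! ### Schwartz pairings and the Fourier transform on L². -/

/-- The complex Hilbert space `L²(ℝⁿ)`. -/
abbrev L2C (n : ℕ) : Type := Lp ℂ 2 (volume : Measure (EuclideanSpace ℝ (Fin n)))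

variable {n : ℕ}

/-- The pairing of complex `L²` functions with a fixed Schwartz function. -/
noncomputable def schwartzPairing (η : 𝓢(EuclideanSpace ℝ (Fin n), ℂ)) : L2C n →L[ℂ] ℂ where
  toFun u := Lp.toTemperedDistribution u η
  map_add' u v := by
    exact DFunLike.congr_fun
      ((Lp.toTemperedDistributionCLM (E := EuclideanSpace ℝ (Fin n)) ℂ volume 2).map_add u v) η
  map_smul' c u := by
    exact DFunLike.congr_fun
      ((Lp.toTemperedDistributionCLM (E := EuclideanSpace ℝ (Fin n)) ℂ volume 2).map_smul c u) η
  cont := (Lp.toTemperedDistributionCLM (E := EuclideanSpace ℝ (Fin n)) ℂ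
    volume 2).continuous.eval_const η

theorem schwartzPairing_apply (η : 𝓢(EuclideanSpace ℝ (Fin n), ℂ)) (u : L2C n) :
    schwartzPairing η u = ∫ x, η x * u x := by
  change Lp.toTemperedDistribution u η = _
  simp

/-- The symbol `4π²|ξ|²` of `-Δ`. -/
noncomputable def symb (ξ : EuclideanSpace ℝ (Fin n)) : ℝ := (2 * Real.pi) ^ 2 * ‖ξ‖ ^ 2

theorem symb_nonneg (ξ : EuclideanSpace ℝ (Fin n)) : 0 ≤ symb ξ := by
  unfold symb; positivity

theorem continuous_symb : Continuous (symb (n := n)) := by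
  unfold symb; fun_prop

theorem hasTemperateGrowth_symb : (symb (n := n)).HasTemperateGrowth := by
  unfold symb; fun_prop

/-- Multiplication of Schwartz functions by `4π²|ξ|²`. -/
noncomputable def symbMul : 𝓢(EuclideanSpace ℝ (Fin n), ℂ) →L[ℝ] 𝓢(EuclideanSpace ℝ (Fin n), ℂ) :=
  SchwartzMap.smulLeftCLM ℂ (symb (n := n))

@[simp]
theorem symbMul_apply (η : 𝓢(EuclideanSpace ℝ (Fin n), ℂ)) (ξ : EuclideanSpace ℝ (Fin n)) :
    symbMul η ξ = symb ξ * η ξ := by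
  simp [symbMul, SchwartzMap.smulLeftCLM_apply_apply hasTemperateGrowth_symb]

/-- The inverse transform is the one needed, because pairing u with η amounts to pairing 𝓕u with
𝓕⁻η. The multiplier formula for 𝓕 carries over since 𝓕⁻ is 𝓕 composed with ξ ↦ -ξ and the symbol is
even. -/
theorem fourierInv_laplacian (η : 𝓢(EuclideanSpace ℝ (Fin n), ℂ)) :
    𝓕⁻ (Δ η) = -symbMul (𝓕⁻ η) := by
  have hg : (fun ξ : EuclideanSpace ℝ (Fin n) => ‖ξ‖ ^ 2).HasTemperateGrowth := by fun_prop
  have hF : 𝓕 (Δ η) = -symbMul (𝓕 η) := by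
    rw [SchwartzMap.laplacian_eq_fourierMultiplierCLM]
    ext ξ
    rw [FourierTransform.fourier_smul, SchwartzMap.fourierMultiplierCLM_apply,
      FourierTransform.fourier_fourierInv_eq]
    simp [SchwartzMap.smulLeftCLM_apply_apply hg, symb, mul_assoc]
  have hneg : ∀ (ζ : 𝓢(EuclideanSpace ℝ (Fin n), ℂ)) ξ, (𝓕⁻ ζ) ξ = (𝓕 ζ) (-ξ) := fun ζ ξ => by
    rw [SchwartzMap.fourierInv_coe, SchwartzMap.fourier_coe, Real.fourierInv_eq_fourier_neg]
  ext ξ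
  rw [hneg, hF]
  simp [hneg, symb]

/-- Pairing with a Schwartz function on the Fourier side. -/
theorem schwartzPairing_eq_fourier (η : 𝓢(EuclideanSpace ℝ (Fin n), ℂ)) (u : L2C n) :
    schwartzPairing η u = schwartzPairing (𝓕⁻ η) (𝓕 u) := by
  have h := Lp.fourier_toTemperedDistribution_eq u
  have h2 := DFunLike.congr_fun h (𝓕⁻ η)
  rw [TemperedDistribution.fourier_apply] at h2
  rw [FourierTransform.fourier_fourierInv_eq] at h2
  exact h2

/-- A function in `L²` is determined by its pairings with test functions. -/
theorem ae_eq_symb_mul_of_schwartzPairing {u v : L2C n}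
    (h : ∀ η, schwartzPairing η u = schwartzPairing (symbMul η) v) :
    u =ᵐ[volume] fun ξ => (symb ξ : ℂ) * v ξ := by
  -- The product is not known to be in L²; local integrability is enough when testing with smooth
  -- compactly supported functions.
  have hv : LocallyIntegrable (fun ξ => (symb ξ : ℂ) * v ξ)
      (volume : Measure (EuclideanSpace ℝ (Fin n))) := by
    rw [← locallyIntegrableOn_univ]
    exact ((((Lp.memLp v).locallyIntegrable one_le_two).locallyIntegrableOn univ).continuousOn_mul
      (Complex.continuous_ofReal.comp continuous_symb).continuousOn isOpen_univ.isLocallyClosed)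
  have := ae_eq_of_integral_contDiff_smul_eq ((Lp.memLp u).locallyIntegrable one_le_two) hv ?_
  · exact this
  intro g hg hc
  have hg₁ : HasCompactSupport (Complex.ofRealCLM ∘ g) := hc.comp_left rfl
  have hg₂ : ContDiff ℝ (⊤ : ℕ∞) (Complex.ofRealCLM ∘ g) := by fun_prop
  have := h (hg₁.toSchwartzMap hg₂)
  rw [schwartzPairing_apply, schwartzPairing_apply] at this
  simp only [symbMul_apply, HasCompactSupport.toSchwartzMap_toFun, Function.comp,
    Complex.ofRealCLM_apply] at this
  simp only [Complex.real_smul]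
  rw [this]
  congr 1; ext ξ; ring

/-- The `L²` Fourier transform agrees with the Fourier integral on `L¹ ∩ L²`. -/
theorem fourier_ae_eq_of_memLp_one {u : L2C n} (hu : Integrable u volume) :
    (𝓕 u : L2C n) =ᵐ[volume] 𝓕 (u : EuclideanSpace ℝ (Fin n) → ℂ) := by
  have hcont : Continuous (𝓕 (u : EuclideanSpace ℝ (Fin n) → ℂ)) :=
    VectorFourier.fourierIntegral_continuous Real.continuous_fourierChar
      (innerSL ℝ).continuous₂ hu
  refine ae_eq_of_integral_contDiff_smul_eq
    ((Lp.memLp (𝓕 u : L2C n)).locallyIntegrable one_le_two) hcont.locallyIntegrable ?_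
  intro g hg hc
  have hg₁ : HasCompactSupport (Complex.ofRealCLM ∘ g) := hc.comp_left rfl
  have hg₂ : ContDiff ℝ (⊤ : ℕ∞) (Complex.ofRealCLM ∘ g) := by fun_prop
  set η := hg₁.toSchwartzMap hg₂ with hη
  have h1 : schwartzPairing η (𝓕 u) = schwartzPairing (𝓕 η) u := by
    rw [schwartzPairing_eq_fourier (𝓕 η) u, FourierTransform.fourierInv_fourier_eq]
  -- Both transforms satisfy the multiplication formula ∫ η 𝓕u = ∫ (𝓕η) u, hence have the same
  -- integrals against test functions.
  have h2 := VectorFourier.integral_fourierIntegral_smul_eq_flip (e := Real.fourierChar)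
    (L := innerₗ (EuclideanSpace ℝ (Fin n))) (μ := volume) (ν := volume)
    Real.continuous_fourierChar (by exact continuous_inner) (η.integrable) hu
  rw [schwartzPairing_apply, schwartzPairing_apply] at h1
  simp only [smul_eq_mul] at h2
  have e1 : ∀ x, η x = (g x : ℂ) := fun x => rfl
  simp only [Complex.real_smul, ← e1]
  rw [h1]
  refine h2.trans ?_
  rw [flip_innerₗ]
  rfl

/-! ### The system on the Fourier side and its uniqueness. -/

/-- The acoustic system on the Fourier side, in the variables of `IsMode` and tested against
Schwartz functions. -/
structure IsFourierSolution (W B D q : ℝ) (F G Z : ℝ → L2C n) : Prop where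
  deriv_F : ∀ t, 0 ≤ t → HasDerivWithinAt F (G t) (Ici 0) t
  cont_G : ContinuousOn G (Ici 0)
  cont_Z : ContinuousOn Z (Ici 0)
  eq_G : ∀ η t, 0 < t → HasDerivAt (fun s => schwartzPairing η (G s))
    (schwartzPairing (symbMul η) (-W • F t - B • G t + D • Z t)) t
  eq_Z : ∀ η t, 0 < t → HasDerivAt (fun s => schwartzPairing η (Z s))
    (schwartzPairing (symbMul η) (-D • Z t + q • G t)) t

theorem IsFourierSolution.cont_F {W B D q : ℝ} {F G Z : ℝ → L2C n}
    (h : IsFourierSolution W B D q F G Z) : ContinuousOn F (Ici 0) :=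
  fun t ht => (h.deriv_F t ht).continuousWithinAt

theorem IsFourierSolution.add {W B D q : ℝ} {F G Z F' G' Z' : ℝ → L2C n}
    (h : IsFourierSolution W B D q F G Z) (h' : IsFourierSolution W B D q F' G' Z') :
    IsFourierSolution W B D q (F + F') (G + G') (Z + Z') where
  deriv_F t ht := (h.deriv_F t ht).add (h'.deriv_F t ht)
  cont_G := h.cont_G.add h'.cont_G
  cont_Z := h.cont_Z.add h'.cont_Z
  eq_G η t ht := by
    have := (h.eq_G η t ht).add (h'.eq_G η t ht)
    rw [← map_add] at this
    refine (this.congr_deriv ?_).congr_of_eventuallyEq ?_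
    · congr 1; simp only [Pi.add_apply]; module
    · exact Eventually.of_forall fun s => by simp
  eq_Z η t ht := by
    have := (h.eq_Z η t ht).add (h'.eq_Z η t ht)
    rw [← map_add] at this
    refine (this.congr_deriv ?_).congr_of_eventuallyEq ?_
    · congr 1; simp only [Pi.add_apply]; module
    · exact Eventually.of_forall fun s => by simp

theorem IsFourierSolution.neg {W B D q : ℝ} {F G Z : ℝ → L2C n}
    (h : IsFourierSolution W B D q F G Z) : IsFourierSolution W B D q (-F) (-G) (-Z) where
  deriv_F t ht := (h.deriv_F t ht).neg
  cont_G := h.cont_G.neg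
  cont_Z := h.cont_Z.neg
  eq_G η t ht := by
    have := (h.eq_G η t ht).neg
    rw [← map_neg] at this
    refine (this.congr_deriv ?_).congr_of_eventuallyEq ?_
    · congr 1; simp only [Pi.neg_apply]; module
    · exact Eventually.of_forall fun s => by simp
  eq_Z η t ht := by
    have := (h.eq_Z η t ht).neg
    rw [← map_neg] at this
    refine (this.congr_deriv ?_).congr_of_eventuallyEq ?_
    · congr 1; simp only [Pi.neg_apply]; module
    · exact Eventually.of_forall fun s => by simp

section Uniqueness

/-- The primitive of a curve that is continuous on the half line. -/
noncomputable def halfLinePrimitive (K : ℝ → L2C n) (t : ℝ) : L2C n :=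
  -- Freezing K at its value at 0 for negative times makes the integrand continuous on the whole
  -- line, so the primitive has a two-sided derivative even at t = 0.
  ∫ s in (0 : ℝ)..t, K (max s 0)

theorem hasDerivAt_halfLinePrimitive {K : ℝ → L2C n} (hK : ContinuousOn K (Ici 0)) {t : ℝ}
    (ht : 0 ≤ t) : HasDerivAt (halfLinePrimitive K) (K t) t := by
  have hc : Continuous fun s => K (max s 0) :=
    hK.comp_continuous (by fun_prop) fun s => le_max_right s 0
  have h := (hc.integral_hasStrictDerivAt 0 t).hasDerivAt
  rw [max_eq_left ht] at h
  exact h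

/-- A weak evolution equation `H' = 4π²|ξ|² K` holds in integrated form almost everywhere. -/
theorem sub_ae_eq_symb_mul_primitive {H K : ℝ → L2C n} (hH : ContinuousOn H (Ici 0))
    (hK : ContinuousOn K (Ici 0))
    (h : ∀ η t, 0 < t → HasDerivAt (fun s => schwartzPairing η (H s))
      (schwartzPairing (symbMul η) (K t)) t) {t : ℝ} (ht : 0 ≤ t) :
    ((H t - H 0 : L2C n) : EuclideanSpace ℝ (Fin n) → ℂ) =ᵐ[volume]
      fun ξ => (symb ξ : ℂ) * halfLinePrimitive K t ξ := by
  apply ae_eq_symb_mul_of_schwartzPairing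
  intro η
  -- The weak equation is available only for positive times; the endpoint 0 is reached by
  -- continuity.
  have hd : ∀ τ ∈ Ioo 0 t, HasDerivAt (fun τ => schwartzPairing η (H τ) -
      schwartzPairing (symbMul η) (halfLinePrimitive K τ)) 0 τ := by
    intro τ hτ
    have h2 := (schwartzPairing (symbMul η)).hasFDerivAt.restrictScalars ℝ |>.comp_hasDerivAt τ
      (hasDerivAt_halfLinePrimitive hK hτ.1.le)
    refine ((h η τ hτ.1).sub h2).congr_deriv ?_
    simp
  have hc : ContinuousOn (fun τ => schwartzPairing η (H τ) -
      schwartzPairing (symbMul η) (halfLinePrimitive K τ)) (Icc 0 t) := by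
    apply ContinuousOn.sub
    · exact (schwartzPairing η).continuous.comp_continuousOn (hH.mono Icc_subset_Ici_self)
    · exact (schwartzPairing (symbMul η)).continuous.comp_continuousOn fun τ hτ =>
        (hasDerivAt_halfLinePrimitive hK hτ.1).continuousAt.continuousWithinAt
  have := intervalIntegral.integral_eq_sub_of_hasDerivAt_of_le ht hc hd (by simp)
  simp only [intervalIntegral.integral_zero] at this
  have h0 : halfLinePrimitive K 0 = 0 := by simp [halfLinePrimitive]
  rw [h0, map_zero, sub_zero] at this
  rw [map_sub]
  linear_combination -this

/-- After truncation in frequency, a weak evolution equation becomes a strong one. -/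
theorem hasDerivWithinAt_truncation {H K : ℝ → L2C n} (hH : ContinuousOn H (Ici 0))
    (hK : ContinuousOn K (Ici 0))
    (h : ∀ η t, 0 < t → HasDerivAt (fun s => schwartzPairing η (H s))
      (schwartzPairing (symbMul η) (K t)) t)
    {χ : EuclideanSpace ℝ (Fin n) → ℝ} {T M : L2C n →L[ℂ] L2C n}
    (hT : ∀ u, T u =ᵐ[volume] fun ξ => (χ ξ : ℂ) * u ξ)
    (hM : ∀ u, M u =ᵐ[volume] fun ξ => ((symb ξ * χ ξ : ℝ) : ℂ) * u ξ) {t : ℝ} (ht : 0 ≤ t) :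
    HasDerivWithinAt (fun s => T (H s)) (M (K t)) (Ici 0) t := by
  have h1 : ∀ τ ∈ Ici (0 : ℝ), T (H τ) = T (H 0) + M (halfLinePrimitive K τ) := by
    intro τ hτ
    rw [← sub_eq_iff_eq_add', ← map_sub]
    apply Lp.ext
    filter_upwards [hT (H τ - H 0), hM (halfLinePrimitive K τ),
      sub_ae_eq_symb_mul_primitive hH hK h hτ] with ξ a1 a2 a3
    rw [a1, a2, a3]; push_cast; ring
  have h2 := ((M.hasFDerivAt.restrictScalars ℝ).comp_hasDerivAt t
    (hasDerivAt_halfLinePrimitive hK ht)).const_add (T (H 0))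
  exact (h2.hasDerivWithinAt.congr h1 (h1 t ht))

/-- On a ball of frequencies the symbol is bounded, so the truncated triple solves a linear ODE in
(L²)³ with a bounded generator and vanishes by uniqueness for Lipschitz ODEs. Balls of integer
radius exhaust the space. -/
theorem IsFourierSolution.eq_zero {W B D q : ℝ} {F G Z : ℝ → L2C n}
    (h : IsFourierSolution W B D q F G Z) (hF : F 0 = 0) (hG : G 0 = 0) (hZ : Z 0 = 0) {t : ℝ}
    (ht : 0 ≤ t) : F t = 0 ∧ G t = 0 ∧ Z t = 0 := by
  have key : ∀ R : ℕ, ∀ᵐ ξ, ‖ξ‖ ≤ R → F t ξ = 0 ∧ G t ξ = 0 ∧ Z t ξ = 0 := by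
    intro R
    set χ : EuclideanSpace ℝ (Fin n) → ℝ := (Metric.closedBall 0 (R : ℝ)).indicator 1 with hχ
    have hχm : Measurable χ := measurable_one.indicator measurableSet_closedBall
    have hχb : ∀ ξ, |χ ξ| ≤ 1 := fun ξ => by
      rw [hχ]; by_cases hξ : ξ ∈ Metric.closedBall 0 (R : ℝ) <;> simp [hξ]
    have hmb : ∀ ξ, |symb ξ * χ ξ| ≤ (2 * Real.pi) ^ 2 * (R : ℝ) ^ 2 := fun ξ => by
      rw [hχ]
      by_cases hξ : ξ ∈ Metric.closedBall (0 : EuclideanSpace ℝ (Fin n)) (R : ℝ)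
      · rw [indicator_of_mem hξ, Pi.one_apply, mul_one, abs_of_nonneg (symb_nonneg ξ)]
        rw [mem_closedBall_zero_iff] at hξ
        unfold symb; gcongr
      · rw [indicator_of_notMem hξ]; simp; positivity
    obtain ⟨T, hT⟩ := exists_mulLp (μ := volume) hχm.aestronglyMeasurable hχb
    obtain ⟨M, hM⟩ := exists_mulLp (μ := volume)
      (continuous_symb.measurable.mul hχm).aestronglyMeasurable hmb
    -- The cutoff is idempotent; this closes the system in the truncated unknowns.
    have hMT : ∀ u, M (T u) = M u := fun u => by
      apply Lp.ext
      filter_upwards [hM (T u), hM u, hT u] with ξ a1 a2 a3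
      rw [a1, a2, a3, ← mul_assoc, ← Complex.ofReal_mul]
      congr 2
      by_cases hξ : ξ ∈ Metric.closedBall (0 : EuclideanSpace ℝ (Fin n)) (R : ℝ) <;> simp [hχ, hξ]
    let M' : L2C n →L[ℝ] L2C n := M.restrictScalars ℝ
    let pF := ContinuousLinearMap.fst ℝ (L2C n) (L2C n × L2C n)
    let pG := (ContinuousLinearMap.fst ℝ (L2C n) (L2C n)).comp
      (ContinuousLinearMap.snd ℝ (L2C n) (L2C n × L2C n))
    let pZ := (ContinuousLinearMap.snd ℝ (L2C n) (L2C n)).comp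
      (ContinuousLinearMap.snd ℝ (L2C n) (L2C n × L2C n))
    let A : (L2C n × L2C n × L2C n) →L[ℝ] (L2C n × L2C n × L2C n) :=
      pG.prod ((M'.comp (-W • pF - B • pG + D • pZ)).prod (M'.comp (-D • pZ + q • pG)))
    let U : ℝ → L2C n × L2C n × L2C n := fun s => (T (F s), T (G s), T (Z s))
    have hU : ∀ τ, 0 ≤ τ → HasDerivWithinAt U (A (U τ)) (Ici 0) τ := by
      intro τ hτ
      have d1 := (T.hasFDerivAt.restrictScalars ℝ).comp_hasDerivWithinAt τ (h.deriv_F τ hτ)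
      have d2 := hasDerivWithinAt_truncation h.cont_G
        (((h.cont_F.const_smul (-W)).sub (h.cont_G.const_smul B)).add (h.cont_Z.const_smul D))
        h.eq_G hT hM hτ
      have d3 := hasDerivWithinAt_truncation h.cont_Z
        ((h.cont_Z.const_smul (-D)).add (h.cont_G.const_smul q)) h.eq_Z hT hM hτ
      refine (d1.prodMk (d2.prodMk d3)).congr_deriv ?_
      have hTs : ∀ (c : ℝ) (u : L2C n), T (c • u) = c • T u := fun c u =>
        T.map_smul_of_tower c u
      have e1 : -W • T (F τ) - B • T (G τ) + D • T (Z τ) =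
        T (-W • F τ - B • G τ + D • Z τ) := by rw [map_add, map_sub, hTs, hTs, hTs]
      have e2 : -D • T (Z τ) + q • T (G τ) = T (-D • Z τ + q • G τ) := by
        rw [map_add, hTs, hTs]
      refine Prod.ext rfl (Prod.ext ?_ ?_)
      · change M (-W • F τ - B • G τ + D • Z τ) = M (-W • T (F τ) - B • T (G τ) + D • T (Z τ))
        rw [e1, hMT]
      · change M (-D • Z τ + q • G τ) = M (-D • T (Z τ) + q • T (G τ))
        rw [e2, hMT]
    have hzero : EqOn U (fun _ => 0) (Icc 0 t) := by
      refine ODE_solution_unique (v := fun _ => A) (K := ‖A‖₊) (fun _ => A.lipschitz) ?_ ?_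
        continuousOn_const (fun τ _ => ?_) ?_
      · exact fun τ hτ => ((hU τ hτ.1).continuousWithinAt).mono Icc_subset_Ici_self
      · exact fun τ hτ => (hU τ hτ.1).mono (Ici_subset_Ici.2 hτ.1)
      · simpa using hasDerivWithinAt_const (x := τ) (s := Ici τ) (c := (0 : L2C n × L2C n × L2C n))
      · simp [U, hF, hG, hZ]
    have hUt := hzero (right_mem_Icc.2 ht)
    have zero_of : ∀ u, T u = 0 → ∀ᵐ ξ, ‖ξ‖ ≤ R → u ξ = 0 := by
      intro u hu
      have h0 := hT u
      rw [hu] at h0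
      filter_upwards [h0, Lp.coeFn_zero ℂ 2 (volume : Measure (EuclideanSpace ℝ (Fin n)))]
        with ξ a1 a2 hξ
      rw [a2] at a1
      have : χ ξ = 1 := by
        rw [hχ, indicator_of_mem (by simpa using hξ)]; rfl
      simpa [this] using a1.symm
    filter_upwards [zero_of _ (congrArg Prod.fst hUt),
      zero_of _ (congrArg (fun x => x.2.1) hUt),
      zero_of _ (congrArg (fun x => x.2.2) hUt)] with ξ a1 a2 a3 hξ
    exact ⟨a1 hξ, a2 hξ, a3 hξ⟩
  have key' := ae_all_iff.2 key
  refine ⟨?_, ?_, ?_⟩ <;>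
  · rw [Lp.eq_zero_iff_ae_eq_zero]
    filter_upwards [key'] with ξ hξ
    obtain ⟨R, hR⟩ := exists_nat_ge ‖ξ‖
    first
    | exact (hξ R hR).1
    | exact (hξ R hR).2.1
    | exact (hξ R hR).2.2

end Uniqueness

/-! ### Existence: time-dependent Fourier multipliers. -/

section Multiplier

/-- A multiplier family `m t s` (time, squared frequency) is bounded on compact time intervals,
uniformly in the frequency. -/
def LocallyBoundedInTime (m : ℝ → ℝ → ℝ) : Prop :=
  ∀ T, ∃ C, ∀ t ∈ Icc 0 T, ∀ s, 0 ≤ s → |m t s| ≤ C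

variable {m k : ℝ → ℝ → ℝ} {u : L2C n} {F G : ℝ → L2C n}

theorem continuousOn_multiplier (hm : ∀ s, Continuous fun t => m t s)
    (hb : LocallyBoundedInTime m)
    (hF : ∀ t, 0 ≤ t → F t =ᵐ[volume] fun ξ => (m t (symb ξ) : ℂ) * u ξ) :
    ContinuousOn F (Ici 0) := by
  intro t ht
  rw [ContinuousWithinAt, ← tendsto_sub_nhds_zero_iff]
  obtain ⟨C, hC⟩ := hb (t + 1)
  have hnear : ∀ᶠ τ in 𝓝[Ici 0] t, τ ∈ Icc 0 (t + 1) := by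
    filter_upwards [self_mem_nhdsWithin,
      mem_nhdsWithin_of_mem_nhds (Iio_mem_nhds (lt_add_one t))] with τ h1 h2
    exact ⟨h1, le_of_lt h2⟩
  refine tendsto_zero_of_ae_eq_mul (a := fun τ ξ => m τ (symb ξ) - m t (symb ξ)) (u := u)
    (C := C + C) ?_ ?_ fun ξ => ?_
  · filter_upwards [hnear] with τ hτ
    filter_upwards [hF τ hτ.1, hF t ht, Lp.coeFn_sub (F τ) (F t)] with ξ a1 a2 a3
    rw [a3, Pi.sub_apply, a1, a2]; push_cast; ring
  · filter_upwards [hnear] with τ hτ ξ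
    exact (abs_sub _ _).trans (add_le_add (hC τ hτ _ (symb_nonneg ξ))
      (hC t ⟨ht, by linarith⟩ _ (symb_nonneg ξ)))
  · rw [tendsto_sub_nhds_zero_iff]
    exact (hm (symb ξ)).continuousAt.continuousWithinAt

/-- By the mean value inequality the difference quotients are bounded by the supremum of `k`,
uniformly in the frequency, so dominated convergence makes them converge in L². -/
theorem hasDerivWithinAt_multiplier (hm : ∀ s t, HasDerivAt (fun t => m t s) (k t s) t)
    (hb : LocallyBoundedInTime k)
    (hF : ∀ t, 0 ≤ t → F t =ᵐ[volume] fun ξ => (m t (symb ξ) : ℂ) * u ξ)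
    (hG : ∀ t, 0 ≤ t → G t =ᵐ[volume] fun ξ => (k t (symb ξ) : ℂ) * u ξ) {t : ℝ} (ht : 0 ≤ t) :
    HasDerivWithinAt F (G t) (Ici 0) t := by
  rw [hasDerivWithinAt_iff_tendsto_slope, ← tendsto_sub_nhds_zero_iff]
  obtain ⟨C, hC⟩ := hb (t + 1)
  have hnear : ∀ᶠ τ in 𝓝[Ici 0 \ {t}] t, τ ∈ Icc 0 (t + 1) ∧ τ ≠ t := by
    filter_upwards [self_mem_nhdsWithin,
      mem_nhdsWithin_of_mem_nhds (Iio_mem_nhds (lt_add_one t))] with τ h1 h2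
    exact ⟨⟨h1.1, le_of_lt h2⟩, h1.2⟩
  refine tendsto_zero_of_ae_eq_mul
    (a := fun τ ξ => slope (fun t => m t (symb ξ)) t τ - k t (symb ξ)) (u := u)
    (C := C + C) ?_ ?_ fun ξ => ?_
  · filter_upwards [hnear] with τ hτ
    filter_upwards [hF τ hτ.1.1, hF t ht, hG t ht, Lp.coeFn_sub (F τ) (F t),
      Lp.coeFn_sub (slope F t τ) (G t), Lp.coeFn_smul ((τ - t)⁻¹) (F τ - F t)]
      with ξ a1 a2 a3 a4 a5 a6
    rw [a5, Pi.sub_apply, slope_def_module, a6, Pi.smul_apply, a4, Pi.sub_apply, a1, a2, a3,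
      slope_def_module, Complex.real_smul, smul_eq_mul]
    push_cast; ring
  · filter_upwards [hnear] with τ hτ ξ
    have htI : t ∈ Icc 0 (t + 1) := ⟨ht, by linarith⟩
    refine (abs_sub _ _).trans (add_le_add ?_ (hC t htI _ (symb_nonneg ξ)))
    have h1 := (convex_Icc 0 (t + 1)).norm_image_sub_le_of_norm_hasDerivWithin_le
      (fun τ _ => (hm (symb ξ) τ).hasDerivWithinAt) (fun τ hτ => hC τ hτ _ (symb_nonneg ξ))
      htI hτ.1
    rw [slope_def_module, smul_eq_mul, abs_mul, abs_inv,
      inv_mul_le_iff₀ (abs_pos.2 (sub_ne_zero.2 hτ.2)), mul_comm]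
    exact h1
  · rw [tendsto_sub_nhds_zero_iff]
    exact hasDerivWithinAt_iff_tendsto_slope.1 (hm (symb ξ) t).hasDerivWithinAt

/-- The time derivative s k(t, s) need not be bounded in s, so differentiability in L² is not
available. In the weak form the factor s is moved onto the test function, leaving the bounded k to
dominate. -/
theorem hasDerivAt_schwartzPairing_multiplier
    (hm : ∀ s t, HasDerivAt (fun t => m t s) (s * k t s) t) (hb : LocallyBoundedInTime k)
    (hF : ∀ t, 0 ≤ t → F t =ᵐ[volume] fun ξ => (m t (symb ξ) : ℂ) * u ξ)
    (hG : ∀ t, 0 ≤ t → G t =ᵐ[volume] fun ξ => (k t (symb ξ) : ℂ) * u ξ)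
    (η : 𝓢(EuclideanSpace ℝ (Fin n), ℂ)) {t : ℝ} (ht : 0 < t) :
    HasDerivAt (fun s => schwartzPairing η (F s)) (schwartzPairing (symbMul η) (G t)) t := by
  obtain ⟨C, hC⟩ := hb (t + 1)
  have hint : ∀ (ζ : 𝓢(EuclideanSpace ℝ (Fin n), ℂ)) (v : L2C n),
      Integrable (fun ξ => ζ ξ * v ξ) volume := fun ζ v =>
    (ζ.memLp 2 volume).integrable_mul (Lp.memLp v)
  have hint' : ∀ τ, 0 ≤ τ → Integrable (fun ξ => η ξ * ((m τ (symb ξ) : ℂ) * u ξ)) volume :=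
    fun τ hτ => (hint η (F τ)).congr (by filter_upwards [hF τ hτ] with ξ h; rw [h])
  have hS : Ioo 0 (t + 1) ∈ 𝓝 t := Ioo_mem_nhds ht (lt_add_one t)
  have key := hasDerivAt_integral_of_dominated_loc_of_deriv_le (μ := volume) (𝕜 := ℝ)
    (F := fun τ ξ => η ξ * ((m τ (symb ξ) : ℂ) * u ξ))
    (F' := fun τ ξ => symbMul η ξ * ((k τ (symb ξ) : ℂ) * u ξ)) (x₀ := t)
    (bound := fun ξ => C * ‖symbMul η ξ * u ξ‖) hS ?_ (hint' t ht.le) ?_ ?_ ?_ ?_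
  · refine (key.2.congr_deriv ?_).congr_of_eventuallyEq ?_
    · rw [schwartzPairing_apply]
      apply integral_congr_ae
      filter_upwards [hG t ht.le] with ξ h
      rw [h]
    · filter_upwards [hS] with τ hτ
      rw [schwartzPairing_apply]
      apply integral_congr_ae
      filter_upwards [hF τ hτ.1.le] with ξ h
      rw [h]
  · filter_upwards [hS] with τ hτ using (hint' τ hτ.1.le).aestronglyMeasurable
  · refine ((hint (symbMul η) (G t)).aestronglyMeasurable).congr ?_
    filter_upwards [hG t ht.le] with ξ h
    rw [h]
  · refine Eventually.of_forall fun ξ τ hτ => ?_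
    have := hC τ ⟨hτ.1.le, hτ.2.le⟩ _ (symb_nonneg ξ)
    rw [norm_mul, norm_mul, norm_mul, Complex.norm_real, Real.norm_eq_abs]
    calc _ ≤ ‖symbMul η ξ‖ * (C * ‖u ξ‖) := by gcongr
      _ = _ := by ring
  · exact ((hint (symbMul η) u).norm.const_mul C)
  · refine Eventually.of_forall fun ξ τ _ => ?_
    have h1 := ((hm (symb ξ) τ).ofReal_comp.mul_const (u ξ)).const_mul (η ξ)
    refine h1.congr_deriv ?_
    rw [symbMul_apply]; push_cast; ring

end Multiplier

namespace ModeCoeff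

variable {W B D q ν : ℝ} (h : ModeCoeff W B D q ν)

include h

theorem locallyBoundedInTime_modeFlow (v : ℝ × ℝ × ℝ) :
    LocallyBoundedInTime (fun t s => (modeFlow W B D q v t s).1) ∧
    LocallyBoundedInTime (fun t s => (modeFlow W B D q v t s).2.1) ∧
    LocallyBoundedInTime (fun t s => (modeFlow W B D q v t s).2.2) := by
  obtain ⟨C, K, hC, hb⟩ := h.exists_growth_bound
  have key : ∀ T, ∃ A, 0 ≤ A ∧ ∀ t ∈ Icc 0 T, ∀ s, 0 ≤ s → (modeFlow W B D q v t s).1 ^ 2 +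
      (modeFlow W B D q v t s).2.1 ^ 2 + (modeFlow W B D q v t s).2.2 ^ 2 ≤ A ^ 2 := by
    intro T
    set A := C * Real.exp (|K| * T) * (v.1 ^ 2 + v.2.1 ^ 2 + v.2.2 ^ 2)
    have hA : 0 ≤ A := by positivity
    refine ⟨√A, Real.sqrt_nonneg _, fun t ht s hs => ?_⟩
    rw [Real.sq_sqrt hA]
    refine (hb s _ _ _ hs (isMode_modeFlow W B D q s v) t ht.1).trans ?_
    simp only [modeFlow_zero]
    have : K * t ≤ |K| * T := mul_le_mul (le_abs_self K) ht.2 ht.1 (abs_nonneg K)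
    change _ ≤ C * Real.exp (|K| * T) * (v.1 ^ 2 + v.2.1 ^ 2 + v.2.2 ^ 2)
    gcongr
  refine ⟨fun T => ?_, fun T => ?_, fun T => ?_⟩ <;>
  · obtain ⟨A, hA, hk⟩ := key T
    refine ⟨A, fun t ht s hs => abs_le_of_sq_le_sq ((le_trans ?_ (hk t ht s hs))) hA⟩
    nlinarith [sq_nonneg (modeFlow W B D q v t s).1, sq_nonneg (modeFlow W B D q v t s).2.1,
      sq_nonneg (modeFlow W B D q v t s).2.2]

/-- The flow of the modes acting on one `L²` function gives a solution. -/
theorem exists_isFourierSolution_modeFlow (v : ℝ × ℝ × ℝ) (u : L2C n) :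
    ∃ F G Z : ℝ → L2C n, IsFourierSolution W B D q F G Z ∧ ∀ t, 0 ≤ t →
      (F t =ᵐ[volume] fun ξ => ((modeFlow W B D q v t (symb ξ)).1 : ℂ) * u ξ) ∧
      (G t =ᵐ[volume] fun ξ => ((modeFlow W B D q v t (symb ξ)).2.1 : ℂ) * u ξ) ∧
      (Z t =ᵐ[volume] fun ξ => ((modeFlow W B D q v t (symb ξ)).2.2 : ℂ) * u ξ) := by
  obtain ⟨b1, b2, b3⟩ := h.locallyBoundedInTime_modeFlow v
  have ex : ∀ m : ℝ → ℝ → ℝ, LocallyBoundedInTime m → (∀ t, Continuous (m t)) →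
      ∃ F : ℝ → L2C n, ∀ t, 0 ≤ t → F t =ᵐ[volume] fun ξ => (m t (symb ξ) : ℂ) * u ξ := by
    intro m hb hm
    have : ∀ t, ∃ f : L2C n, 0 ≤ t → f =ᵐ[volume] fun ξ => (m t (symb ξ) : ℂ) * u ξ := by
      intro t
      by_cases ht : 0 ≤ t
      · obtain ⟨C, hC⟩ := hb t
        obtain ⟨T, hT⟩ := exists_mulLp (μ := volume)
          ((hm t).comp (continuous_symb (n := n))).aestronglyMeasurable
          fun ξ => hC t ⟨ht, le_rfl⟩ _ (symb_nonneg ξ)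
        exact ⟨T u, fun _ => hT u⟩
      · exact ⟨0, fun h => absurd h ht⟩
    choose F hF using this
    exact ⟨F, hF⟩
  have hc := continuous_modeFlow W B D q v
  have hct : ∀ s, Continuous fun t => modeFlow W B D q v t s := fun s =>
    hc.comp (by fun_prop : Continuous fun t : ℝ => (t, s))
  have hcs : ∀ t, Continuous fun s => modeFlow W B D q v t s := fun t =>
    hc.comp (by fun_prop : Continuous fun s : ℝ => (t, s))
  obtain ⟨F, hF⟩ := ex _ b1 fun t => (hcs t).fst
  obtain ⟨G, hG⟩ := ex _ b2 fun t => (hcs t).snd.fst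
  obtain ⟨Z, hZ⟩ := ex _ b3 fun t => (hcs t).snd.snd
  have hmode := fun s => isMode_modeFlow W B D q s v
  refine ⟨F, G, Z, ⟨?_, ?_, ?_, ?_, ?_⟩, fun t ht => ⟨hF t ht, hG t ht, hZ t ht⟩⟩
  · exact fun t ht => hasDerivWithinAt_multiplier (fun s t => (hmode s).deriv_f t) b2 hF hG ht
  · exact continuousOn_multiplier (fun s => (hct s).snd.fst) b2 hG
  · exact continuousOn_multiplier (fun s => (hct s).snd.snd) b3 hZ
  · intro η t ht
    refine hasDerivAt_schwartzPairing_multiplier (G := fun t => -W • F t - B • G t + D • Z t)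
      (fun s t => (hmode s).deriv_g t) ?_ hG ?_ η ht
    · intro T
      obtain ⟨C1, h1⟩ := b1 T
      obtain ⟨C2, h2⟩ := b2 T
      obtain ⟨C3, h3⟩ := b3 T
      refine ⟨|W| * C1 + |B| * C2 + |D| * C3, fun t ht s hs => ?_⟩
      refine (abs_add_le _ _).trans (add_le_add ((abs_sub _ _).trans (add_le_add ?_ ?_)) ?_)
      · rw [abs_mul, abs_neg]; exact mul_le_mul_of_nonneg_left (h1 t ht s hs) (abs_nonneg _)
      · rw [abs_mul]; exact mul_le_mul_of_nonneg_left (h2 t ht s hs) (abs_nonneg _)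
      · rw [abs_mul]; exact mul_le_mul_of_nonneg_left (h3 t ht s hs) (abs_nonneg _)
    · intro t ht
      filter_upwards [hF t ht, hG t ht, hZ t ht, Lp.coeFn_add (-W • F t - B • G t) (D • Z t),
        Lp.coeFn_sub (-W • F t) (B • G t), Lp.coeFn_smul (-W) (F t), Lp.coeFn_smul B (G t),
        Lp.coeFn_smul D (Z t)] with ξ a1 a2 a3 a4 a5 a6 a7 a8
      rw [a4, Pi.add_apply, a5, Pi.sub_apply, a6, a7, a8, Pi.smul_apply, Pi.smul_apply,
        Pi.smul_apply, a1, a2, a3]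
      simp only [Complex.real_smul]
      push_cast; ring
  · intro η t ht
    refine hasDerivAt_schwartzPairing_multiplier (G := fun t => -D • Z t + q • G t)
      (fun s t => (hmode s).deriv_z t) ?_ hZ ?_ η ht
    · intro T
      obtain ⟨C2, h2⟩ := b2 T
      obtain ⟨C3, h3⟩ := b3 T
      refine ⟨|D| * C3 + |q| * C2, fun t ht s hs => ?_⟩
      refine (abs_add_le _ _).trans (add_le_add ?_ ?_)
      · rw [abs_mul, abs_neg]; exact mul_le_mul_of_nonneg_left (h3 t ht s hs) (abs_nonneg _)
      · rw [abs_mul]; exact mul_le_mul_of_nonneg_left (h2 t ht s hs) (abs_nonneg _)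
    · intro t ht
      filter_upwards [hG t ht, hZ t ht, Lp.coeFn_add (-D • Z t) (q • G t),
        Lp.coeFn_smul (-D) (Z t), Lp.coeFn_smul q (G t)] with ξ a1 a2 a3 a4 a5
      rw [a3, Pi.add_apply, a4, a5, Pi.smul_apply, Pi.smul_apply, a1, a2]
      simp only [Complex.real_smul]
      push_cast; ring

end ModeCoeff

/-! ### Passing between real functions and their transforms. -/

section RealFourier

/-- The Fourier transform of real `L²` functions. -/
noncomputable def realFourier : L2 n →L[ℝ] L2C n :=
  ((Lp.fourierTransformₗᵢ (EuclideanSpace ℝ (Fin n)) ℂ).toContinuousLinearEquiv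
    : L2C n →L[ℂ] L2C n).restrictScalars ℝ ∘L Complex.ofRealCLM.compLpL 2 volume

/-- The real part of the inverse Fourier transform. -/
noncomputable def reFourierInv : L2C n →L[ℝ] L2 n :=
  Complex.reCLM.compLpL 2 volume ∘L
    ((Lp.fourierTransformₗᵢ (EuclideanSpace ℝ (Fin n)) ℂ).symm.toContinuousLinearEquiv
    : L2C n →L[ℂ] L2C n).restrictScalars ℝ

theorem realFourier_apply (f : L2 n) :
    realFourier f = 𝓕 (Complex.ofRealCLM.compLpL 2 volume f : L2C n) := rfl

theorem reFourierInv_apply (f : L2C n) :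
    reFourierInv f = Complex.reCLM.compLpL 2 volume (𝓕⁻ f : L2C n) := rfl

theorem norm_realFourier (f : L2 n) : ‖realFourier f‖ = ‖f‖ := by
  rw [realFourier_apply, Lp.norm_fourier_eq]
  apply le_antisymm <;>
  · apply Lp.norm_le_norm_of_ae_le
    filter_upwards [ContinuousLinearMap.coeFn_compLpL (p := 2) (μ := volume) Complex.ofRealCLM f]
      with x hx
    simp [hx]

theorem realFourier_injective : Function.Injective (realFourier (n := n)) := by
  rw [injective_iff_map_eq_zero]
  intro f hf
  rw [← norm_eq_zero, ← norm_realFourier, hf, norm_zero]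

theorem reFourierInv_realFourier (f : L2 n) : reFourierInv (realFourier f) = f := by
  rw [reFourierInv_apply, realFourier_apply, FourierTransform.fourierInv_fourier_eq]
  apply Lp.ext
  filter_upwards [ContinuousLinearMap.coeFn_compLpL (p := 2) (μ := volume) Complex.ofRealCLM f,
    ContinuousLinearMap.coeFn_compLpL (p := 2) (μ := volume) Complex.reCLM
      (Complex.ofRealCLM.compLpL 2 volume f)] with x h1 h2
  rw [h2, h1]; simp

theorem pairing_eq_schwartzPairing (f : L2 n) (η : 𝓢(EuclideanSpace ℝ (Fin n), ℂ)) :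
    pairing f η = schwartzPairing (𝓕⁻ η) (realFourier f) := by
  rw [realFourier_apply, ← schwartzPairing_eq_fourier, schwartzPairing_apply, pairing]
  apply integral_congr_ae
  filter_upwards [ContinuousLinearMap.coeFn_compLpL (p := 2) (μ := volume) Complex.ofRealCLM f]
    with x hx
  rw [hx, mul_comm]; rfl

theorem pairing_laplacian (f : L2 n) (η : 𝓢(EuclideanSpace ℝ (Fin n), ℂ)) :
    pairing f (Δ η) = -schwartzPairing (symbMul (𝓕⁻ η)) (realFourier f) := by
  rw [pairing_eq_schwartzPairing, fourierInv_laplacian, schwartzPairing_apply,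
    schwartzPairing_apply, ← integral_neg]
  congr 1; ext x; simp

/-- Complex conjugation of Schwartz functions. -/
noncomputable def conjSchwartz : 𝓢(EuclideanSpace ℝ (Fin n), ℂ) →L[ℝ] 𝓢(EuclideanSpace ℝ (Fin n), ℂ) :=
  SchwartzMap.postcompCLM (Complex.conjCLE : ℂ →L[ℝ] ℂ)

theorem conjSchwartz_apply (η : 𝓢(EuclideanSpace ℝ (Fin n), ℂ)) (x : EuclideanSpace ℝ (Fin n)) :
    conjSchwartz η x = (starRingEnd ℂ) (η x) := rfl

theorem laplacian_conjSchwartz (η : 𝓢(EuclideanSpace ℝ (Fin n), ℂ)) :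
    Δ (conjSchwartz η) = conjSchwartz (Δ η) := by
  ext x
  rw [SchwartzMap.laplacian_apply, conjSchwartz_apply, SchwartzMap.laplacian_apply]
  exact ((η.smooth 2).contDiffAt (x := x)).laplacian_CLM_comp_left
    (l := (Complex.conjCLE : ℂ →L[ℝ] ℂ))

/-- Taking real parts avoids having to show that the Fourier-side solution has the symmetry of a
real function. The real part is the average with the conjugate, and the conjugation is shifted to
the test function. -/
theorem pairing_reFourierInv (u : L2C n) (η : 𝓢(EuclideanSpace ℝ (Fin n), ℂ)) :
    pairing (reFourierInv u) η = (schwartzPairing (𝓕⁻ η) u +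
      (starRingEnd ℂ) (schwartzPairing (𝓕⁻ (conjSchwartz η)) u)) / 2 := by
  have h1 : ∀ ζ : 𝓢(EuclideanSpace ℝ (Fin n), ℂ),
      schwartzPairing (𝓕⁻ ζ) u = schwartzPairing ζ (𝓕⁻ u : L2C n) := fun ζ => by
    rw [schwartzPairing_eq_fourier ζ, FourierTransform.fourier_fourierInv_eq]
  have hint : ∀ ζ : 𝓢(EuclideanSpace ℝ (Fin n), ℂ),
      Integrable (fun x => ζ x * (𝓕⁻ u : L2C n) x) volume := fun ζ =>
    (ζ.memLp 2 volume).integrable_mul (Lp.memLp _)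
  rw [h1, h1, schwartzPairing_apply, schwartzPairing_apply, ← integral_conj,
    ← integral_add (hint η) (by
      simpa using (Complex.conjCLE : ℂ →L[ℝ] ℂ).integrable_comp (hint (conjSchwartz η))),
    ← integral_div, pairing]
  apply integral_congr_ae
  rw [reFourierInv_apply]
  filter_upwards [ContinuousLinearMap.coeFn_compLpL (p := 2) (μ := volume) Complex.reCLM
    (𝓕⁻ u : L2C n)] with x hx
  rw [hx, conjSchwartz_apply, map_mul, Complex.conj_conj, Complex.reCLM_apply,
    Complex.re_eq_add_conj]
  ring

theorem pairing_reFourierInv_laplacian (u : L2C n) (η : 𝓢(EuclideanSpace ℝ (Fin n), ℂ)) :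
    pairing (reFourierInv u) (Δ η) = -(schwartzPairing (symbMul (𝓕⁻ η)) u +
      (starRingEnd ℂ) (schwartzPairing (symbMul (𝓕⁻ (conjSchwartz η))) u)) / 2 := by
  have hneg : ∀ ζ : 𝓢(EuclideanSpace ℝ (Fin n), ℂ),
      schwartzPairing (-ζ) u = -schwartzPairing ζ u := fun ζ => by
    rw [schwartzPairing_apply, schwartzPairing_apply, ← integral_neg]
    congr 1; ext x; simp
  rw [pairing_reFourierInv, ← laplacian_conjSchwartz, fourierInv_laplacian, fourierInv_laplacian,
    hneg, hneg, map_neg]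
  ring

end RealFourier

/-! ### Reduction of the acoustic system to modes. -/

namespace AcousticParams

variable (p : AcousticParams)

/-- The total diffusivity `(1 + β) ν₀` of sound due to viscosity. -/
def visc : ℝ := (1 + p.β) * p.ν₀

/-- The square `γ c₀²` of the adiabatic speed of sound. -/
def W : ℝ := p.γ * p.c₀ ^ 2

/-- The damping coefficient of the acoustic modes. -/
def B : ℝ := p.visc + (p.γ - 1) * p.D

/-- The coupling coefficient between the acoustic and the thermal modes. -/
def q : ℝ := (p.γ - 1) * (p.D - p.visc)

theorem visc_pos : 0 < p.visc := mul_pos (by linarith [p.β_gt]) p.ν₀_pos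

/-- With ν = D/S, where S denotes the displayed denominator, one has S + q = 2B and thus D + νq =
2νB. The discriminant condition becomes B < S, which holds because S - B = γ(1+β)ν₀ > 0. -/
theorem modeCoeff : ModeCoeff p.W p.B p.D p.q
    (p.D / (2 * p.visc + (p.γ - 1) * p.D + (p.γ - 1) * p.visc)) := by
  have hb := p.visc_pos
  have hD := p.D_pos
  have hγ : 0 < p.γ - 1 := by linarith [p.γ_gt]
  set S := 2 * p.visc + (p.γ - 1) * p.D + (p.γ - 1) * p.visc with hS
  have hSp : 0 < S := by positivity
  refine ⟨mul_pos (by linarith) (pow_pos p.c₀_pos 2), hD, by positivity, ?_⟩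
  have e1 : p.D + p.D / S * p.q = p.D / S * (2 * p.B) := by
    unfold B q; field_simp; rw [hS]; ring
  have hB : 0 < p.B := by unfold B; positivity
  have hBS : p.B < S := by
    have : 0 < p.visc + (p.γ - 1) * p.visc := by positivity
    unfold B; rw [hS]; linarith
  rw [e1]
  have e2 : 4 * p.B * (p.D / S * p.D) - (p.D / S * (2 * p.B)) ^ 2
      = 4 * p.B * p.D ^ 2 / S ^ 2 * (S - p.B) := by field_simp; ring
  have : 0 < 4 * p.B * p.D ^ 2 / S ^ 2 * (S - p.B) :=
    mul_pos (by positivity) (by linarith)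
  linarith

end AcousticParams

variable {p : AcousticParams}

/-- The first equation only differentiates the combination φ_t + α_p c₀² T. Subtracting α_p c₀²
times the second isolates φ_t, and the coupling term in φ raises c₀² to W = γ c₀². -/
theorem IsSolution.hasDerivAt_realFourier {φ₀ φ₁ T₀ : EuclideanSpace ℝ (Fin n) → ℝ}
    {φ φt T : ℝ → L2 n} (h : IsSolution p φ₀ φ₁ T₀ φ φt T)
    (η : 𝓢(EuclideanSpace ℝ (Fin n), ℂ)) {t : ℝ} (ht : 0 < t) :
    HasDerivAt (fun s => schwartzPairing η (realFourier (φt s)))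
      (schwartzPairing (symbMul η) (-p.W • realFourier (φ t) - p.visc • realFourier (φt t) +
        (p.αp * p.c₀ ^ 2 * (p.γ * p.D)) • realFourier (T t))) t ∧
    HasDerivAt (fun s => schwartzPairing η (realFourier (T s)))
      (schwartzPairing (symbMul η) (-(p.γ * p.D) • realFourier (T t) +
        ((p.γ - 1) / p.αp) • realFourier (φ t))) t := by
  have hα := p.αp_pos.ne'
  have h1 := h.eq_φ (𝓕 η) t ht
  have h2 := h.eq_T (𝓕 η) t ht
  simp only [pairing_laplacian] at h1 h2
  simp only [pairing_eq_schwartzPairing,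
    FourierTransform.fourierInv_fourier_eq] at h1 h2
  constructor
  · have h3 := h1.sub (h2.const_mul ((p.αp * p.c₀ ^ 2 : ℝ) : ℂ))
    refine (h3.congr_deriv ?_).congr_of_eventuallyEq (Eventually.of_forall fun s => ?_)
    · simp only [map_add, map_sub, ContinuousLinearMap.map_smul_of_tower, Complex.real_smul,
        AcousticParams.W, AcousticParams.visc]
      have : (p.αp : ℂ) ≠ 0 := by exact_mod_cast hα
      push_cast
      field_simp
      ring
    · simp
  · refine h2.congr_deriv ?_
    simp only [map_add, ContinuousLinearMap.map_smul_of_tower, Complex.real_smul]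
    push_cast
    ring

/-- In the equation for z the two contributions of φ are -(γ-1)γc₀² and γα_p c₀²(γ-1)/α_p, which
cancel. -/
theorem IsSolution.isFourierSolution {φ₀ φ₁ T₀ : EuclideanSpace ℝ (Fin n) → ℝ}
    {φ φt T : ℝ → L2 n} (h : IsSolution p φ₀ φ₁ T₀ φ φt T) :
    IsFourierSolution p.W p.B p.D p.q (fun t => realFourier (φ t)) (fun t => realFourier (φt t))
      (fun t => (p.γ - 1) • realFourier (φt t) +
        (p.γ * (p.αp * p.c₀ ^ 2)) • realFourier (T t)) where
  deriv_F t ht := realFourier.hasFDerivAt.comp_hasDerivWithinAt t (h.hasDeriv t ht)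
  cont_G := realFourier.continuous.comp_continuousOn h.continuous_φt
  cont_Z := ((realFourier.continuous.comp_continuousOn h.continuous_φt).const_smul (p.γ - 1)).add
    ((realFourier.continuous.comp_continuousOn h.continuous_T).const_smul
      (p.γ * (p.αp * p.c₀ ^ 2)))
  eq_G η t ht := by
    refine (h.hasDerivAt_realFourier η ht).1.congr_deriv ?_
    congr 1
    simp only [AcousticParams.B]
    module
  eq_Z η t ht := by
    obtain ⟨h1, h2⟩ := h.hasDerivAt_realFourier η ht
    simp only [map_add, map_sub, ContinuousLinearMap.map_smul_of_tower, Complex.real_smul] at h1 h2 ⊢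
    refine ((h1.const_mul ((p.γ - 1 : ℝ) : ℂ)).add
      (h2.const_mul ((p.γ * (p.αp * p.c₀ ^ 2) : ℝ) : ℂ))).congr_deriv ?_
    have : (p.αp : ℂ) ≠ 0 := by exact_mod_cast p.αp_pos.ne'
    generalize schwartzPairing (symbMul η) (realFourier (φ t)) = x
    generalize schwartzPairing (symbMul η) (realFourier (φt t)) = y
    generalize schwartzPairing (symbMul η) (realFourier (T t)) = w
    simp only [AcousticParams.W, AcousticParams.q]
    push_cast
    field_simp
    ring

/-- The temperature is recovered by inverting z = (γ-1)φ_t + γ α_p c₀² T; combining the weak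
equations for g and z linearly then restores the original pair. -/
theorem IsFourierSolution.isSolution {F G Z : ℝ → L2C n}
    (h : IsFourierSolution p.W p.B p.D p.q F G Z) {φ₀ φ₁ T₀ : L2 n}
    (hF : F 0 = realFourier φ₀) (hG : G 0 = realFourier φ₁)
    (hZ : Z 0 = (p.γ - 1) • realFourier φ₁ + (p.γ * (p.αp * p.c₀ ^ 2)) • realFourier T₀) :
    IsSolution p φ₀ φ₁ T₀ (fun t => reFourierInv (F t)) (fun t => reFourierInv (G t))
      (fun t => reFourierInv ((p.γ * (p.αp * p.c₀ ^ 2))⁻¹ • (Z t - (p.γ - 1) • G t))) := by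
  have hα := p.αp_pos.ne'
  have hc := p.c₀_pos.ne'
  have hγ : p.γ ≠ 0 := by linarith [p.γ_gt]
  have hα' : (p.αp : ℂ) ≠ 0 := by exact_mod_cast hα
  have hc' : (p.c₀ : ℂ) ≠ 0 := by exact_mod_cast hc
  have hγ' : (p.γ : ℂ) ≠ 0 := by exact_mod_cast hγ
  have kG : ∀ (η : 𝓢(EuclideanSpace ℝ (Fin n), ℂ)) t, 0 < t →
      HasDerivAt (fun s => pairing (reFourierInv (G s)) η)
      (-pairing (reFourierInv (-p.W • F t - p.B • G t + p.D • Z t)) (Δ η)) t := by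
    intro η t ht
    rw [pairing_reFourierInv_laplacian]
    simp only [pairing_reFourierInv]
    refine (((h.eq_G (𝓕⁻ η) t ht).add
      (h.eq_G (𝓕⁻ (conjSchwartz η)) t ht).star).div_const 2).congr_deriv ?_
    simp only [neg_div, neg_neg]; rfl
  have kZ : ∀ (η : 𝓢(EuclideanSpace ℝ (Fin n), ℂ)) t, 0 < t →
      HasDerivAt (fun s => pairing (reFourierInv (Z s)) η)
      (-pairing (reFourierInv (-p.D • Z t + p.q • G t)) (Δ η)) t := by
    intro η t ht
    rw [pairing_reFourierInv_laplacian]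
    simp only [pairing_reFourierInv]
    refine (((h.eq_Z (𝓕⁻ η) t ht).add
      (h.eq_Z (𝓕⁻ (conjSchwartz η)) t ht).star).div_const 2).congr_deriv ?_
    simp only [neg_div, neg_neg]; rfl
  have padd : ∀ (u v : L2 n) (η : 𝓢(EuclideanSpace ℝ (Fin n), ℂ)),
      pairing (u + v) η = pairing u η + pairing v η := fun u v η => by
    simp only [pairing_eq_schwartzPairing, map_add]
  have psub : ∀ (u v : L2 n) (η : 𝓢(EuclideanSpace ℝ (Fin n), ℂ)),
      pairing (u - v) η = pairing u η - pairing v η := fun u v η => by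
    simp only [pairing_eq_schwartzPairing, map_sub]
  have psmul : ∀ (c : ℝ) (u : L2 n) (η : 𝓢(EuclideanSpace ℝ (Fin n), ℂ)),
      pairing (c • u) η = c * pairing u η := fun c u η => by
    simp only [pairing_eq_schwartzPairing, ContinuousLinearMap.map_smul_of_tower,
      Complex.real_smul, map_smul]
  refine ⟨fun t ht => ?_, ?_, ?_, ?_, ?_, ?_, fun η t ht => ?_, fun η t ht => ?_⟩
  · exact reFourierInv.hasFDerivAt.comp_hasDerivWithinAt t (h.deriv_F t ht)
  · exact reFourierInv.continuous.comp_continuousOn h.cont_G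
  · refine reFourierInv.continuous.comp_continuousOn ?_
    exact ((h.cont_Z.sub (h.cont_G.const_smul (p.γ - 1))).const_smul (p.γ * (p.αp * p.c₀ ^ 2))⁻¹)
  · simp only [hF, reFourierInv_realFourier]; rfl
  · simp only [hG, reFourierInv_realFourier]; rfl
  · have : (p.γ * (p.αp * p.c₀ ^ 2))⁻¹ • (Z 0 - (p.γ - 1) • G 0) = realFourier T₀ := by
      rw [hZ, hG, add_sub_cancel_left, smul_smul, inv_mul_cancel₀ (by positivity), one_smul]
    simp only [this, reFourierInv_realFourier]; rfl
  · have h1 := (kG η t ht).add (((kZ η t ht).sub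
      ((kG η t ht).const_mul ((p.γ - 1 : ℝ) : ℂ))).const_mul ((p.γ⁻¹ : ℝ) : ℂ))
    refine (h1.congr_deriv ?_).congr_of_eventuallyEq (Eventually.of_forall fun s => ?_)
    · simp only [map_add, map_sub, map_smul, padd, psub, psmul, AcousticParams.W, AcousticParams.B,
        AcousticParams.q, AcousticParams.visc]
      push_cast
      field_simp
      ring
    · simp only [map_sub, map_smul, psub, psmul, Pi.add_apply, Pi.sub_apply]
      push_cast
      field_simp
  · have h1 := (((kZ η t ht).sub
      ((kG η t ht).const_mul ((p.γ - 1 : ℝ) : ℂ))).const_mul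
        (((p.γ * (p.αp * p.c₀ ^ 2))⁻¹ : ℝ) : ℂ))
    refine (h1.congr_deriv ?_).congr_of_eventuallyEq (Eventually.of_forall fun s => ?_)
    · simp only [map_add, map_sub, map_smul, padd, psub, psmul, AcousticParams.W, AcousticParams.B,
        AcousticParams.q, AcousticParams.visc]
      push_cast
      field_simp
      ring
    · simp only [map_sub, map_smul, psub, psmul, Pi.sub_apply]

namespace AcousticParams

/-- The initial values of a mode for unit data in `φ₀`, `φ₁`, `T₀` respectively. -/
def unitData (p : AcousticParams) : Fin 3 → ℝ × ℝ × ℝ :=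
  -- A unit velocity also excites z, which contains (γ-1)φ_t.
  ![(1, 0, 0), (0, 1, p.γ - 1), (0, 0, p.γ * (p.αp * p.c₀ ^ 2))]

/-- The Fourier multipliers expressing `φ(t)` in terms of `φ₀`, `φ₁`, `T₀`, as functions of time
and squared frequency. -/
noncomputable def multiplier (p : AcousticParams) (j : Fin 3) (t s : ℝ) : ℝ :=
  (modeFlow p.W p.B p.D p.q (p.unitData j) t s).1

end AcousticParams

theorem exists_isFourierSolution (p : AcousticParams) (φ₀ φ₁ T₀ : L2 n) :
    ∃ F G Z : ℝ → L2C n, IsFourierSolution p.W p.B p.D p.q F G Z ∧ F 0 = realFourier φ₀ ∧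
      G 0 = realFourier φ₁ ∧
      Z 0 = (p.γ - 1) • realFourier φ₁ + (p.γ * (p.αp * p.c₀ ^ 2)) • realFourier T₀ ∧
      ∀ t, 0 ≤ t → F t =ᵐ[volume] fun ξ => (p.multiplier 0 t (symb ξ) : ℂ) * realFourier φ₀ ξ +
        (p.multiplier 1 t (symb ξ) : ℂ) * realFourier φ₁ ξ +
        (p.multiplier 2 t (symb ξ) : ℂ) * realFourier T₀ ξ := by
  obtain ⟨F₀, G₀, Z₀, h₀, e₀⟩ :=
    p.modeCoeff.exists_isFourierSolution_modeFlow (p.unitData 0) (realFourier φ₀)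
  obtain ⟨F₁, G₁, Z₁, h₁, e₁⟩ :=
    p.modeCoeff.exists_isFourierSolution_modeFlow (p.unitData 1) (realFourier φ₁)
  obtain ⟨F₂, G₂, Z₂, h₂, e₂⟩ :=
    p.modeCoeff.exists_isFourierSolution_modeFlow (p.unitData 2) (realFourier T₀)
  have hsum : ∀ a b c : L2C n, ((a + b + c : L2C n) : EuclideanSpace ℝ (Fin n) → ℂ) =ᵐ[volume]
      fun ξ => a ξ + b ξ + c ξ := fun a b c => by
    filter_upwards [Lp.coeFn_add (a + b) c, Lp.coeFn_add a b] with ξ x1 x2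
    rw [x1, Pi.add_apply, x2, Pi.add_apply]
  refine ⟨F₀ + F₁ + F₂, G₀ + G₁ + G₂, Z₀ + Z₁ + Z₂, (h₀.add h₁).add h₂, ?_, ?_, ?_, fun t ht => ?_⟩
  · apply Lp.ext
    filter_upwards [hsum (F₀ 0) (F₁ 0) (F₂ 0), (e₀ 0 le_rfl).1, (e₁ 0 le_rfl).1, (e₂ 0 le_rfl).1]
      with ξ x1 x2 x3 x4
    simp only [Pi.add_apply]
    rw [x1, x2, x3, x4]
    simp [AcousticParams.unitData]
  · apply Lp.ext
    filter_upwards [hsum (G₀ 0) (G₁ 0) (G₂ 0), (e₀ 0 le_rfl).2.1, (e₁ 0 le_rfl).2.1,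
      (e₂ 0 le_rfl).2.1] with ξ x1 x2 x3 x4
    simp only [Pi.add_apply]
    rw [x1, x2, x3, x4]
    simp [AcousticParams.unitData]
  · apply Lp.ext
    filter_upwards [hsum (Z₀ 0) (Z₁ 0) (Z₂ 0), (e₀ 0 le_rfl).2.2, (e₁ 0 le_rfl).2.2,
      (e₂ 0 le_rfl).2.2, Lp.coeFn_add ((p.γ - 1) • realFourier φ₁)
      ((p.γ * (p.αp * p.c₀ ^ 2)) • realFourier T₀), Lp.coeFn_smul (p.γ - 1) (realFourier φ₁),
      Lp.coeFn_smul (p.γ * (p.αp * p.c₀ ^ 2)) (realFourier T₀)] with ξ x1 x2 x3 x4 x5 x6 x7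
    simp only [Pi.add_apply]
    rw [x5, Pi.add_apply, x6, x7, Pi.smul_apply, Pi.smul_apply, x1, x2, x3, x4]
    simp [AcousticParams.unitData]
  · filter_upwards [hsum (F₀ t) (F₁ t) (F₂ t), (e₀ t ht).1, (e₁ t ht).1, (e₂ t ht).1]
      with ξ x1 x2 x3 x4
    simp only [Pi.add_apply]
    rw [x1, x2, x3, x4]
    rfl

theorem IsFourierSolution.unique {W B D q : ℝ} {F G Z F' G' Z' : ℝ → L2C n}
    (h : IsFourierSolution W B D q F G Z) (h' : IsFourierSolution W B D q F' G' Z')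
    (hF : F 0 = F' 0) (hG : G 0 = G' 0) (hZ : Z 0 = Z' 0) {t : ℝ} (ht : 0 ≤ t) :
    F t = F' t ∧ G t = G' t ∧ Z t = Z' t := by
  have := (h.add h'.neg).eq_zero (by simp [hF]) (by simp [hG]) (by simp [hZ]) ht
  simpa only [Pi.add_apply, Pi.neg_apply, add_neg_eq_zero] using this

theorem IsSolution.congr_data {φ₀ φ₁ T₀ φ₀' φ₁' T₀' : EuclideanSpace ℝ (Fin n) → ℝ}
    {φ φt T : ℝ → L2 n} (h : IsSolution p φ₀ φ₁ T₀ φ φt T) (h0 : φ₀ =ᵐ[volume] φ₀')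
    (h1 : φ₁ =ᵐ[volume] φ₁') (h2 : T₀ =ᵐ[volume] T₀') : IsSolution p φ₀' φ₁' T₀' φ φt T :=
  { h with
    init_φ := h.init_φ.trans h0
    init_φt := h.init_φt.trans h1
    init_T := h.init_T.trans h2 }

theorem IsSolution.unique {φ₀ φ₁ T₀ : EuclideanSpace ℝ (Fin n) → ℝ}
    {φ φt T φ' φt' T' : ℝ → L2 n} (h : IsSolution p φ₀ φ₁ T₀ φ φt T)
    (h' : IsSolution p φ₀ φ₁ T₀ φ' φt' T') {t : ℝ} (ht : 0 ≤ t) :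
    φ t = φ' t ∧ φt t = φt' t ∧ T t = T' t := by
  have e0 : φ 0 = φ' 0 := Lp.ext (h.init_φ.trans h'.init_φ.symm)
  have e1 : φt 0 = φt' 0 := Lp.ext (h.init_φt.trans h'.init_φt.symm)
  have e2 : T 0 = T' 0 := Lp.ext (h.init_T.trans h'.init_T.symm)
  obtain ⟨a, b, c⟩ := h.isFourierSolution.unique h'.isFourierSolution (by simp only [e0])
    (by simp only [e1]) (by simp only [e1, e2]) ht
  have b' := realFourier_injective b
  refine ⟨realFourier_injective a, b', realFourier_injective ?_⟩
  simp only [b', add_right_inj] at c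
  have hne : p.γ * (p.αp * p.c₀ ^ 2) ≠ 0 := by
    have := p.αp_pos; have := p.c₀_pos; have : 0 < p.γ := by linarith [p.γ_gt]
    positivity
  exact smul_right_injective _ hne c

theorem exists_isSolution (p : AcousticParams) {φ₀ φ₁ T₀ : EuclideanSpace ℝ (Fin n) → ℝ}
    (h0 : MemLp φ₀ 2 volume) (h1 : MemLp φ₁ 2 volume) (h2 : MemLp T₀ 2 volume) :
    ∃ φ φt T : ℝ → L2 n, IsSolution p φ₀ φ₁ T₀ φ φt T := by
  obtain ⟨F, G, Z, h, e0, e1, e2, -⟩ := exists_isFourierSolution p h0.toLp h1.toLp h2.toLp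
  exact ⟨_, _, _, (h.isSolution e0 e1 e2).congr_data h0.coeFn_toLp h1.coeFn_toLp h2.coeFn_toLp⟩

/-- The Fourier representation of the potential. -/
theorem IsSolution.realFourier_ae_eq {φ₀ φ₁ T₀ : EuclideanSpace ℝ (Fin n) → ℝ}
    {φ φt T : ℝ → L2 n} (h : IsSolution p φ₀ φ₁ T₀ φ φt T) {t : ℝ} (ht : 0 ≤ t) :
    realFourier (φ t) =ᵐ[volume] fun ξ =>
      (p.multiplier 0 t (symb ξ) : ℂ) * realFourier (φ 0) ξ +
      (p.multiplier 1 t (symb ξ) : ℂ) * realFourier (φt 0) ξ +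
      (p.multiplier 2 t (symb ξ) : ℂ) * realFourier (T 0) ξ := by
  obtain ⟨F, G, Z, hF, e0, e1, e2, e⟩ := exists_isFourierSolution p (φ 0) (φt 0) (T 0)
  rw [(h.isFourierSolution.unique hF e0.symm e1.symm e2.symm ht).1]
  exact e t ht

/-! ### Fourier integrals of the data and bounds for the solution multipliers. -/

/-- The Fourier transform of a real function in `L¹ ∩ L²` is its Fourier integral. -/
theorem realFourier_ae_eq {f : L2 n} {g : EuclideanSpace ℝ (Fin n) → ℝ} (hg : MemLp g 1 volume)
    (h : f =ᵐ[volume] g) :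
    realFourier f =ᵐ[volume] 𝓕 (fun x => (g x : ℂ)) := by
  have h1 : (Complex.ofRealCLM.compLpL 2 volume f : L2C n) =ᵐ[volume] fun x => (g x : ℂ) := by
    filter_upwards [ContinuousLinearMap.coeFn_compLpL (p := 2) (μ := volume) Complex.ofRealCLM f,
      h] with x a1 a2
    rw [a1, a2]; rfl
  have h2 : Integrable (fun x => (g x : ℂ)) (volume : Measure (EuclideanSpace ℝ (Fin n))) :=
    (memLp_one_iff_integrable.1 hg).ofReal
  rw [realFourier_apply]
  filter_upwards [fourier_ae_eq_of_memLp_one (h2.congr h1.symm)] with ξ hξ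
  rw [hξ]
  exact Real.fourier_congr_ae h1 ξ

theorem norm_fourier_ofReal_le {g : EuclideanSpace ℝ (Fin n) → ℝ} (hg : MemLp g 1 volume)
    (ξ : EuclideanSpace ℝ (Fin n)) :
    ‖𝓕 (fun x => (g x : ℂ)) ξ‖ ≤ (eLpNorm g 1 volume).toReal := by
  have h1 : ‖𝓕 (fun x => (g x : ℂ)) ξ‖ ≤ ∫ x, ‖(g x : ℂ)‖ :=
    VectorFourier.norm_fourierIntegral_le_integral_norm _ _ _ _ _
  refine h1.trans (le_of_eq ?_)
  simp only [Complex.norm_real]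
  rw [integral_norm_eq_lintegral_enorm hg.1, eLpNorm_one_eq_lintegral_enorm]

theorem fourier_ofReal_zero (g : EuclideanSpace ℝ (Fin n) → ℝ) :
    𝓕 (fun x => (g x : ℂ)) 0 = ((∫ x, g x : ℝ) : ℂ) := by
  rw [Real.fourier_eq]
  simp only [inner_zero_right, neg_zero, AddChar.map_zero_eq_one, one_smul]
  exact integral_complex_ofReal

theorem continuous_fourier_ofReal {g : EuclideanSpace ℝ (Fin n) → ℝ} (hg : MemLp g 1 volume) :
    Continuous (𝓕 (fun x => (g x : ℂ))) :=
  VectorFourier.fourierIntegral_continuous Real.continuous_fourierChar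
    (innerSL ℝ).continuous₂ (memLp_one_iff_integrable.1 hg).ofReal

namespace AcousticParams

variable (p : AcousticParams)

theorem exists_multiplier_energy_bound : ∃ C δ : ℝ, 0 < C ∧ 0 < δ ∧ ∀ j s t, 0 ≤ s → 0 ≤ t →
    s * p.multiplier j t s ^ 2 +
      (modeFlow p.W p.B p.D p.q (p.unitData j) t s).2.1 ^ 2 ≤
      C * Real.exp (-δ * (s / (1 + s)) * t) * (s + 1) := by
  obtain ⟨C, δ, hC, hδ, h⟩ := p.modeCoeff.exists_decay_bound
  set A : ℝ := 2 + (p.γ - 1) ^ 2 + (p.γ * (p.αp * p.c₀ ^ 2)) ^ 2 with hA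
  refine ⟨C * A, δ, by positivity, hδ, fun j s t hs ht => ?_⟩
  have h1 := h s _ _ _ hs (isMode_modeFlow p.W p.B p.D p.q s (p.unitData j)) t ht
  simp only [modeFlow_zero] at h1
  have h2 : s * (p.unitData j).1 ^ 2 + (p.unitData j).2.1 ^ 2 + (p.unitData j).2.2 ^ 2 ≤
      A * (s + 1) := by
    have e1 : 0 ≤ s * A := by positivity
    have e2 : 0 ≤ (p.γ - 1) ^ 2 := by positivity
    have e3 : 0 ≤ (p.γ * (p.αp * p.c₀ ^ 2)) ^ 2 := by positivity
    have e4 : s * 1 ≤ s * A := by gcongr; rw [hA]; linarith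
    fin_cases j <;> simp [unitData] <;> linarith
  have h3 := sq_nonneg (modeFlow p.W p.B p.D p.q (p.unitData j) t s).2.2
  calc _ ≤ _ := le_add_of_nonneg_right h3
    _ ≤ _ := h1
    _ ≤ C * Real.exp (-δ * (s / (1 + s)) * t) * (A * (s + 1)) := by gcongr
    _ = _ := by ring

/-- For s ≥ 1 the rate s/(1+s) is at least 1/2, and the initial energy, of size s + 1 ≤ 2s, is
compensated by the weight s on the left. -/
theorem exists_multiplier_high_bound : ∃ C δ : ℝ, 0 < C ∧ 0 < δ ∧ ∀ j s t, 1 ≤ s → 0 ≤ t →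
    p.multiplier j t s ^ 2 ≤ C * Real.exp (-δ * t) := by
  obtain ⟨C, δ, hC, hδ, h⟩ := p.exists_multiplier_energy_bound
  refine ⟨2 * C, δ / 2, by positivity, by positivity, fun j s t hs ht => ?_⟩
  have h1 := h j s t (by linarith) ht
  have h2 : Real.exp (-δ * (s / (1 + s)) * t) ≤ Real.exp (-(δ / 2) * t) := by
    rw [Real.exp_le_exp]
    have : 1 / 2 ≤ s / (1 + s) := by rw [div_le_div_iff₀ two_pos (by linarith)]; linarith
    have := mul_le_mul_of_nonneg_left this (mul_nonneg hδ.le ht)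
    linarith
  have hs0 : 0 < s := by linarith
  refine le_of_mul_le_mul_left ?_ hs0
  calc s * p.multiplier j t s ^ 2 ≤ _ := le_add_of_nonneg_right (sq_nonneg _)
    _ ≤ _ := h1
    _ ≤ C * Real.exp (-(δ / 2) * t) * (s + s) := by gcongr
    _ = _ := by ring

/-- The first bound is the energy estimate, singular at s = 0. The second integrates the bounded
velocity g in time; it handles frequencies so low that 1/s is not integrable, which matters for n ≤
2. -/
theorem exists_multiplier_low_bound : ∃ C δ : ℝ, 0 < C ∧ 0 < δ ∧ ∀ j s t, 0 ≤ s → s ≤ 1 → 0 ≤ t →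
    s * p.multiplier j t s ^ 2 ≤ C * Real.exp (-δ * s * t) ∧
    p.multiplier j t s ^ 2 ≤ C * (1 + t) ^ 2 := by
  obtain ⟨C, δ, hC, hδ, h⟩ := p.exists_multiplier_energy_bound
  refine ⟨2 * C + (1 + √(2 * C)) ^ 2, δ / 2, by positivity, by positivity,
    fun j s t hs hs1 ht => ⟨?_, ?_⟩⟩
  · have h1 := h j s t hs ht
    have h2 : Real.exp (-δ * (s / (1 + s)) * t) ≤ Real.exp (-(δ / 2) * s * t) := by
      rw [Real.exp_le_exp]
      have : s / 2 ≤ s / (1 + s) := div_le_div_of_nonneg_left hs (by linarith) (by linarith)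
      have := mul_le_mul_of_nonneg_left this (mul_nonneg hδ.le ht)
      linarith
    calc s * p.multiplier j t s ^ 2 ≤ _ := le_add_of_nonneg_right (sq_nonneg _)
      _ ≤ _ := h1
      _ ≤ C * Real.exp (-(δ / 2) * s * t) * (1 + 1) := by gcongr
      _ ≤ _ := by
        have : 0 ≤ (1 + √(2 * C)) ^ 2 * Real.exp (-(δ / 2) * s * t) := by positivity
        linarith
  · have hm := isMode_modeFlow p.W p.B p.D p.q s (p.unitData j)
    have hg : ∀ τ ∈ Icc 0 t,
        ‖(modeFlow p.W p.B p.D p.q (p.unitData j) τ s).2.1‖ ≤ √(2 * C) := by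
      intro τ hτ
      have h1 := h j s τ hs hτ.1
      refine Real.abs_le_sqrt ?_
      have hexp : Real.exp (-δ * (s / (1 + s)) * τ) ≤ 1 := by
        rw [Real.exp_le_one_iff]
        have := hτ.1
        have : 0 ≤ δ * (s / (1 + s)) * τ := by positivity
        linarith
      calc _ ≤ _ := le_add_of_nonneg_left (mul_nonneg hs (sq_nonneg (p.multiplier j τ s)))
        _ ≤ _ := h1
        _ ≤ C * 1 * (1 + 1) := by gcongr
        _ = 2 * C := by ring
    have h2 := (convex_Icc 0 t).norm_image_sub_le_of_norm_hasDerivWithin_le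
      (fun τ _ => (hm.deriv_f τ).hasDerivWithinAt) hg (left_mem_Icc.2 ht) (right_mem_Icc.2 ht)
    simp only [modeFlow_zero, sub_zero, Real.norm_eq_abs, abs_of_nonneg ht] at h2
    have h3 : |(p.unitData j).1| ≤ 1 := by fin_cases j <;> simp [unitData]
    have h4 : |p.multiplier j t s| ≤ (1 + √(2 * C)) * (1 + t) := by
      have h5 := abs_sub_abs_le_abs_sub (p.multiplier j t s) (p.unitData j).1
      have h6 : |p.multiplier j t s - (p.unitData j).1| ≤ √(2 * C) * t := h2
      have : 0 ≤ t + √(2 * C) := by positivity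
      linarith
    calc p.multiplier j t s ^ 2 = |p.multiplier j t s| ^ 2 := (sq_abs _).symm
      _ ≤ ((1 + √(2 * C)) * (1 + t)) ^ 2 := by gcongr
      _ ≤ _ := by
        have : 0 ≤ 2 * C * (1 + t) ^ 2 := by positivity
        rw [mul_pow]; linarith

/-- Unit data in φ₀ or T₀ have g(0) = 0, so only φ₁ can produce the factor 1/r. -/
theorem exists_multiplier_approx : ∃ C : ℝ, 0 < C ∧ ∀ r t, 0 < r → r ≤ 1 → 0 ≤ t → r ^ 2 * t ≤ 1 →
    |p.multiplier 0 t (r ^ 2)| ≤ C ∧ |p.multiplier 2 t (r ^ 2)| ≤ C ∧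
    |√p.W * r * p.multiplier 1 t (r ^ 2) - Real.sin (√p.W * r * t)| ≤ C * (r + r ^ 2 * t) := by
  obtain ⟨C₁, hC₁, h1⟩ := p.modeCoeff.exists_bound_of_velocity_eq_zero
  obtain ⟨C₂, hC₂, h2⟩ := p.modeCoeff.exists_oscillator_approx
  set A : ℝ := 1 + (p.γ * (p.αp * p.c₀ ^ 2)) ^ 2 with hA
  set M : ℝ := C₂ * (1 + |p.γ - 1|) with hM
  refine ⟨√(C₁ * A) + M, by positivity, fun r t hr hr1 ht hrt => ?_⟩
  have hM0 : 0 ≤ M := by positivity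
  have hm := fun j => isMode_modeFlow p.W p.B p.D p.q (r ^ 2) (p.unitData j)
  have hbd : ∀ j, (p.unitData j).2.1 = 0 → (p.unitData j).1 ^ 2 + (p.unitData j).2.2 ^ 2 ≤ A →
      |p.multiplier j t (r ^ 2)| ≤ √(C₁ * A) + M := by
    intro j hj hjA
    have := h1 (r ^ 2) _ _ _ (by positivity) (pow_le_one₀ hr.le hr1) (hm j)
      (by simpa using hj) t ht hrt
    simp only [modeFlow_zero] at this
    have h3 : |p.multiplier j t (r ^ 2)| ≤ √(C₁ * A) :=
      Real.abs_le_sqrt (this.trans (mul_le_mul_of_nonneg_left hjA hC₁.le))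
    linarith
  refine ⟨hbd 0 (by simp [unitData]) ?_, hbd 2 (by simp [unitData]) ?_, ?_⟩
  · simp [unitData, hA]; positivity
  · simp [unitData, hA]
  · have := h2 r _ _ _ hr.le hr1 (hm 1) (by simp [unitData]) t ht hrt
    simp only [modeFlow_zero] at this
    have e : (p.unitData 1).2.1 = 1 ∧ (p.unitData 1).2.2 = p.γ - 1 := by simp [unitData]
    rw [e.1, e.2, one_mul, abs_one] at this
    calc _ ≤ C₂ * (r + r ^ 2 * t) * (1 + |p.γ - 1|) := this
      _ = M * (r + r ^ 2 * t) := by rw [hM]; ring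
      _ ≤ _ := by gcongr; linarith [Real.sqrt_nonneg (C₁ * A)]

end AcousticParams

/-! ### The growth rate and radial majorants. -/

theorem growthRate_sq_one {t : ℝ} (ht : 0 ≤ t) : growthRate 1 t ^ 2 = t := by
  simp [growthRate, Real.sq_sqrt ht]

theorem growthRate_sq_two {t : ℝ} (ht : 1 ≤ t) : growthRate 2 t ^ 2 = Real.log t := by
  simp [growthRate, Real.sq_sqrt (Real.log_nonneg ht)]

theorem growthRate_sq_of_three_le (hn : 3 ≤ n) {t : ℝ} (ht : 0 < t) :
    growthRate n t ^ 2 = t ^ (-((n : ℝ) - 2) / 2) := by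
  rw [growthRate, if_neg (by omega), if_neg (by omega), ← Real.rpow_natCast, ← Real.rpow_mul ht.le]
  congr 1; push_cast; ring

/-- This is why the estimates start at t = 3 > e: for n = 2 bounded terms can be absorbed into log
t. -/
theorem one_le_log_of_three_le {t : ℝ} (ht : 3 ≤ t) : 1 ≤ Real.log t := by
  rw [Real.le_log_iff_exp_le (by linarith)]
  linarith [Real.exp_one_lt_d9]

theorem growthRate_pos {t : ℝ} (ht : 3 ≤ t) : 0 < growthRate n t := by
  unfold growthRate
  split_ifs
  · exact Real.sqrt_pos.2 (by linarith)
  · exact Real.sqrt_pos.2 (by linarith [one_le_log_of_three_le ht])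
  · exact Real.rpow_pos_of_pos (by linarith) _

theorem exists_exp_le_growthRate_sq (hn : 1 ≤ n) {δ : ℝ} (hδ : 0 < δ) :
    ∃ K : ℝ, 0 < K ∧ ∀ t, 3 ≤ t → Real.exp (-δ * t) ≤ K * growthRate n t ^ 2 := by
  refine ⟨1 + n.factorial / δ ^ n, by positivity, fun t ht => ?_⟩
  have ht0 : 0 < t := by linarith
  have hexp1 : Real.exp (-δ * t) ≤ 1 := by
    rw [Real.exp_le_one_iff]; have : 0 ≤ δ * t := by positivity
    linarith
  have hK : 1 ≤ 1 + n.factorial / δ ^ n := by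
    have : 0 ≤ n.factorial / δ ^ n := by positivity
    linarith
  rcases (by omega : n = 1 ∨ n = 2 ∨ 3 ≤ n) with rfl | rfl | h3
  · rw [growthRate_sq_one ht0.le]; nlinarith
  · rw [growthRate_sq_two (by linarith)]; nlinarith [one_le_log_of_three_le ht]
  · rw [growthRate_sq_of_three_le h3 ht0]
    have h1 := Real.pow_div_factorial_le_exp (δ * t) (by positivity) n
    have h2 : t ^ (-(n : ℝ)) ≤ t ^ (-((n : ℝ) - 2) / 2) := by
      apply Real.rpow_le_rpow_of_exponent_le (by linarith)
      have : (3 : ℝ) ≤ n := by exact_mod_cast h3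
      linarith
    calc Real.exp (-δ * t) = (Real.exp (δ * t))⁻¹ := by rw [← Real.exp_neg]; ring_nf
      _ ≤ ((δ * t) ^ n / n.factorial)⁻¹ := inv_anti₀ (by positivity) h1
      _ = n.factorial / δ ^ n * t ^ (-(n : ℝ)) := by
        rw [Real.rpow_neg ht0.le, Real.rpow_natCast, mul_pow]; field_simp
      _ ≤ (1 + n.factorial / δ ^ n) * t ^ (-((n : ℝ) - 2) / 2) := by
        gcongr; linarith

/-- Radial integration on `ℝⁿ`. -/
theorem integral_norm_euclidean (hn : 1 ≤ n) (f : ℝ → ℝ) :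
    ∫ ξ : EuclideanSpace ℝ (Fin n), f ‖ξ‖ = n * volume.real
      (Metric.ball (0 : EuclideanSpace ℝ (Fin n)) 1) * ∫ y in Ioi (0 : ℝ), y ^ (n - 1) * f y := by
  have : Nonempty (Fin n) := ⟨⟨0, hn⟩⟩
  simpa [mul_assoc] using
    integral_fun_norm_addHaar (volume : Measure (EuclideanSpace ℝ (Fin n))) f

theorem integrable_norm_euclidean (hn : 1 ≤ n) {f : ℝ → ℝ}
    (hf : IntegrableOn (fun y => y ^ (n - 1) * f y) (Ioi 0)) :
    Integrable (fun ξ : EuclideanSpace ℝ (Fin n) => f ‖ξ‖) := by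
  have : Nonempty (Fin n) := ⟨⟨0, hn⟩⟩
  rw [integrable_fun_norm_addHaar]
  simpa using hf

/-- The majorant is 4t² ≥ (1+t)² for ρ ≤ 1/t and ρ⁻² on (1/t, 1]. Its radial integral is 4t + (t -
1) for n = 1 and 2 + log t for n = 2; no exponential decay is needed. -/
theorem exists_low_frequency_kernel_of_le_two (hn : 1 ≤ n) (hn2 : n ≤ 2) :
    ∃ K : ℝ, 0 < K ∧ ∀ t, 3 ≤ t → ∃ f : ℝ → ℝ,
      Integrable (fun ξ : EuclideanSpace ℝ (Fin n) => f ‖ξ‖) ∧ (∀ ρ, 0 ≤ f ρ) ∧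
      ∫ ξ : EuclideanSpace ℝ (Fin n), f ‖ξ‖ ≤ K * growthRate n t ^ 2 ∧
      ∀ ρ y, 0 < ρ → ρ ≤ 1 → y ≤ (1 + t) ^ 2 → ρ ^ 2 * y ≤ 1 → y ≤ f ρ := by
  set V := n * volume.real (Metric.ball (0 : EuclideanSpace ℝ (Fin n)) 1) with hV
  have hV0 : 0 ≤ V := by positivity
  refine ⟨V * 5 + 1, by positivity, fun t ht => ?_⟩
  have ht0 : 0 < t := by linarith
  have hti : t⁻¹ ≤ 1 := inv_le_one_of_one_le₀ (by linarith)
  set f : ℝ → ℝ := fun ρ => (Ioc 0 t⁻¹).indicator (fun _ => 4 * t ^ 2) ρ +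
    (Ioc t⁻¹ 1).indicator (fun ρ => (ρ ^ 2)⁻¹) ρ with hf
  have hmul : (fun y => y ^ (n - 1) * f y) = fun y =>
      (Ioc 0 t⁻¹).indicator (fun y => y ^ (n - 1) * (4 * t ^ 2)) y +
      (Ioc t⁻¹ 1).indicator (fun y => y ^ (n - 1) * (y ^ 2)⁻¹) y := by
    ext y
    simp only [hf, mul_add, indicator_apply]
    split_ifs <;> simp
  have i1 : IntegrableOn (fun y : ℝ => y ^ (n - 1) * (4 * t ^ 2)) (Ioc 0 t⁻¹) :=
    (Continuous.integrableOn_Icc (by fun_prop)).mono_set Ioc_subset_Icc_self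
  have i2 : IntegrableOn (fun y : ℝ => y ^ (n - 1) * (y ^ 2)⁻¹) (Ioc t⁻¹ 1) := by
    refine (ContinuousOn.integrableOn_Icc ?_).mono_set Ioc_subset_Icc_self
    refine ContinuousOn.mul (by fun_prop) (ContinuousOn.inv₀ (by fun_prop) fun y hy => ?_)
    have : 0 < y := lt_of_lt_of_le (by positivity) hy.1
    positivity
  have j1 := (integrable_indicator_iff measurableSet_Ioc).2 i1
  have j2 := (integrable_indicator_iff measurableSet_Ioc).2 i2
  refine ⟨f, integrable_norm_euclidean hn ?_, fun ρ => ?_, ?_, fun ρ y hρ hρ1 hy1 hy2 => ?_⟩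
  · rw [hmul]; exact (j1.add j2).integrableOn
  · apply add_nonneg <;> apply indicator_nonneg <;> intros <;> positivity
  · rw [integral_norm_euclidean hn, hmul, integral_add j1.integrableOn j2.integrableOn,
      setIntegral_indicator measurableSet_Ioc, setIntegral_indicator measurableSet_Ioc,
      inter_eq_self_of_subset_right Ioc_subset_Ioi_self, inter_eq_self_of_subset_right
      (Ioc_subset_Ioi_self.trans (Ioi_subset_Ioi (by positivity))),
      ← intervalIntegral.integral_of_le (by positivity), ← intervalIntegral.integral_of_le hti,
      ← hV]
    have hg := sq_nonneg (growthRate n t)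
    suffices h : (∫ y in (0 : ℝ)..t⁻¹, y ^ (n - 1) * (4 * t ^ 2)) +
        ∫ y in t⁻¹..1, y ^ (n - 1) * (y ^ 2)⁻¹ ≤ 5 * growthRate n t ^ 2 by
      have := mul_le_mul_of_nonneg_left h hV0
      linarith
    rw [intervalIntegral.integral_mul_const, integral_pow]
    rcases (by omega : n = 1 ∨ n = 2) with rfl | rfl
    · rw [growthRate_sq_one ht0.le]
      have e : ∫ y in t⁻¹..1, y ^ (1 - 1) * (y ^ 2)⁻¹ = t - 1 := by
        have : ∀ y : ℝ, y ^ (1 - 1) * (y ^ 2)⁻¹ = y ^ (-2 : ℤ) := fun y => by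
          simp [zpow_neg]
        simp only [this]
        rw [integral_zpow]
        · norm_num [zpow_neg]; ring
        · right
          refine ⟨by norm_num, ?_⟩
          rw [uIcc_of_le hti]
          exact fun h => absurd h.1 (by simpa using ht0)
      rw [e]
      have : ((t⁻¹ ^ (1 - 1 + 1) - 0 ^ (1 - 1 + 1)) / ((1 - 1 : ℕ) + 1 : ℝ)) * (4 * t ^ 2) = 4 * t := by
        norm_num; field_simp
      rw [this]; linarith
    · rw [growthRate_sq_two (by linarith)]
      have e : ∫ y in t⁻¹..1, y ^ (2 - 1) * (y ^ 2)⁻¹ = Real.log t := by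
        have : ∀ y : ℝ, y ^ (2 - 1) * (y ^ 2)⁻¹ = y⁻¹ := fun y => by
          by_cases hy : y = 0
          · simp [hy]
          · field_simp; simp
        simp only [this]
        rw [integral_inv_of_pos (by positivity) one_pos]; simp
      rw [e]
      have : ((t⁻¹ ^ (2 - 1 + 1) - 0 ^ (2 - 1 + 1)) / ((2 - 1 : ℕ) + 1 : ℝ)) * (4 * t ^ 2) = 2 := by
        norm_num; field_simp; norm_num
      rw [this]; linarith [one_le_log_of_three_le ht]
  · simp only [hf]
    by_cases hρt : ρ ≤ t⁻¹
    · rw [indicator_of_mem (show ρ ∈ Ioc 0 t⁻¹ from ⟨hρ, hρt⟩),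
        indicator_of_notMem (fun h => absurd h.1 (not_lt.2 hρt)), add_zero]
      nlinarith
    · rw [indicator_of_notMem (fun h => absurd h.2 hρt),
        indicator_of_mem (show ρ ∈ Ioc t⁻¹ 1 from ⟨not_le.1 hρt, hρ1⟩), zero_add,
        ← one_div, le_div_iff₀ (by positivity)]
      linarith

/-- Here ρ⁻² is integrable at the origin, and scaling in the Gaussian integral of ρ^{n-3} produces
t^{-(n-2)/2} with a Gamma factor. -/
theorem exists_low_frequency_kernel_of_three_le (hn : 3 ≤ n) {δ : ℝ} (hδ : 0 < δ) :
    ∃ K : ℝ, 0 < K ∧ ∀ t, 3 ≤ t → ∃ f : ℝ → ℝ,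
      Integrable (fun ξ : EuclideanSpace ℝ (Fin n) => f ‖ξ‖) ∧ (∀ ρ, 0 ≤ f ρ) ∧
      ∫ ξ : EuclideanSpace ℝ (Fin n), f ‖ξ‖ ≤ K * growthRate n t ^ 2 ∧
      ∀ ρ y, 0 < ρ → ρ ^ 2 * y ≤ Real.exp (-δ * ρ ^ 2 * t) → y ≤ f ρ := by
  set V := n * volume.real (Metric.ball (0 : EuclideanSpace ℝ (Fin n)) 1) with hV
  have hV0 : 0 ≤ V := by positivity
  have hn3 : (3 : ℝ) ≤ n := by exact_mod_cast hn
  set Γ' := δ ^ (-((n : ℝ) - 2) / 2) * (1 / 2) * Real.Gamma (((n : ℝ) - 2) / 2) with hΓ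
  have hΓ0 : 0 < Γ' := by
    have := Real.Gamma_pos_of_pos (s := ((n : ℝ) - 2) / 2) (by linarith)
    positivity
  refine ⟨V * Γ' + 1, by positivity, fun t ht => ?_⟩
  have ht0 : 0 < t := by linarith
  set f : ℝ → ℝ := fun ρ => (ρ ^ 2)⁻¹ * Real.exp (-δ * ρ ^ 2 * t) with hf
  have hmul : EqOn (fun y => y ^ ((n : ℝ) - 3) * Real.exp (-(δ * t) * y ^ (2 : ℝ)))
      (fun y => y ^ (n - 1) * f y) (Ioi 0) := by
    intro y hy
    have hy' : 0 < y := hy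
    simp only [hf]
    have : y ^ ((n : ℝ) - 3) = y ^ (n - 1) * (y ^ 2)⁻¹ := by
      rw [show (n : ℝ) - 3 = ((n - 1 : ℕ) : ℝ) - (2 : ℕ) by
        rw [Nat.cast_sub (by omega)]; push_cast; ring, Real.rpow_sub hy', Real.rpow_natCast,
        Real.rpow_natCast]
      rfl
    rw [this, Real.rpow_two, mul_assoc]
    congr 3; ring
  have hint : IntegrableOn (fun y => y ^ (n - 1) * f y) (Ioi 0) :=
    (integrableOn_rpow_mul_exp_neg_mul_rpow (by linarith) two_pos
      (by positivity)).congr_fun hmul measurableSet_Ioi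
  refine ⟨f, integrable_norm_euclidean (by omega) hint, fun ρ => by positivity, ?_,
    fun ρ y hρ hy => ?_⟩
  · rw [integral_norm_euclidean (by omega), ← hV, ← setIntegral_congr_fun measurableSet_Ioi hmul,
      integral_rpow_mul_exp_neg_mul_rpow two_pos (by linarith) (by positivity),
      growthRate_sq_of_three_le hn ht0, Real.mul_rpow hδ.le ht0.le]
    have e1 : (-((n : ℝ) - 3 + 1) / 2) = -((n : ℝ) - 2) / 2 := by ring
    have e2 : ((n : ℝ) - 3 + 1) / 2 = ((n : ℝ) - 2) / 2 := by ring
    rw [e1, e2]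
    have : 0 ≤ t ^ (-((n : ℝ) - 2) / 2) := by positivity
    rw [hΓ]
    linarith
  · simp only [hf]
    rw [← div_eq_inv_mul, le_div_iff₀ (by positivity)]
    linarith

theorem exists_low_frequency_kernel (hn : 1 ≤ n) {δ : ℝ} (hδ : 0 < δ) :
    ∃ K : ℝ, 0 < K ∧ ∀ t, 3 ≤ t → ∃ f : ℝ → ℝ,
      Integrable (fun ξ : EuclideanSpace ℝ (Fin n) => f ‖ξ‖) ∧ (∀ ρ, 0 ≤ f ρ) ∧
      ∫ ξ : EuclideanSpace ℝ (Fin n), f ‖ξ‖ ≤ K * growthRate n t ^ 2 ∧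
      ∀ ρ y, 0 < ρ → ρ ≤ 1 → y ≤ (1 + t) ^ 2 → ρ ^ 2 * y ≤ Real.exp (-δ * ρ ^ 2 * t) →
        y ≤ f ρ := by
  rcases le_or_gt n 2 with h2 | h3
  · obtain ⟨K, hK, h⟩ := exists_low_frequency_kernel_of_le_two hn h2
    refine ⟨K, hK, fun t ht => ?_⟩
    obtain ⟨f, h1, h2, h3, h4⟩ := h t ht
    refine ⟨f, h1, h2, h3, fun ρ y hρ hρ1 hy hy' => h4 ρ y hρ hρ1 hy (hy'.trans ?_)⟩
    rw [Real.exp_le_one_iff]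
    have : 0 ≤ δ * ρ ^ 2 * t := by positivity
    linarith
  · obtain ⟨K, hK, h⟩ := exists_low_frequency_kernel_of_three_le h3 hδ
    refine ⟨K, hK, fun t ht => ?_⟩
    obtain ⟨f, h1, h2, h3, h4⟩ := h t ht
    exact ⟨f, h1, h2, h3, fun ρ y hρ _ _ hy' => h4 ρ y hρ hy'⟩

theorem norm_sq_le_symb (ξ : EuclideanSpace ℝ (Fin n)) : ‖ξ‖ ^ 2 ≤ symb ξ := by
  unfold symb
  have h := Real.pi_gt_three
  have : (1 : ℝ) ≤ (2 * Real.pi) ^ 2 := by nlinarith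
  nlinarith [sq_nonneg ‖ξ‖]

/-! ### The upper bound. -/

namespace AcousticParams

/-- Split at s = 1. Above, exponential decay multiplies the L² norm of u; below, the radial majorant
multiplies the supremum bound N, which for the data is their L¹ norm. -/
theorem exists_multiplier_integrable_bound (p : AcousticParams) (hn : 1 ≤ n) :
    ∃ C : ℝ, 0 < C ∧ ∀ j t, 3 ≤ t → ∀ (u : L2C n) (N : ℝ), 0 ≤ N → (∀ᵐ ξ, ‖u ξ‖ ≤ N) →
      ∃ h : EuclideanSpace ℝ (Fin n) → ℝ, Integrable h ∧
        (∀ᵐ ξ, p.multiplier j t (symb ξ) ^ 2 * ‖u ξ‖ ^ 2 ≤ h ξ) ∧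
        ∫ ξ, h ξ ≤ C * growthRate n t ^ 2 * (‖u‖ + N) ^ 2 := by
  obtain ⟨C₁, δ₁, hC₁, hδ₁, H₁⟩ := p.exists_multiplier_high_bound
  obtain ⟨C₂, δ₂, hC₂, hδ₂, H₂⟩ := p.exists_multiplier_low_bound
  obtain ⟨K₁, hK₁, E₁⟩ := exists_exp_le_growthRate_sq hn hδ₁
  obtain ⟨K₂, hK₂, E₂⟩ := exists_low_frequency_kernel hn hδ₂
  refine ⟨C₁ * K₁ + C₂ * K₂, by positivity, fun j t ht u N hN hu => ?_⟩
  have ht0 : 0 ≤ t := by linarith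
  obtain ⟨f, f1, f2, f3, f4⟩ := E₂ t ht
  have hne : Nonempty (Fin n) := ⟨⟨0, hn⟩⟩
  have i1 := (integrable_norm_sq u).const_mul (C₁ * Real.exp (-δ₁ * t))
  have i2 := f1.const_mul (C₂ * N ^ 2)
  refine ⟨_, i1.add i2, ?_, ?_⟩
  · filter_upwards [hu, Measure.ae_ne volume (0 : EuclideanSpace ℝ (Fin n))] with ξ hξ hξ0
    have hρ : 0 < ‖ξ‖ := norm_pos_iff.2 hξ0
    have hs := norm_sq_le_symb ξ
    have hfn := f2 ‖ξ‖
    rw [Pi.add_apply]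
    rcases le_or_gt 1 (symb ξ) with h1 | h1
    · have := mul_le_mul_of_nonneg_right (H₁ j _ t h1 ht0) (sq_nonneg ‖u ξ‖)
      have : 0 ≤ C₂ * N ^ 2 * f ‖ξ‖ := by positivity
      linarith
    · obtain ⟨h3, h4⟩ := H₂ j (symb ξ) t (symb_nonneg ξ) h1.le ht0
      have hm := sq_nonneg (p.multiplier j t (symb ξ))
      have h5 : p.multiplier j t (symb ξ) ^ 2 / C₂ ≤ f ‖ξ‖ := by
        refine f4 _ _ hρ (by nlinarith) ?_ ?_
        · rw [div_le_iff₀ hC₂]; linarith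
        · rw [← mul_div_assoc, div_le_iff₀ hC₂]
          have h6 : Real.exp (-δ₂ * symb ξ * t) ≤ Real.exp (-δ₂ * ‖ξ‖ ^ 2 * t) := by
            apply Real.exp_le_exp.2
            have := mul_le_mul_of_nonneg_left hs (mul_nonneg hδ₂.le ht0)
            linarith
          have := mul_le_mul_of_nonneg_right hs hm
          have := mul_le_mul_of_nonneg_left h6 hC₂.le
          linarith
      rw [div_le_iff₀ hC₂] at h5
      have h7 : ‖u ξ‖ ^ 2 ≤ N ^ 2 := by gcongr
      have h8 := mul_le_mul h5 h7 (sq_nonneg _) (by positivity)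
      have : 0 ≤ C₁ * Real.exp (-δ₁ * t) * ‖u ξ‖ ^ 2 := by positivity
      linarith
  · simp only [Pi.add_apply]
    rw [integral_add i1 i2, integral_const_mul, integral_const_mul, ← norm_sq_eq_integral_norm_sq]
    have hg := sq_nonneg (growthRate n t)
    have h1 : ‖u‖ ^ 2 ≤ (‖u‖ + N) ^ 2 := by gcongr; linarith
    have h2 : N ^ 2 ≤ (‖u‖ + N) ^ 2 := by gcongr; linarith [norm_nonneg u]
    calc _ ≤ C₁ * (K₁ * growthRate n t ^ 2) * (‖u‖ + N) ^ 2 +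
          C₂ * (‖u‖ + N) ^ 2 * (K₂ * growthRate n t ^ 2) := by
            gcongr
            · exact E₁ t ht
            · exact integral_nonneg fun ξ => f2 ‖ξ‖
      _ = _ := by ring

end AcousticParams

theorem ae_norm_realFourier_le {f : L2 n} {g : EuclideanSpace ℝ (Fin n) → ℝ}
    (hg : MemLp g 1 volume) (h : f =ᵐ[volume] g) :
    ∀ᵐ ξ, ‖realFourier f ξ‖ ≤ (eLpNorm g 1 volume).toReal := by
  filter_upwards [realFourier_ae_eq hg h] with ξ hξ
  rw [hξ]
  exact norm_fourier_ofReal_le hg ξ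

theorem norm_realFourier_add_eq {f : L2 n} {g : EuclideanSpace ℝ (Fin n) → ℝ}
    (h : f =ᵐ[volume] g) :
    ‖realFourier f‖ + (eLpNorm g 1 volume).toReal = normL1L2 g := by
  rw [norm_realFourier, Lp.norm_def, eLpNorm_congr_ae h, normL1L2, add_comm]

theorem normL1L2_nonneg (g : EuclideanSpace ℝ (Fin n) → ℝ) : 0 ≤ normL1L2 g := by
  unfold normL1L2; positivity

theorem exists_norm_le_growthRate (p : AcousticParams) (hn : 1 ≤ n) :
    ∃ C : ℝ, 0 < C ∧ ∀ φ₀ φ₁ T₀ : EuclideanSpace ℝ (Fin n) → ℝ,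
      MemL1L2 φ₀ → MemL1L2 φ₁ → MemL1L2 T₀ →
      ∀ φ φt T : ℝ → L2 n, IsSolution p φ₀ φ₁ T₀ φ φt T → ∀ t, 3 ≤ t →
        ‖φ t‖ ≤ C * growthRate n t * (normL1L2 φ₀ + normL1L2 φ₁ + normL1L2 T₀) := by
  obtain ⟨C, hC, H⟩ := p.exists_multiplier_integrable_bound hn
  refine ⟨√(3 * C), by positivity, fun φ₀ φ₁ T₀ m₀ m₁ m₂ φ φt T h t ht => ?_⟩
  have hg := growthRate_pos (n := n) ht
  have n0 := normL1L2_nonneg φ₀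
  have n1 := normL1L2_nonneg φ₁
  have n2 := normL1L2_nonneg T₀
  obtain ⟨h₀, i₀, b₀, e₀⟩ := H 0 t ht (realFourier (φ 0)) _ ENNReal.toReal_nonneg
    (ae_norm_realFourier_le m₀.1 h.init_φ)
  obtain ⟨h₁, i₁, b₁, e₁⟩ := H 1 t ht (realFourier (φt 0)) _ ENNReal.toReal_nonneg
    (ae_norm_realFourier_le m₁.1 h.init_φt)
  obtain ⟨h₂, i₂, b₂, e₂⟩ := H 2 t ht (realFourier (T 0)) _ ENNReal.toReal_nonneg
    (ae_norm_realFourier_le m₂.1 h.init_T)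
  rw [norm_realFourier_add_eq h.init_φ] at e₀
  rw [norm_realFourier_add_eq h.init_φt] at e₁
  rw [norm_realFourier_add_eq h.init_T] at e₂
  have key : ‖φ t‖ ^ 2 ≤ 3 * (C * growthRate n t ^ 2 * normL1L2 φ₀ ^ 2 +
      C * growthRate n t ^ 2 * normL1L2 φ₁ ^ 2 + C * growthRate n t ^ 2 * normL1L2 T₀ ^ 2) := by
    rw [← norm_realFourier, norm_sq_eq_integral_norm_sq]
    calc ∫ ξ, ‖realFourier (φ t) ξ‖ ^ 2 ≤ ∫ ξ, 3 * (h₀ ξ + h₁ ξ + h₂ ξ) := by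
          refine integral_mono_ae (integrable_norm_sq _) (((i₀.add i₁).add i₂).const_mul 3) ?_
          filter_upwards [b₀, b₁, b₂, h.realFourier_ae_eq (by linarith : (0 : ℝ) ≤ t)]
            with ξ x₀ x₁ x₂ hξ
          rw [hξ]
          refine le_trans ?_ (mul_le_mul_of_nonneg_left (add_le_add (add_le_add x₀ x₁) x₂)
            (by norm_num))
          refine le_trans (pow_le_pow_left₀ (norm_nonneg _) (norm_add₃_le) 2) ?_
          simp only [norm_mul, Complex.norm_real, Real.norm_eq_abs]
          simp only [← sq_abs (AcousticParams.multiplier p _ _ _), ← mul_pow]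
          set a := |p.multiplier 0 t (symb ξ)| * ‖realFourier (φ 0) ξ‖
          set b := |p.multiplier 1 t (symb ξ)| * ‖realFourier (φt 0) ξ‖
          set c := |p.multiplier 2 t (symb ξ)| * ‖realFourier (T 0) ξ‖
          nlinarith [sq_nonneg (a - b), sq_nonneg (b - c), sq_nonneg (a - c)]
      _ ≤ _ := by
          rw [integral_const_mul, integral_add (by exact i₀.add i₁) i₂, integral_add i₀ i₁]
          gcongr
  refine le_of_sq_le_sq (key.trans ?_) (by positivity)
  rw [mul_pow, mul_pow, Real.sq_sqrt (by positivity)]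
  have : normL1L2 φ₀ ^ 2 + normL1L2 φ₁ ^ 2 + normL1L2 T₀ ^ 2 ≤
      (normL1L2 φ₀ + normL1L2 φ₁ + normL1L2 T₀) ^ 2 := by
    nlinarith [mul_nonneg n0 n1, mul_nonneg n0 n2, mul_nonneg n1 n2]
  have := mul_le_mul_of_nonneg_left this (by positivity : 0 ≤ 3 * C * growthRate n t ^ 2)
  linarith

/-! ### Oscillatory integrals over low-frequency shells. -/

/-- Integration by parts: the derivative of ρ^m sin(ωρ)/ω is ρ^m cos(ωρ) plus an error of at most
ρ^m/4, because ωρ ≥ 4|m|. Of the constant 3/4, one quarter pays for this error and one half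
survives. -/
theorem le_integral_zpow_mul_sub_cos {m : ℤ} {ω x y : ℝ} (hω : 0 < ω) (hx : 0 < x) (hxy : x ≤ y)
    (h : 4 * |(m : ℝ)| ≤ ω * x) :
    (∫ ρ in x..y, ρ ^ m) / 2 - (x ^ m + y ^ m) / ω ≤
      ∫ ρ in x..y, ρ ^ m * (3 / 4 - Real.cos (ω * ρ)) := by
  have hy : 0 < y := hx.trans_le hxy
  have hpos : ∀ ρ ∈ uIcc x y, 0 < ρ := fun ρ hρ => by
    rw [uIcc_of_le hxy] at hρ; exact hx.trans_le hρ.1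
  have hz : ∀ k : ℤ, ContinuousOn (fun ρ : ℝ => ρ ^ k) (uIcc x y) := fun k =>
    continuousOn_id.zpow₀ k fun ρ hρ => Or.inl (hpos ρ hρ).ne'
  have hcos : ContinuousOn (fun ρ => Real.cos (ω * ρ)) (uIcc x y) := by fun_prop
  have hsin : ContinuousOn (fun ρ => Real.sin (ω * ρ)) (uIcc x y) := by fun_prop
  set F' : ℝ → ℝ := fun ρ => m * ρ ^ (m - 1) * Real.sin (ω * ρ) / ω + ρ ^ m * Real.cos (ω * ρ)
    with hF'
  have hF : ∀ ρ ∈ uIcc x y, HasDerivAt (fun ρ => ρ ^ m * Real.sin (ω * ρ) / ω) (F' ρ) ρ := by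
    intro ρ hρ
    have h1 := hasDerivAt_zpow m ρ (Or.inl (hpos ρ hρ).ne')
    have h2 := ((hasDerivAt_id ρ).const_mul ω).sin
    refine ((h1.mul h2).div_const ω).congr_deriv ?_
    simp only [hF', id]
    field_simp
  have cF' : ContinuousOn F' (uIcc x y) :=
    ((((continuousOn_const.mul (hz (m - 1))).mul hsin).div_const ω)).add ((hz m).mul hcos)
  have hint := intervalIntegral.integral_eq_sub_of_hasDerivAt hF cF'.intervalIntegrable
  have hmono : ∫ ρ in x..y, (ρ ^ m / 2 - F' ρ) ≤
      ∫ ρ in x..y, ρ ^ m * (3 / 4 - Real.cos (ω * ρ)) := by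
    refine intervalIntegral.integral_mono_on hxy
      (((hz m).div_const 2).sub cF').intervalIntegrable
      ((hz m).mul (continuousOn_const.sub hcos)).intervalIntegrable fun ρ hρ => ?_
    have hρ0 : 0 < ρ := hx.trans_le hρ.1
    have e : m * ρ ^ (m - 1) * Real.sin (ω * ρ) / ω =
        ρ ^ m * (m * Real.sin (ω * ρ) / (ω * ρ)) := by
      rw [zpow_sub_one₀ hρ0.ne']; field_simp
    have h1 : |m * Real.sin (ω * ρ) / (ω * ρ)| ≤ 1 / 4 := by
      rw [abs_div, abs_mul, abs_of_pos (by positivity : 0 < ω * ρ), div_le_iff₀ (by positivity)]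
      have h2 := mul_le_mul_of_nonneg_left (Real.abs_sin_le_one (ω * ρ)) (abs_nonneg (m : ℝ))
      have h3 := mul_le_mul_of_nonneg_left hρ.1 hω.le
      linarith
    have h2 := (abs_le.1 h1).1
    have h3 : 0 < ρ ^ m := zpow_pos hρ0 m
    simp only [hF']
    rw [e]
    nlinarith
  rw [intervalIntegral.integral_sub ((hz m).div_const 2).intervalIntegrable
    cF'.intervalIntegrable, hint, intervalIntegral.integral_div] at hmono
  have b : ∀ ρ, 0 < ρ → |ρ ^ m * Real.sin (ω * ρ) / ω| ≤ ρ ^ m / ω := fun ρ hρ => by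
    have h3 : 0 < ρ ^ m := zpow_pos hρ m
    rw [abs_div, abs_mul, abs_of_pos hω, abs_of_pos h3]
    gcongr
    exact mul_le_of_le_one_right h3.le (Real.abs_sin_le_one _)
  have bx := (abs_le.1 (b x hx)).1
  have by' := (abs_le.1 (b y hy)).2
  rw [add_div]
  linarith

theorem exists_le_integral_zpow_one {a ε : ℝ} (ha : 0 < a) (hε : 0 < ε) :
    ∃ k : ℝ, 0 < k ∧ ∀ᶠ t in atTop, ∃ x y, 0 < x ∧ x ≤ y ∧ y ≤ ε / √t ∧
      k * t ≤ ∫ ρ in x..y, ρ ^ (-2 : ℤ) * (3 / 4 - Real.cos (a * t * ρ)) := by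
  -- At the inner radius l/t the phase a t ρ equals 8 = 4|-2|, as the integration by parts requires.
  -- Half the main integral is then four times t/(8l) to leading order, and the inner boundary term
  -- costs one of these four.
  set l := 8 / a with hl
  have hl0 : 0 < l := by positivity
  have hal : a * l = 8 := by rw [hl]; field_simp
  refine ⟨1 / (8 * l), by positivity, ?_⟩
  have hs := Real.tendsto_sqrt_atTop
  filter_upwards [eventually_ge_atTop 1, hs.eventually_ge_atTop (l / ε),
    hs.eventually_ge_atTop (8 * l * (1 / (2 * ε) + 1 / (a * ε ^ 2)))] with t h1 h2 h3
  have ht : 0 < t := by linarith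
  have hst : 1 ≤ √t := by rwa [Real.one_le_sqrt]
  have hst0 : 0 < √t := by linarith
  have hsq : √t * √t = t := Real.mul_self_sqrt ht.le
  have hxy : l / t ≤ ε / √t := by
    rw [div_le_iff₀ hε] at h2
    rw [div_le_div_iff₀ ht hst0]
    nlinarith
  refine ⟨l / t, ε / √t, by positivity, hxy, le_rfl, ?_⟩
  refine le_trans ?_ (le_integral_zpow_mul_sub_cos (by positivity) (by positivity) hxy ?_)
  · rw [integral_zpow]
    · have e1 : (l / t) ^ (-2 : ℤ) = t ^ 2 / l ^ 2 := by
        rw [zpow_neg]; norm_cast; rw [div_pow, inv_div]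
      have e2 : (ε / √t) ^ (-2 : ℤ) = t / ε ^ 2 := by
        rw [zpow_neg]; norm_cast; rw [div_pow, inv_div, Real.sq_sqrt ht.le]
      have e3 : ((ε / √t) ^ (-2 + 1 : ℤ) - (l / t) ^ (-2 + 1 : ℤ)) / ((-2 : ℤ) + 1) =
          t / l - √t / ε := by
        norm_num; ring
      rw [e1, e2, e3]
      have e4 : (t ^ 2 / l ^ 2 + t / ε ^ 2) / (a * t) = t / (8 * l) + 1 / (a * ε ^ 2) := by
        rw [← hal]; field_simp
      rw [e4]
      have h5 : 1 / (2 * ε) + 1 / (a * ε ^ 2) ≤ √t / (8 * l) := by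
        rw [le_div_iff₀ (by positivity)]; linarith
      have h6 := mul_le_mul_of_nonneg_right h5 hst0.le
      have h7 : √t / (8 * l) * √t = t / (8 * l) := by rw [div_mul_eq_mul_div, hsq]
      have h8 : 1 / (a * ε ^ 2) ≤ 1 / (a * ε ^ 2) * √t := le_mul_of_one_le_right (by positivity) hst
      have h9 : t / l / 2 = 4 * (t / (8 * l)) := by field_simp; norm_num
      have h10 : √t / ε / 2 = 1 / (2 * ε) * √t := by field_simp
      have h11 : 0 ≤ t / (8 * l) := by positivity
      have h12 : 1 / (8 * l) * t = t / (8 * l) := by ring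
      rw [sub_div, h9, h10, h12]
      linarith
    · right
      refine ⟨by norm_num, ?_⟩
      rw [uIcc_of_le hxy]
      exact fun h => absurd h.1 (not_le.2 (by positivity))
  · have : a * t * (l / t) = 8 := by rw [← hal]; field_simp
    rw [this]; norm_num

theorem exists_le_integral_zpow_two {a ε : ℝ} (ha : 0 < a) (hε : 0 < ε) :
    ∃ k : ℝ, 0 < k ∧ ∀ᶠ t in atTop, ∃ x y, 0 < x ∧ x ≤ y ∧ y ≤ ε / √t ∧
      k * Real.log t ≤ ∫ ρ in x..y, ρ ^ (-1 : ℤ) * (3 / 4 - Real.cos (a * t * ρ)) := by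
  -- The phase at l/t is 4 = 4|-1|. The shell from l/t to ε/√t contributes (log t)/2 to leading
  -- order; the final 1/8 is half of the resulting 1/4.
  set l := 4 / a with hl
  have hl0 : 0 < l := by positivity
  have hal : a * l = 4 := by rw [hl]; field_simp
  refine ⟨1 / 8, by positivity, ?_⟩
  have hs := Real.tendsto_sqrt_atTop
  filter_upwards [eventually_ge_atTop 1, hs.eventually_ge_atTop (l / ε),
    Real.tendsto_log_atTop.eventually_ge_atTop
      (8 * (1 / 4 + 1 / (a * ε) + Real.log (l / ε) / 2))] with t h1 h2 h3
  have ht : 0 < t := by linarith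
  have hst : 1 ≤ √t := by rwa [Real.one_le_sqrt]
  have hst0 : 0 < √t := by linarith
  have hsq : √t * √t = t := Real.mul_self_sqrt ht.le
  have hxy : l / t ≤ ε / √t := by
    rw [div_le_iff₀ hε] at h2
    rw [div_le_div_iff₀ ht hst0]
    nlinarith
  refine ⟨l / t, ε / √t, by positivity, hxy, le_rfl, ?_⟩
  refine le_trans ?_ (le_integral_zpow_mul_sub_cos (by positivity) (by positivity) hxy ?_)
  · simp only [zpow_neg, zpow_one]
    rw [integral_inv_of_pos (by positivity) (by positivity)]
    have e1 : ε / √t / (l / t) = √t / (l / ε) := by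
      field_simp; rw [Real.sq_sqrt ht.le]
    rw [e1, Real.log_div (by positivity) (by positivity), Real.log_sqrt ht.le, inv_div, inv_div]
    have e2 : (t / l + √t / ε) / (a * t) = 1 / 4 + 1 / (a * ε) / √t := by
      rw [← hal]; field_simp; linear_combination l * hsq
    rw [e2]
    have : 1 / (a * ε) / √t ≤ 1 / (a * ε) := div_le_self (by positivity) hst
    linarith
  · have : a * t * (l / t) = 4 := by rw [← hal]; field_simp
    rw [this]; norm_num

theorem exists_le_integral_zpow_of_three_le (hn : 3 ≤ n) {a ε : ℝ} (ha : 0 < a) (hε : 0 < ε) :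
    ∃ k : ℝ, 0 < k ∧ ∀ᶠ t in atTop, ∃ x y, 0 < x ∧ x ≤ y ∧ y ≤ ε / √t ∧
      k * t ^ (-((n : ℝ) - 2) / 2) ≤
        ∫ ρ in x..y, ρ ^ ((n : ℤ) - 3) * (3 / 4 - Real.cos (a * t * ρ)) := by
  obtain ⟨m, rfl⟩ : ∃ m, n = m + 3 := ⟨n - 3, by omega⟩
  refine ⟨(ε / 2) ^ (m + 1) / 4, by positivity, ?_⟩
  have hs := Real.tendsto_sqrt_atTop
  filter_upwards [eventually_ge_atTop 1, hs.eventually_ge_atTop (8 * m / (a * ε)),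
    hs.eventually_ge_atTop (8 * (1 + 2 ^ m) / (a * ε))] with t h1 h2 h3
  have ht : 0 < t := by linarith
  have hst0 : 0 < √t := by positivity
  have hsq : √t * √t = t := Real.mul_self_sqrt ht.le
  -- For n ≥ 3 a single dyadic shell at scale t^{-1/2} carries the full rate. The phase there is of
  -- order √t, so the boundary terms become negligible.
  set x := ε / 2 / √t with hx
  have hx0 : 0 < x := by positivity
  have hxy : ε / √t = 2 * x := by rw [hx]; ring
  have htx : a * t * x = a * ε / 2 * √t := by
    calc a * t * x = a * ε / 2 * (t / √t) := by rw [hx]; ring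
      _ = _ := by rw [Real.div_sqrt]
  rw [div_le_iff₀ (by positivity)] at h2 h3
  refine ⟨x, 2 * x, hx0, by linarith, hxy.ge, ?_⟩
  have em : ((m + 3 : ℕ) : ℤ) - 3 = m := by push_cast; ring
  rw [em]
  refine le_trans ?_ (le_integral_zpow_mul_sub_cos (by positivity) hx0 (by linarith) ?_)
  · simp only [zpow_natCast]
    have i1 : x * x ^ m ≤ ∫ ρ in x..2 * x, ρ ^ m := by
      have : ∫ ρ in x..2 * x, x ^ m ≤ ∫ ρ in x..2 * x, ρ ^ m := by
        refine intervalIntegral.integral_mono_on (by linarith) (by simp)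
          (Continuous.intervalIntegrable (by fun_prop) _ _) fun ρ hρ => ?_
        have := hρ.1
        gcongr
      refine le_trans (le_of_eq ?_) this
      simp; left; ring
    have e1 : t ^ (-(((m + 3 : ℕ) : ℝ) - 2) / 2) = (1 / √t) ^ (m + 1) := by
      rw [one_div, ← Real.sqrt_inv, Real.sqrt_eq_rpow, ← Real.rpow_natCast,
        ← Real.rpow_mul (by positivity), Real.inv_rpow ht.le, ← Real.rpow_neg ht.le]
      congr 1; push_cast; ring
    have e2 : (ε / 2) ^ (m + 1) / 4 * (1 / √t) ^ (m + 1) = x * x ^ m / 4 := by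
      rw [← pow_succ', hx, div_pow (ε / 2) √t, one_div, inv_pow]; ring
    rw [e1, e2]
    have i2 : (x ^ m + (2 * x) ^ m) / (a * t) ≤ x * x ^ m / 4 := by
      rw [div_le_iff₀ (by positivity), mul_pow]
      have : x * x ^ m / 4 * (a * t) = x ^ m * (a * t * x) / 4 := by ring
      rw [this, htx]
      have hxm : 0 < x ^ m := by positivity
      have := mul_le_mul_of_nonneg_left h3 hxm.le
      linarith
    linarith
  · rw [htx]
    push_cast
    rw [abs_of_nonneg (by positivity)]
    linarith

theorem exists_growthRate_sq_le_integral (hn : 1 ≤ n) {a ε : ℝ} (ha : 0 < a) (hε : 0 < ε) :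
    ∃ k : ℝ, 0 < k ∧ ∀ᶠ t in atTop, ∃ x y, 0 < x ∧ x ≤ y ∧ y ≤ ε / √t ∧
      k * growthRate n t ^ 2 ≤
        ∫ ρ in x..y, ρ ^ ((n : ℤ) - 3) * (3 / 4 - Real.cos (a * t * ρ)) := by
  rcases (by omega : n = 1 ∨ n = 2 ∨ 3 ≤ n) with rfl | rfl | h3
  · obtain ⟨k, hk, h⟩ := exists_le_integral_zpow_one ha hε
    refine ⟨k, hk, ?_⟩
    filter_upwards [h, eventually_ge_atTop 1] with t h1 ht
    rw [growthRate_sq_one (by linarith)]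
    exact h1
  · obtain ⟨k, hk, h⟩ := exists_le_integral_zpow_two ha hε
    refine ⟨k, hk, ?_⟩
    filter_upwards [h, eventually_ge_atTop 1] with t h1 ht
    rw [growthRate_sq_two (by linarith)]
    exact h1
  · obtain ⟨k, hk, h⟩ := exists_le_integral_zpow_of_three_le h3 ha hε
    refine ⟨k, hk, ?_⟩
    filter_upwards [h, eventually_ge_atTop 1] with t h1 ht
    rw [growthRate_sq_of_three_le h3 (by linarith)]
    exact h1

/-! ### The lower bound. -/

/-- Squaring with (X + P/8)² ≤ 2X² + P²/32 and using 2 sin² S = 1 - cos 2S, the error P/8 lowers the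
constant from 1 to 3/4. -/
theorem mul_sq_sub_cos_le {P S X : ℝ} (hP : 0 ≤ P)
    (h : P * (|Real.sin S| / 2 - 1 / 8) ≤ X) :
    P ^ 2 * (3 / 4 - Real.cos (2 * S)) ≤ 16 * X ^ 2 := by
  have h1 : (P * |Real.sin S| / 2) ^ 2 ≤ (X + P / 8) ^ 2 := by
    gcongr
    linarith
  have h2 : (P * |Real.sin S| / 2) ^ 2 = P ^ 2 * Real.sin S ^ 2 / 4 := by
    rw [div_pow, mul_pow, sq_abs]; norm_num
  rw [h2] at h1
  rw [Real.cos_two_mul, Real.cos_sq']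
  nlinarith [sq_nonneg (X - P / 8)]

theorem norm_add₃_ge {u v w : ℂ} : ‖v‖ - ‖u‖ - ‖w‖ ≤ ‖u + v + w‖ := by
  have h : v = (u + v + w) - u - w := by ring
  have h1 := norm_sub_le ((u + v + w) - u) w
  have h2 := norm_sub_le (u + v + w) u
  rw [← h] at h1
  linarith

/-- Near ξ = 0 the factor φ̂₁ is close to P, and multiplication by r suppresses the bounded
contributions of φ₀ and T₀. The scale ε is free of the data; only r₀ depends on them, and it
restricts just how large t must be. -/
theorem exists_low_frequency_lower_bound (n : ℕ) (p : AcousticParams) :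
    ∃ ε : ℝ, 0 < ε ∧ ∀ φ₀ φ₁ T₀ : EuclideanSpace ℝ (Fin n) → ℝ,
      MemL1L2 φ₀ → MemL1L2 φ₁ → MemL1L2 T₀ → (∫ x, φ₁ x) ≠ 0 →
      ∀ φ φt T : ℝ → L2 n, IsSolution p φ₀ φ₁ T₀ φ φt T →
      ∃ r₀ : ℝ, 0 < r₀ ∧ ∀ t, 0 ≤ t → ∀ᵐ ξ : EuclideanSpace ℝ (Fin n),
        0 < ‖ξ‖ → ‖ξ‖ ≤ r₀ → ‖ξ‖ ^ 2 * t ≤ ε ^ 2 →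
        (∫ x, φ₁ x) ^ 2 * (3 / 4 - Real.cos (4 * Real.pi * √p.W * t * ‖ξ‖)) ≤
          64 * Real.pi ^ 2 * p.W * (‖ξ‖ ^ 2 * ‖realFourier (φ t) ξ‖ ^ 2) := by
  obtain ⟨C, hC, H⟩ := p.exists_multiplier_approx
  have hW : 0 < p.W := p.modeCoeff.W_pos
  have hw : 0 < √p.W := Real.sqrt_pos.2 hW
  have hπ := Real.pi_pos
  -- The errors are 2Cη · 2|P| from the oscillator approximation and Cη|P| from φ₀ and T₀. Their sum
  -- 5Cη|P| is at most |P|/8.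
  set η : ℝ := 1 / (40 * (C + 1)) with hη
  have hη0 : 0 < η := by positivity
  have hη1 : η ≤ 1 := by
    rw [hη, div_le_one (by positivity)]; linarith
  have hCη : 40 * (C * η) ≤ 1 := by
    rw [hη, mul_one_div, mul_div_assoc', div_le_one (by positivity)]; linarith
  refine ⟨√η / (2 * Real.pi), by positivity, fun φ₀ φ₁ T₀ m₀ m₁ m₂ hP φ φt T h => ?_⟩
  set P := ∫ x, φ₁ x
  set N₀ := (eLpNorm φ₀ 1 volume).toReal
  set N₂ := (eLpNorm T₀ 1 volume).toReal
  have hP0 : 0 < |P| := abs_pos.2 hP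
  have hN₀ : 0 ≤ N₀ := ENNReal.toReal_nonneg
  have hN₂ : 0 ≤ N₂ := ENNReal.toReal_nonneg
  have hcont : Tendsto (fun ξ => ‖𝓕 (fun x => (φ₁ x : ℂ)) ξ‖)
      (𝓝 (0 : EuclideanSpace ℝ (Fin n))) (𝓝 |P|) := by
    have := (continuous_fourier_ofReal m₁.1).norm.tendsto 0
    rwa [fourier_ofReal_zero, Complex.norm_real] at this
  obtain ⟨r₁, hr₁, hball⟩ := Metric.eventually_nhds_iff.1
    (hcont.eventually (Icc_mem_nhds (by linarith : |P| / 2 < |P|) (by linarith : |P| < 2 * |P|)))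
  set D := √p.W * (N₀ + N₂) + 1
  have hD : 0 < D := by positivity
  refine ⟨min (r₁ / 2) (min (η / (2 * Real.pi)) (η * |P| / D / (2 * Real.pi))), by positivity,
    fun t ht => ?_⟩
  filter_upwards [h.realFourier_ae_eq ht, realFourier_ae_eq m₁.1 h.init_φt,
    ae_norm_realFourier_le m₀.1 h.init_φ, ae_norm_realFourier_le m₂.1 h.init_T]
    with ξ e e₁ b₀ b₂ hξ0 hξ hξt
  simp only [le_min_iff] at hξ
  obtain ⟨c1, c2, c3⟩ := hξ
  obtain ⟨a1, a2⟩ := hball (show dist ξ 0 < r₁ by rw [dist_zero_right]; linarith)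
  rw [← e₁] at a1 a2
  set r := 2 * Real.pi * ‖ξ‖ with hr
  have hr0 : 0 < r := by positivity
  rw [le_div_iff₀ (by positivity)] at c2 c3
  have hrη : r ≤ η := by rw [hr]; linarith
  have hrD : r * D ≤ η * |P| := by
    rw [← le_div_iff₀ hD, hr]; linarith
  have hrt : r ^ 2 * t ≤ η := by
    have : (√η / (2 * Real.pi)) ^ 2 = η / (2 * Real.pi) ^ 2 := by
      rw [div_pow, Real.sq_sqrt hη0.le]
    rw [this, le_div_iff₀ (by positivity)] at hξt
    rw [hr]; linarith
  have hs : symb ξ = r ^ 2 := by rw [hr, symb]; ring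
  obtain ⟨B₀, B₂, B₁⟩ := H r t hr0 (hrη.trans hη1) ht (hrt.trans hη1)
  rw [hs] at e
  set v := realFourier (φ t) ξ
  have hv := norm_add₃_ge (u := (p.multiplier 0 t (r ^ 2) : ℂ) * realFourier (φ 0) ξ)
    (v := (p.multiplier 1 t (r ^ 2) : ℂ) * realFourier (φt 0) ξ)
    (w := (p.multiplier 2 t (r ^ 2) : ℂ) * realFourier (T 0) ξ)
  rw [← e] at hv
  simp only [norm_mul, Complex.norm_real, Real.norm_eq_abs] at hv
  have k₀ := mul_le_mul B₀ b₀ (norm_nonneg _) hC.le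
  have k₂ := mul_le_mul B₂ b₂ (norm_nonneg _) hC.le
  have k₁ : |Real.sin (√p.W * r * t)| - 2 * C * η ≤ √p.W * r * |p.multiplier 1 t (r ^ 2)| := by
    have := abs_sub_abs_le_abs_sub (Real.sin (√p.W * r * t)) (√p.W * r * p.multiplier 1 t (r ^ 2))
    rw [abs_sub_comm] at this
    rw [abs_mul (√p.W * r), abs_of_pos (by positivity : 0 < √p.W * r)] at this
    have h1 := mul_le_mul_of_nonneg_left (add_le_add hrη hrt) hC.le
    linarith
  have main : |P| * (|Real.sin (√p.W * r * t)| / 2 - 1 / 8) ≤ √p.W * r * ‖v‖ := by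
    have s1 := mul_le_mul_of_nonneg_left hv (by positivity : 0 ≤ √p.W * r)
    have s2 := mul_le_mul_of_nonneg_right k₁ (norm_nonneg (realFourier (φt 0) ξ))
    have s3 := mul_le_mul_of_nonneg_left (add_le_add k₀ k₂) (by positivity : 0 ≤ √p.W * r)
    have s4 : √p.W * r * (C * N₀ + C * N₂) ≤ C * η * |P| := by
      have hD1 : √p.W * (N₀ + N₂) ≤ D := le_add_of_nonneg_right zero_le_one
      have := mul_le_mul_of_nonneg_left (mul_le_mul_of_nonneg_left hD1 hr0.le) hC.le
      have := mul_le_mul_of_nonneg_left hrD hC.le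
      calc _ = C * (r * (√p.W * (N₀ + N₂))) := by ring
        _ ≤ _ := by linarith
    have s5 := mul_le_mul_of_nonneg_left a1 (abs_nonneg (Real.sin (√p.W * r * t)))
    have s6 := mul_le_mul_of_nonneg_left a2 (by positivity : 0 ≤ 2 * C * η)
    have s7 := mul_le_mul_of_nonneg_right hCη hP0.le
    linarith
  have fin := mul_sq_sub_cos_le hP0.le main
  rw [sq_abs] at fin
  have ec : 2 * (√p.W * r * t) = 4 * Real.pi * √p.W * t * ‖ξ‖ := by rw [hr]; ring
  have er : 16 * (√p.W * r * ‖v‖) ^ 2 = 64 * Real.pi ^ 2 * p.W * (‖ξ‖ ^ 2 * ‖v‖ ^ 2) := by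
    rw [mul_pow, mul_pow, Real.sq_sqrt hW.le, hr]; ring
  rwa [ec, er] at fin

theorem exists_growthRate_le_norm (p : AcousticParams) (hn : 1 ≤ n) :
    ∃ c : ℝ, 0 < c ∧ ∀ φ₀ φ₁ T₀ : EuclideanSpace ℝ (Fin n) → ℝ,
      MemL1L2 φ₀ → MemL1L2 φ₁ → MemL1L2 T₀ → (∫ x, φ₁ x) ≠ 0 →
      ∀ φ φt T : ℝ → L2 n, IsSolution p φ₀ φ₁ T₀ φ φt T →
      ∀ᶠ t in atTop, c * growthRate n t * |∫ x, φ₁ x| ≤ ‖φ t‖ := by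
  obtain ⟨ε, hε, H⟩ := exists_low_frequency_lower_bound n p
  have hW : 0 < p.W := p.modeCoeff.W_pos
  have ha : 0 < 4 * Real.pi * √p.W := by positivity
  set a := 4 * Real.pi * √p.W
  obtain ⟨k, hk, hgrowth⟩ := exists_growthRate_sq_le_integral hn ha hε
  set V := n * volume.real (Metric.ball (0 : EuclideanSpace ℝ (Fin n)) 1) with hV
  have hV0 : 0 < V := by
    have h1 : 0 < volume.real (Metric.ball (0 : EuclideanSpace ℝ (Fin n)) 1) :=
      ENNReal.toReal_pos (Metric.measure_ball_pos _ _ one_pos).ne' measure_ball_lt_top.ne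
    have h2 : (0 : ℝ) < n := by exact_mod_cast hn
    positivity
  set K := 64 * Real.pi ^ 2 * p.W
  have hK : 0 < K := by positivity
  refine ⟨√(V * k / K), by positivity, fun φ₀ φ₁ T₀ m₀ m₁ m₂ hP φ φt T h => ?_⟩
  obtain ⟨r₀, hr₀, hb⟩ := H φ₀ φ₁ T₀ m₀ m₁ m₂ hP φ φt T h
  set P := ∫ x, φ₁ x
  filter_upwards [hgrowth, eventually_ge_atTop 3,
    Real.tendsto_sqrt_atTop.eventually_ge_atTop (ε / r₀)] with t hg ht hst
  obtain ⟨x, y, hx, hxy, hy, hint⟩ := hg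
  have ht0 : 0 < t := by linarith
  have hst0 : 0 < √t := Real.sqrt_pos.2 ht0
  have hyr : y ≤ r₀ := by
    refine hy.trans ?_
    rw [div_le_iff₀ hr₀] at hst
    rw [div_le_iff₀ hst0]
    linarith
  -- This minorant may be negative inside the shell, which is harmless: the pointwise comparison
  -- with |φ̂|² still holds there, and it is trivial outside.
  set f : ℝ → ℝ := (Ioc x y).indicator fun ρ => (ρ ^ 2)⁻¹ * (3 / 4 - Real.cos (a * t * ρ))
    with hf
  have hmul : (fun ρ => ρ ^ (n - 1) * f ρ) =
      (Ioc x y).indicator fun ρ => ρ ^ ((n : ℤ) - 3) * (3 / 4 - Real.cos (a * t * ρ)) := by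
    ext ρ
    simp only [hf, indicator_apply]
    split_ifs with hρ
    · have hρ0 : 0 < ρ := hx.trans hρ.1
      rw [← mul_assoc, show (n : ℤ) - 3 = ((n - 1 : ℕ) : ℤ) - (2 : ℕ) by omega,
        zpow_sub₀ hρ0.ne', zpow_natCast, zpow_natCast, div_eq_mul_inv (ρ ^ (n - 1))]
    · simp
  have hfi : Integrable (fun ρ => ρ ^ (n - 1) * f ρ) := by
    rw [hmul, integrable_indicator_iff measurableSet_Ioc]
    refine (ContinuousOn.integrableOn_Icc ?_).mono_set Ioc_subset_Icc_self
    exact (continuousOn_id.zpow₀ _ fun ρ hρ => Or.inl (hx.trans_le hρ.1).ne').mul (by fun_prop)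
  have hfint : ∫ ξ : EuclideanSpace ℝ (Fin n), f ‖ξ‖ =
      V * ∫ ρ in x..y, ρ ^ ((n : ℤ) - 3) * (3 / 4 - Real.cos (a * t * ρ)) := by
    rw [integral_norm_euclidean hn, hmul, setIntegral_indicator measurableSet_Ioc,
      inter_eq_self_of_subset_right (Ioc_subset_Ioi_self.trans (Ioi_subset_Ioi hx.le)),
      ← intervalIntegral.integral_of_le hxy]
  have hlow : P ^ 2 / K * ∫ ξ : EuclideanSpace ℝ (Fin n), f ‖ξ‖ ≤ ‖φ t‖ ^ 2 := by
    rw [← norm_realFourier, norm_sq_eq_integral_norm_sq, ← integral_const_mul]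
    refine integral_mono_ae ((integrable_norm_euclidean hn hfi.integrableOn).const_mul _)
      (integrable_norm_sq _) ?_
    filter_upwards [hb t ht0.le] with ξ hξ
    by_cases hm : ‖ξ‖ ∈ Ioc x y
    · have hξ0 : 0 < ‖ξ‖ := hx.trans hm.1
      have := hξ hξ0 (hm.2.trans hyr) (by
        have : ‖ξ‖ ≤ ε / √t := hm.2.trans hy
        rw [le_div_iff₀ hst0] at this
        calc ‖ξ‖ ^ 2 * t = (‖ξ‖ * √t) ^ 2 := by rw [mul_pow, Real.sq_sqrt ht0.le]
          _ ≤ ε ^ 2 := by gcongr)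
      simp only [hf, indicator_of_mem hm]
      rw [div_mul_eq_mul_div, div_le_iff₀ hK, ← mul_assoc, mul_comm (P ^ 2), mul_assoc,
        inv_mul_le_iff₀ (by positivity)]
      linarith
    · simp only [hf, indicator_of_notMem hm, mul_zero]
      positivity
  rw [hfint] at hlow
  refine le_of_sq_le_sq ?_ (norm_nonneg _)
  refine le_trans ?_ hlow
  rw [mul_pow, mul_pow, Real.sq_sqrt (by positivity), sq_abs]
  calc V * k / K * growthRate n t ^ 2 * P ^ 2 = P ^ 2 / K * (V * (k * growthRate n t ^ 2)) := by ring
    _ ≤ _ := by gcongr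

/-! ### The main theorem. -/

theorem theorem2p2 (n : ℕ) (hn : 1 ≤ n) (p : AcousticParams) :
    -- the Cauchy problem has exactly one solution
    (∀ φ₀ φ₁ T₀ : EuclideanSpace ℝ (Fin n) → ℝ, MemL1L2 φ₀ → MemL1L2 φ₁ → MemL1L2 T₀ →
      (∃ φ φt T : ℝ → L2 n, IsSolution p φ₀ φ₁ T₀ φ φt T) ∧
      (∀ φ φt T φ' φt' T' : ℝ → L2 n,
        IsSolution p φ₀ φ₁ T₀ φ φt T → IsSolution p φ₀ φ₁ T₀ φ' φt' T' →
        ∀ t, 0 ≤ t → φ t = φ' t ∧ φt t = φt' t ∧ T t = T' t)) ∧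
    -- `c`, `C`, `t₁` depend on the dimension and the physical constants only, `t₀` on the data too
    (∃ c C t₁ : ℝ, 0 < c ∧ 0 < C ∧ 1 < t₁ ∧
      ∀ φ₀ φ₁ T₀ : EuclideanSpace ℝ (Fin n) → ℝ, MemL1L2 φ₀ → MemL1L2 φ₁ → MemL1L2 T₀ →
      ∀ φ φt T : ℝ → L2 n, IsSolution p φ₀ φ₁ T₀ φ φt T →
        (∀ t, t₁ ≤ t →
          ‖φ t‖ ≤ C * growthRate n t * (normL1L2 φ₀ + normL1L2 φ₁ + normL1L2 T₀)) ∧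
        ((∫ x, φ₁ x) ≠ 0 →
          (∃ t₀ : ℝ, 1 < t₀ ∧ ∀ t, t₀ ≤ t → c * growthRate n t * |∫ x, φ₁ x| ≤ ‖φ t‖) ∧
          (fun t => ‖φ t‖) =Θ[atTop] growthRate n)) := by
  obtain ⟨C, hC, upper⟩ := exists_norm_le_growthRate p hn
  obtain ⟨c, hc, lower⟩ := exists_growthRate_le_norm p hn
  refine ⟨fun φ₀ φ₁ T₀ m₀ m₁ m₂ => ⟨exists_isSolution p m₀.2 m₁.2 m₂.2,
    fun φ φt T φ' φt' T' h h' t ht => h.unique h' ht⟩, c, C, 3, hc, hC, by norm_num,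
    fun φ₀ φ₁ T₀ m₀ m₁ m₂ φ φt T h => ⟨upper φ₀ φ₁ T₀ m₀ m₁ m₂ φ φt T h, fun hP => ?_⟩⟩
  have low := lower φ₀ φ₁ T₀ m₀ m₁ m₂ hP φ φt T h
  refine ⟨?_, ?_, ?_⟩
  · obtain ⟨t₀, ht₀⟩ := eventually_atTop.1 low
    exact ⟨max t₀ 2, by simp, fun t ht => ht₀ t ((le_max_left _ _).trans ht)⟩
  · refine IsBigO.of_bound (C * (normL1L2 φ₀ + normL1L2 φ₁ + normL1L2 T₀)) ?_
    filter_upwards [eventually_ge_atTop 3] with t ht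
    rw [norm_norm, Real.norm_of_nonneg (growthRate_pos ht).le]
    linarith [upper φ₀ φ₁ T₀ m₀ m₁ m₂ φ φt T h t ht]
  · refine IsBigO.of_bound (1 / (c * |∫ x, φ₁ x|)) ?_
    filter_upwards [low, eventually_ge_atTop 3] with t h1 ht
    have : 0 < c * |∫ x, φ₁ x| := mul_pos hc (abs_pos.2 hP)
    rw [norm_norm, Real.norm_of_nonneg (growthRate_pos ht).le, one_div, ← div_eq_inv_mul,
      le_div_iff₀ this]
    linarith
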